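/- **Corollary 4.11.** For a $k\times k$ matrix $A=(a_{ij})$ of zeros and ones let $X_A=\{(x_n)_{n\ge1}\in\{1,\dots,k\}^{\mathbb N}: a_{x_nx_{n+1}}=1 \text{ for all } n\}$ with the shift $\sigma$; $B_n(X_A)$ is the set of words of length $n$ that appear in points of $X_A$, and $X_A$ is irreducible if for all words $u,v$ that appear in points of $X_A$ there is such a $w$ with $uwv$ also appearing. Let $X=X_A\subseteq\{1,2,3\}^{\mathbb N}$ be an irreducible shift of finite type, and let $Y\subseteq\{1,2\}^{\mathbb N}$ be the full shift or the shift of finite type with transition matrix $\begin{pmatrix}0&1\\1&1\end{pmatrix}$. Let $\pi:X\to Y$ be a factor map (continuous, surjective, commuting with the shifts) that is the one-block code given by $1\mapsto1$, $2\mapsto2$, $3\mapsto2$. Let $f:X\to\mathbb R$ depend only on the first two coordinates, and write $f[ij]$ for its value on a nonempty cylinder $[ij]$. Write $S_nf=\sum_{i=0}^{n-1}f\circ\sigma^i$. For $y\in Y$ and $n\ge1$ let $$g_n(y)=\sup_{E_n(y)}\sum_{x\in E_n(y)}e^{(S_nf)(x)},$$ the supremum over all sets $E_n(y)$ consisting of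 exactly one point from each nonempty cylinder $[x_1\cdots x_n]$ of $X$ with $\pi(x_1\cdots x_n)=y_1\cdots y_n$, and let $\mathcal G=\{\log g_n\}_{n\ge1}$. $\mathcal G$ is *weakly almost additive* if there are $C_n>0$ with $C_n/n\to0$ and $$e^{-C_n}g_n(y)\,g_m(\sigma^ny)\le g_{n+m}(y)\le e^{C_n}g_n(y)\,g_m(\sigma^ny)\quad\text{for all } y\in Y,\ n,m\ge1,$$ and *almost additive* if $C_n=C$ can be taken independent of $n$. A Borel probability measure $\nu$ on $Y$ is a *weak Gibbs measure* for a Borel function $\hat g:Y\to\mathbb R$ if there are $P\in\mathbb R$ and $C_n>0$ with $\frac1n\log C_n\to0$ and $$\frac1{C_n}\le\frac{\nu[y_1\cdots y_n]}{e^{-nP}e^{(S_n\hat g)(y)}}\le C_n\quad\text{for all } y\in Y,\ n\ge1,$$ and a *Gibbs measure* for $\hat g$ if $C_n=C$ can be taken independent of $n$. "Invariant" means $\sigma$-invariant, and "unique" means that there is exactly one invariant Borel probability measure with the property. Consider the condition $$\lim_{n\to\infty}\frac1n\|\log g_n-S_n\hat g\|_\infty=0,\tag{$*$}$$ where $\|\cdot\|_\infty$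 is the supremum norm over $Y$. (i) $\mathcal G$ is almost additive if and only if there is a Borel measurable $\hat g:Y\to\mathbb R$ satisfying $(*)$ for which there is a unique invariant Gibbs measure. If $\mathcal G$ is weakly almost additive, then there is a Borel measurable $\hat g:Y\to\mathbb R$ satisfying $(*)$ for which there is a unique invariant weak Gibbs measure. (ii) Let $M(i,j)=e^{f[ij]}$ if $ij\in B_2(X)$ and $M(i,j)=0$ otherwise ($i,j\in\{1,2,3\}$), and let $N=(M(i,j))_{i,j\in\{2,3\}}$. Suppose that either $N$ is not of the form $\begin{pmatrix}0&a_1\\a_2&0\end{pmatrix}$ with $a_1,a_2>0$, or $N=\begin{pmatrix}0&a_1\\a_1&0\end{pmatrix}$ for some $a_1>0$ and moreover $M(2,1)=M(3,1)$ or $M(1,2)=M(1,3)$. Then both statements of (i) hold with "Borel measurable $\hat g:Y\to\mathbb R$" replaced by "continuous $\hat g:Y\to\mathbb R$". -/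

import Mathlib

open MeasureTheory Filter Topology

namespace RelPressure

/-- The one-sided shift of finite type `X_A` over the alphabet `Fin k` with transition matrix `A`. -/
def SFT {k : ℕ} (A : Matrix (Fin k) (Fin k) ℕ) : Set (ℕ → Fin k) :=
  {x | ∀ n, A (x n) (x (n + 1)) = 1}

/-- The shift map `σ` of `X_A`. -/
def shift {k : ℕ} (A : Matrix (Fin k) (Fin k) ℕ) (x : SFT A) : SFT A :=
  ⟨fun i => x.1 (i + 1), fun n => x.2 (n + 1)⟩

/-- `B_n(X)`: the words of length `n` that appear in points of `X`. -/
def blocks {α : Type*} (X : Set (ℕ → α)) (n : ℕ) : Set (Fin n → α) :=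
  {w | ∃ x ∈ X, ∃ m : ℕ, ∀ i : Fin n, x (m + i) = w i}

/-- Irreducibility: for all allowable words `u`, `v` there is an allowable `w` with `uwv` allowable. -/
def IsIrreducible {α : Type*} (X : Set (ℕ → α)) : Prop :=
  ∀ (l n : ℕ), ∀ u ∈ blocks X l, ∀ v ∈ blocks X n,
    ∃ m : ℕ, ∃ w ∈ blocks X m, Fin.append (Fin.append u w) v ∈ blocks X (l + m + n)

/-- A factor map between shifts of finite type: continuous, onto, commuting with the shifts. -/
structure IsFactorMap {k l : ℕ} {A : Matrix (Fin k) (Fin k) ℕ} {B : Matrix (Fin l) (Fin l) ℕ}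
    (π : SFT A → SFT B) : Prop where
  continuous : Continuous π
  surjective : Function.Surjective π
  semiconj : Function.Semiconj π (shift A) (shift B)

/-- `π` is the one-block code induced by the map `p` of the alphabets. -/
def IsOneBlockCode {k l : ℕ} {A : Matrix (Fin k) (Fin k) ℕ} {B : Matrix (Fin l) (Fin l) ℕ}
    (π : SFT A → SFT B) (p : Fin k → Fin l) : Prop :=
  ∀ (x : SFT A) (i : ℕ), (π x).1 i = p (x.1 i)

/-- The words of `B_n(X_A)` that the one-block code `p` sends to `y_1 ⋯ y_n`. -/
def fiberBlocks {k l : ℕ} (A : Matrix (Fin k) (Fin k) ℕ) (p : Fin k → Fin l)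
    (n : ℕ) (y : ℕ → Fin l) : Set (Fin n → Fin k) :=
  {w | w ∈ blocks (SFT A) n ∧ ∀ i : Fin n, p (w i) = y i}

/-- `E` consists of exactly one point from each cylinder `[x_1 ⋯ x_n]` of `X_A` with
`p (x_1 ⋯ x_n) = y_1 ⋯ y_n`. -/
def IsSelection {k l : ℕ} (A : Matrix (Fin k) (Fin k) ℕ) (p : Fin k → Fin l)
    (n : ℕ) (y : ℕ → Fin l) (E : Finset (SFT A)) : Prop :=
  (∀ x ∈ E, (fun i : Fin n => x.1 i) ∈ fiberBlocks A p n y) ∧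
    ∀ w ∈ fiberBlocks A p n y, ∃! x : SFT A, x ∈ E ∧ ∀ i : Fin n, x.1 i = w i

/-- `g_n(y) = sup_E ∑_{x ∈ E} exp (S_n f (x))`; the functions `log g_n` form the sequence associated
to the relative pressure function of `f`. -/
noncomputable def relSeq {k l : ℕ} {A : Matrix (Fin k) (Fin k) ℕ} {B : Matrix (Fin l) (Fin l) ℕ}
    (p : Fin k → Fin l) (f : SFT A → ℝ) (n : ℕ) (y : SFT B) : ℝ :=
  sSup {s | ∃ E : Finset (SFT A), IsSelection A p n y.1 E ∧
    s = ∑ x ∈ E, Real.exp (birkhoffSum (shift A) f n x)}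

/-- Almost additivity of `{log F_n}` (for `n ≥ 1`). -/
def AlmostAdditive {k : ℕ} {B : Matrix (Fin k) (Fin k) ℕ} (F : ℕ → SFT B → ℝ) : Prop :=
  ∃ C : ℝ, 0 < C ∧ ∀ n m : ℕ, 1 ≤ n → 1 ≤ m → ∀ y : SFT B,
    F (n + m) y ≤ Real.exp C * F n y * F m ((shift B)^[n] y) ∧
    Real.exp (-C) * F n y * F m ((shift B)^[n] y) ≤ F (n + m) y

/-- Weak almost additivity of `{log F_n}` (for `n ≥ 1`). -/
def WeaklyAlmostAdditive {k : ℕ} {B : Matrix (Fin k) (Fin k) ℕ} (F : ℕ → SFT B → ℝ) : Prop :=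
  ∃ C : ℕ → ℝ, (∀ n, 1 ≤ n → 0 < C n) ∧ Tendsto (fun n : ℕ => C n / n) atTop (𝓝 0) ∧
    ∀ n m : ℕ, 1 ≤ n → 1 ≤ m → ∀ y : SFT B,
      F (n + m) y ≤ Real.exp (C n) * F n y * F m ((shift B)^[n] y) ∧
      Real.exp (-C n) * F n y * F m ((shift B)^[n] y) ≤ F (n + m) y

/-- The cylinder `[y_1 ⋯ y_n]`. -/
def cylinder {k : ℕ} {B : Matrix (Fin k) (Fin k) ℕ} (y : SFT B) (n : ℕ) : Set (SFT B) :=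
  {z | ∀ i < n, z.1 i = y.1 i}

/-- The shift-invariant Borel probability measures. -/
def IsInvariant {k : ℕ} {B : Matrix (Fin k) (Fin k) ℕ} (μ : Measure (SFT B)) : Prop :=
  IsProbabilityMeasure μ ∧ MeasurePreserving (shift B) μ μ

/-- `1 / C_n ≤ μ[y_1 ⋯ y_n] / (exp (-nP) exp (S_n g (y))) ≤ C_n` for all `y` and all `n ≥ 1`. -/
def GibbsBounds {k : ℕ} {B : Matrix (Fin k) (Fin k) ℕ} (μ : Measure (SFT B)) (g : SFT B → ℝ)
    (P : ℝ) (C : ℕ → ℝ) : Prop :=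
  ∀ n : ℕ, 1 ≤ n → ∀ y : SFT B,
    1 / C n ≤ μ.real (cylinder y n) /
        (Real.exp (-(n * P)) * Real.exp (birkhoffSum (shift B) g n y)) ∧
      μ.real (cylinder y n) /
        (Real.exp (-(n * P)) * Real.exp (birkhoffSum (shift B) g n y)) ≤ C n

/-- `μ` is a Gibbs measure for the function `g`. -/
def IsGibbs {k : ℕ} {B : Matrix (Fin k) (Fin k) ℕ} (μ : Measure (SFT B)) (g : SFT B → ℝ) : Prop :=
  ∃ (P C : ℝ), 0 < C ∧ GibbsBounds μ g P (fun _ => C)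

/-- `μ` is a weak Gibbs measure for the function `g`. -/
def IsWeakGibbs {k : ℕ} {B : Matrix (Fin k) (Fin k) ℕ} (μ : Measure (SFT B)) (g : SFT B → ℝ) :
    Prop :=
  ∃ (P : ℝ) (C : ℕ → ℝ), (∀ n, 1 ≤ n → 0 < C n) ∧
    Tendsto (fun n : ℕ => Real.log (C n) / n) atTop (𝓝 0) ∧ GibbsBounds μ g P C

/-- `(1/n) ‖log F_n - S_n g‖_∞ → 0`; the sup norm is taken with values in `[0, ∞]`. -/
def Approximates {k : ℕ} {B : Matrix (Fin k) (Fin k) ℕ} (F : ℕ → SFT B → ℝ) (g : SFT B → ℝ) :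
    Prop :=
  Tendsto (fun n : ℕ => (⨆ y : SFT B, ‖Real.log (F n y) - birkhoffSum (shift B) g n y‖ₑ) / n)
    atTop (𝓝 0)

open Classical in
/-- The matrix `M`: `M(i,j) = exp (f[ij])` if `ij ∈ B_2(X_A)` and `0` otherwise, where `f[ij]`
(given by `φ i j`) is the value of `f` on the cylinder `[ij]`. -/
noncomputable def weightMatrix {k : ℕ} (A : Matrix (Fin k) (Fin k) ℕ) (φ : Fin k → Fin k → ℝ) :
    Matrix (Fin k) (Fin k) ℝ :=
  Matrix.of fun i j => if ![i, j] ∈ blocks (SFT A) 2 then Real.exp (φ i j) else 0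

/-- The symbol map `1 ↦ 1`, `2 ↦ 2`, `3 ↦ 2` (the symbols `1, 2, 3` being `0, 1, 2` here). -/
def code : Fin 3 → Fin 2 := ![0, 1, 1]

/-- The restriction of `M` to the symbols `2, 3` over the symbol `2`. -/
noncomputable def block22 (A : Matrix (Fin 3) (Fin 3) ℕ) (φ : Fin 3 → Fin 3 → ℝ) :
    Matrix (Fin 2) (Fin 2) ℝ :=
  (weightMatrix A φ).submatrix ![1, 2] ![1, 2]

end RelPressure

/-!
Write `0, 1` for the symbols of `Y` and let `M` be the matrix of weights `e^{f[ij]}`. Its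
Perron-Frobenius eigenvectors turn `M` into a Markov measure on `X`, whose projection `ν` to `Y`
satisfies `g_n(y) ≍ tⁿ ν[y_1 ⋯ y_n]`, where `t` is the Perron-Frobenius eigenvalue. Since `0` has a
single preimage, it is a renewal symbol of `ν`: past and future are independent given a `0`.

Hence the function `log (ν[y_0 ⋯ y_m] / ν[y_1 ⋯ y_m])`, where `m` is the first return time of `y` to
the symbol `0`, has telescoping Birkhoff sums up to the last occurrence of `0`; on the remaining run
`1 1 ⋯ 1` the additivity of `log g_n` controls the error. This gives the potential.

For uniqueness, an invariant measure whose cylinder masses are subexponentially comparable with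
those of `ν` agrees with `ν`: the indicator of `[0 v_2 ⋯ v_q]`, centred given the first symbol, has
`ν`-mean zero given the past, so that large deviations of its averages are exponentially unlikely
under `ν`, hence under the other measure too, where its mean must therefore vanish.

The potential is continuous as soon as `ν[b 1ᵐ 0] / ν[1ᵐ 0]` converges as `m → ∞`. Numerator and
denominator solve the linear recurrence given by the characteristic polynomial of the `2 × 2` block
of `M / t` over the symbol `1`, and the ratio can oscillate only if that block has trace zero.
-/

namespace RelPressure

open scoped Matrix

section LinearRecurrence

variable {s u : ℕ → ℝ} {τ δ K : ℝ}

lemma div_sub_div_of_recurrence (hs : ∀ j, 0 < s j)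
    (hsr : ∀ j, s (j + 2) = τ * s (j + 1) - δ * s j)
    (hur : ∀ j, u (j + 2) = τ * u (j + 1) - δ * u j) (j : ℕ) :
    u (j + 2) / s (j + 2) - u (j + 1) / s (j + 1) =
      δ * s j / s (j + 2) * (u (j + 1) / s (j + 1) - u j / s j) := by
  have h0 := (hs j).ne'
  have h1 := (hs (j + 1)).ne'
  have h2 := (hs (j + 2)).ne'
  field_simp
  rw [hsr, hur]
  ring

lemma monotone_or_antitone_div_of_recurrence (hs : ∀ j, 0 < s j)
    (hsr : ∀ j, s (j + 2) = τ * s (j + 1) - δ * s j)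
    (hur : ∀ j, u (j + 2) = τ * u (j + 1) - δ * u j) (hδ : 0 ≤ δ) :
    Monotone (fun j => u j / s j) ∨ Antitone fun j => u j / s j := by
  have hfactor (j) : 0 ≤ δ * s j / s (j + 2) :=
    div_nonneg (mul_nonneg hδ (hs j).le) (hs (j + 2)).le
  have hstep := div_sub_div_of_recurrence hs hsr hur
  rcases le_total (u 0 / s 0) (u 1 / s 1) with h | h
  · refine .inl (monotone_nat_of_le_succ fun j => sub_nonneg.1 ?_)
    induction j with
    | zero => exact sub_nonneg.2 h
    | succ j ih => exact hstep j ▸ mul_nonneg (hfactor j) ih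
  · refine .inr (antitone_nat_of_succ_le fun j => sub_nonpos.1 ?_)
    induction j with
    | zero => exact sub_nonpos.2 h
    | succ j ih => exact hstep j ▸ mul_nonpos_of_nonneg_of_nonpos (hfactor j) ih

lemma cauchySeq_div_of_recurrence (hs : ∀ j, 0 < s j)
    (hsr : ∀ j, s (j + 2) = τ * s (j + 1) - δ * s j)
    (hur : ∀ j, u (j + 2) = τ * u (j + 1) - δ * u j) (hδ : δ < 0) (hτ : 0 < τ) :
    CauchySeq fun j => u j / s j := by
  set θ := -δ / (τ ^ 2 - δ) with hθ
  have hden : 0 < τ ^ 2 - δ := by nlinarith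
  have hθ0 : 0 ≤ θ := div_nonneg (neg_nonneg.2 hδ.le) hden.le
  have hθ1 : θ < 1 := (div_lt_one hden).2 (by nlinarith)
  have hgrowth (j) : τ * s (j + 1) ≤ s (j + 2) := by
    rw [hsr]; nlinarith [mul_pos_of_neg_of_neg hδ (neg_neg_of_pos (hs j))]
  have hfactor (j) : |δ * s (j + 1) / s (j + 3)| ≤ θ := by
    rw [abs_div, abs_mul, abs_of_neg hδ, abs_of_pos (hs _), abs_of_pos (hs _), hθ,
      div_le_div_iff₀ (hs _) hden, hsr (j + 1)]
    nlinarith [mul_le_mul_of_nonneg_left (hgrowth j) hτ.le]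
  rw [← cauchySeq_shift 1]
  refine cauchySeq_of_le_geometric θ |u 2 / s 2 - u 1 / s 1| hθ1 fun j => ?_
  rw [Real.dist_eq, abs_sub_comm]
  induction j with
  | zero => simp
  | succ j ih =>
    rw [div_sub_div_of_recurrence hs hsr hur (j + 1), abs_mul, pow_succ']
    calc |δ * s (j + 1) / s (j + 3)| * |u (j + 2) / s (j + 2) - u (j + 1) / s (j + 1)|
        ≤ θ * (|u 2 / s 2 - u 1 / s 1| * θ ^ j) := by gcongr; exact hfactor j
      _ = |u 2 / s 2 - u 1 / s 1| * (θ * θ ^ j) := by ring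

lemma exists_tendsto_div_of_recurrence (hs : ∀ j, 0 < s j)
    (hsr : ∀ j, s (j + 2) = τ * s (j + 1) - δ * s j)
    (hur : ∀ j, u (j + 2) = τ * u (j + 1) - δ * u j) (hδ : δ < 0 → 0 < τ)
    (hK : ∀ j, |u j / s j| ≤ K) : ∃ L, Tendsto (fun j => u j / s j) atTop (𝓝 L) := by
  rcases lt_or_ge δ 0 with hneg | hnonneg
  · exact cauchySeq_tendsto_of_complete (cauchySeq_div_of_recurrence hs hsr hur hneg (hδ hneg))
  have habove : BddAbove (Set.range fun j => u j / s j) :=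
    ⟨K, Set.forall_mem_range.2 fun j => (abs_le.1 (hK j)).2⟩
  have hbelow : BddBelow (Set.range fun j => u j / s j) :=
    ⟨-K, Set.forall_mem_range.2 fun j => (abs_le.1 (hK j)).1⟩
  rcases monotone_or_antitone_div_of_recurrence hs hsr hur hnonneg with h | h
  · exact ⟨_, tendsto_atTop_ciSup h habove⟩
  · exact ⟨_, tendsto_atTop_ciInf h hbelow⟩

lemma exists_tendsto_log_sub_of_recurrence (hs : ∀ j, 0 < s j) (hu : ∀ j, 0 < u j)
    (hsr : ∀ j, s (j + 2) = τ * s (j + 1) - δ * s j)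
    (hur : ∀ j, u (j + 2) = τ * u (j + 1) - δ * u j) (hδ : δ < 0 → 0 < τ)
    (hK : ∀ j, |Real.log (u j) - Real.log (s j)| ≤ K) :
    ∃ L, Tendsto (fun j => Real.log (u j) - Real.log (s j)) atTop (𝓝 L) := by
  have hratio (j) : 0 < u j / s j := div_pos (hu j) (hs j)
  have hlog (j) : Real.log (u j / s j) = Real.log (u j) - Real.log (s j) :=
    Real.log_div (hu j).ne' (hs j).ne'
  have hlower (j) : Real.exp (-K) ≤ u j / s j :=
    (Real.le_log_iff_exp_le (hratio j)).1 (hlog j ▸ (abs_le.1 (hK j)).1)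
  have hupper (j) : u j / s j ≤ Real.exp K :=
    (Real.log_le_iff_le_exp (hratio j)).1 (hlog j ▸ (abs_le.1 (hK j)).2)
  obtain ⟨L, hL⟩ := exists_tendsto_div_of_recurrence hs hsr hur hδ fun j =>
    (abs_of_pos (hratio j)).trans_le (hupper j)
  have hL0 : 0 < L := (Real.exp_pos (-K)).trans_le (ge_of_tendsto' hL hlower)
  exact ⟨Real.log L, (hL.log hL0.ne').congr hlog⟩

end LinearRecurrence

section AlmostAdditiveSequence

variable {a C : ℕ → ℝ}

lemma abs_mul_sub_mul_le (ha : ∀ n m, 1 ≤ n → 1 ≤ m → |a (n + m) - a n - a m| ≤ C n)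
    {n m : ℕ} (hn : 1 ≤ n) (hm : 1 ≤ m) : |a (m * n) - m * a n| ≤ m * C n := by
  induction m, hm using Nat.le_induction with
  | base => simpa using (abs_nonneg _).trans (ha n n hn hn)
  | succ m hm ih =>
    have h := ha n (m * n) hn (Nat.mul_pos hm hn)
    rw [abs_le] at *
    rw [show (m + 1) * n = n + m * n by ring]
    push_cast
    constructor <;> linarith [h.1, h.2, ih.1, ih.2]

lemma exists_forall_abs_sub_mul_le
    (ha : ∀ n m, 1 ≤ n → 1 ≤ m → |a (n + m) - a n - a m| ≤ C n) :
    ∃ α : ℝ, ∀ n : ℕ, 1 ≤ n → |a n - n * α| ≤ C n := by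
  have hle {n m : ℕ} (hn : 1 ≤ n) (hm : 1 ≤ m) : (a n - C n) / n ≤ (a m + C m) / m := by
    have h₁ := (abs_le.1 (abs_mul_sub_mul_le ha hn hm)).1
    have h₂ := (abs_le.1 (abs_mul_sub_mul_le ha hm hn)).2
    have hn' : (0 : ℝ) < n := by exact_mod_cast hn
    have hm' : (0 : ℝ) < m := by exact_mod_cast hm
    rw [mul_comm n m] at h₂
    rw [div_le_div_iff₀ hn' hm']
    linarith
  obtain ⟨α, hlower, hupper⟩ := exists_between_of_forall_le
    (s := (fun n : ℕ => (a n - C n) / n) '' Set.Ici 1)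
    (t := (fun n : ℕ => (a n + C n) / n) '' Set.Ici 1) ⟨_, 1, Set.self_mem_Ici, rfl⟩
    ⟨_, 1, Set.self_mem_Ici, rfl⟩
    (by rintro _ ⟨n, hn, rfl⟩ _ ⟨m, hm, rfl⟩; exact hle hn hm)
  refine ⟨α, fun n hn => abs_le.2 ?_⟩
  have hn' : (0 : ℝ) < n := by exact_mod_cast hn
  have h₁ := (div_le_iff₀ hn').1 (hlower ⟨n, hn, rfl⟩)
  have h₂ := (le_div_iff₀ hn').1 (hupper ⟨n, hn, rfl⟩)
  constructor <;> linarith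

lemma exists_sublinear_majorant (hC : Tendsto (fun n : ℕ => C n / n) atTop (𝓝 0)) :
    ∃ E : ℕ → ℝ, (∀ k n, k ≤ n → C k ≤ E n) ∧ Tendsto (fun n : ℕ => E n / n) atTop (𝓝 0) := by
  refine ⟨partialSups fun n => |C n|, fun k n hkn =>
    (le_abs_self _).trans (le_partialSups_of_le (fun n => |C n|) hkn), ?_⟩
  refine Metric.tendsto_atTop.2 fun ε hε => ?_
  obtain ⟨N, hN⟩ := Metric.tendsto_atTop.1 hC (ε / 2) (half_pos hε)
  obtain ⟨N', hN'⟩ := exists_nat_gt (partialSups (fun n => |C n|) N / (ε / 2))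
  refine ⟨N' + 1, fun n hn => ?_⟩
  have hn0 : (0 : ℝ) < n := by exact_mod_cast (Nat.succ_pos N').trans_le hn
  have hle : partialSups (fun n => |C n|) n ≤ ε / 2 * n := by
    refine partialSups_le _ _ _ fun k hk => ?_
    rcases le_or_gt k N with hkN | hkN
    · have hN'n : (N' : ℝ) ≤ n := by exact_mod_cast (Nat.le_succ N').trans hn
      rw [div_lt_iff₀' (half_pos hε)] at hN'
      exact (le_partialSups_of_le (fun n => |C n|) hkN).trans (hN'.le.trans (by gcongr))
    · have hk0 : (0 : ℝ) < k := by exact_mod_cast (Nat.zero_le N).trans_lt hkN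
      have h := (hN k hkN.le).le
      rw [Real.dist_eq, sub_zero, abs_div, Nat.abs_cast, div_le_iff₀ hk0] at h
      exact h.trans (by gcongr)
  have hnonneg : 0 ≤ partialSups (fun n => |C n|) n :=
    (abs_nonneg _).trans (le_partialSups (fun n => |C n|) n)
  rw [Real.dist_eq, sub_zero, abs_of_nonneg (div_nonneg hnonneg hn0.le), div_lt_iff₀ hn0]
  nlinarith

lemma tendsto_div_of_abs_sub_mul_le {x C : ℕ → ℝ} {α : ℝ}
    (hC : Tendsto (fun n : ℕ => C n / n) atTop (𝓝 0))
    (hx : ∀ n : ℕ, 1 ≤ n → |x n - n * α| ≤ C n) : Tendsto (fun n : ℕ => x n / n) atTop (𝓝 α) := by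
  refine tendsto_iff_norm_sub_tendsto_zero.2 (squeeze_zero' (Eventually.of_forall fun _ =>
    norm_nonneg _) ((eventually_ge_atTop 1).mono fun n hn => ?_) hC)
  have hn0 : (0 : ℝ) < n := Nat.cast_pos.2 hn
  rw [Real.norm_eq_abs, div_sub' hn0.ne', abs_div, Nat.abs_cast]
  exact div_le_div_of_nonneg_right (hx n hn) hn0.le

lemma tendsto_div_of_tendsto_sub {x : ℕ → ℝ} {L : ℝ}
    (hx : Tendsto (fun n => x (n + 1) - x n) atTop (𝓝 L)) :
    Tendsto (fun n : ℕ => x n / n) atTop (𝓝 L) := by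
  have h := hx.cesaro.add (tendsto_const_div_atTop_nhds_zero_nat (x 0))
  rw [add_zero] at h
  refine h.congr fun n => ?_
  rw [Finset.sum_range_sub]
  ring

end AlmostAdditiveSequence

section PerronFrobenius

lemma extend_pos_iff {ι : Type*} {p : ι → Prop} {x : {i // p i} → ℝ} (hx : ∀ i, 0 < x i) (i : ι) :
    0 < Function.extend Subtype.val x 0 i ↔ p i := by
  by_cases hi : p i
  · simpa only [Subtype.val_injective.extend_apply (a := ⟨i, hi⟩), hi, iff_true] using hx ⟨i, hi⟩
  · rw [Function.extend_apply' _ _ _ (by rintro ⟨j, rfl⟩; exact hi j.2)]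
    simp [hi]

variable {ι : Type*} [Fintype ι] {M : Matrix ι ι ℝ}

lemma mulVec_pos_of_forall_pos {Q : Matrix ι ι ℝ} (hQ : ∀ i j, 0 < Q i j) {z : ι → ℝ}
    (hz : 0 ≤ z) (hz0 : z ≠ 0) (i : ι) : 0 < (Q *ᵥ z) i := by
  obtain ⟨k, hk⟩ := Function.ne_iff.1 hz0
  exact Finset.sum_pos' (fun j _ => mul_nonneg (hQ i j).le (hz j))
    ⟨k, Finset.mem_univ k, mul_pos (hQ i k) ((hz k).lt_of_ne' hk)⟩

lemma le_sum_of_mem_stdSimplex (hM : ∀ i j, 0 ≤ M i j) {x : ι → ℝ} (hx : x ∈ stdSimplex ℝ ι)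
    {t : ℝ} (ht : t • x ≤ M *ᵥ x) : t ≤ ∑ i, ∑ j, M i j := by
  calc t = ∑ i, (t • x) i := by simp [← Finset.mul_sum, hx.2]
    _ ≤ ∑ i, (M *ᵥ x) i := Finset.sum_le_sum fun i _ => ht i
    _ ≤ ∑ i, ∑ j, M i j := Finset.sum_le_sum fun i _ => Finset.sum_le_sum fun j _ =>
        mul_le_of_le_one_right (hM i j) (mem_Icc_of_mem_stdSimplex hx j).2

lemma exists_maximal_subeigenvalue [Nonempty ι] (hM : ∀ i j, 0 ≤ M i j) :
    ∃ x ∈ stdSimplex ℝ ι, ∃ t : ℝ, 0 ≤ t ∧ t • x ≤ M *ᵥ x ∧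
      ∀ y ∈ stdSimplex ℝ ι, ∀ s : ℝ, 0 ≤ s → s • y ≤ M *ᵥ y → s ≤ t := by
  classical
  set K : Set ((ι → ℝ) × ℝ) := (stdSimplex ℝ ι ×ˢ Set.Icc 0 (∑ i, ∑ j, M i j)) ∩
    {p | p.2 • p.1 ≤ M *ᵥ p.1}
  have hcompact : IsCompact K :=
    ((isCompact_stdSimplex ℝ ι).prod isCompact_Icc).inter_right <|
      isClosed_le (by fun_prop) (continuous_const.matrix_mulVec continuous_fst)
  obtain ⟨i⟩ := ‹Nonempty ι›
  have hnonempty : K.Nonempty := by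
    refine ⟨(Pi.single i 1, 0), ⟨single_mem_stdSimplex ℝ i, le_rfl, ?_⟩, fun j => ?_⟩
    · exact Finset.sum_nonneg fun i _ => Finset.sum_nonneg fun j _ => hM i j
    · simpa using hM j i
  obtain ⟨⟨x, t⟩, ⟨⟨hx, ht0, -⟩, ht⟩, hmax⟩ :=
    hcompact.exists_isMaxOn hnonempty continuous_snd.continuousOn
  exact ⟨x, hx, t, ht0, ht, fun y hy s hs hsy =>
    hmax (a := (y, s)) ⟨⟨hy, hs, le_sum_of_mem_stdSimplex hM hy hsy⟩, hsy⟩⟩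

lemma exists_gt_subeigenvalue [Nonempty ι] {w : ι → ℝ} (hw : ∀ i, 0 < w i) {t : ℝ}
    (ht : ∀ i, t * w i < (M *ᵥ w) i) :
    ∃ y ∈ stdSimplex ℝ ι, ∃ s > t, s • y ≤ M *ᵥ y := by
  obtain ⟨s, hs, hts⟩ : ∃ s, (∀ i, s * w i < (M *ᵥ w) i) ∧ t < s := by
    have h (i) : ∀ᶠ s in 𝓝[>] t, s * w i < (M *ᵥ w) i :=
      Eventually.filter_mono nhdsWithin_le_nhds <|
        ContinuousAt.eventually_lt (f := fun s => s * w i) (by fun_prop) continuousAt_const (ht i)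
    exact ((eventually_all.2 h).and self_mem_nhdsWithin).exists
  have hsum : 0 < ∑ i, w i := Finset.sum_pos (fun i _ => hw i) Finset.univ_nonempty
  refine ⟨(∑ i, w i)⁻¹ • w, ⟨fun i => mul_nonneg (inv_pos.2 hsum).le (hw i).le, ?_⟩, s, hts, ?_⟩
  · simp [← Finset.mul_sum, inv_mul_cancel₀ hsum.ne']
  · rw [Matrix.mulVec_smul, smul_comm]
    exact smul_le_smul_of_nonneg_left (fun i => (hs i).le) (inv_pos.2 hsum).le

lemma exists_pos_commute (hM : M.IsIrreducible) :
    ∃ Q : Matrix ι ι ℝ, (∀ i j, 0 < Q i j) ∧ Commute M Q := by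
  classical
  have hpow : ∀ n i j, 0 ≤ (M ^ n) i j := fun n => Matrix.pow_apply_nonneg hM.nonneg n
  choose e _ he using (Matrix.isIrreducible_iff_exists_pow_pos hM.nonneg).1 hM
  refine ⟨∑ i, ∑ j, M ^ e i j, fun i j => ?_, Commute.sum_right _ _ _ fun i _ =>
    Commute.sum_right _ _ _ fun j _ => Commute.self_pow M _⟩
  simp only [Matrix.sum_apply]
  exact Finset.sum_pos' (fun _ _ => Finset.sum_nonneg fun _ _ => hpow _ i j)
    ⟨i, Finset.mem_univ i, Finset.sum_pos' (fun _ _ => hpow _ i j) ⟨j, Finset.mem_univ j, he i j⟩⟩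

theorem exists_pos_eigenvector [Nonempty ι] (hM : M.IsIrreducible) :
    ∃ (t : ℝ) (x : ι → ℝ), 0 < t ∧ (∀ i, 0 < x i) ∧ M *ᵥ x = t • x := by
  obtain ⟨Q, hQ, hcomm⟩ := exists_pos_commute hM
  obtain ⟨x, hx, t, ht0, ht, hmax⟩ := exists_maximal_subeigenvalue hM.nonneg
  have hx0 : x ≠ 0 := by rintro rfl; simpa using hx.2
  set w := Q *ᵥ x with hw
  have hwpos : ∀ i, 0 < w i := mulVec_pos_of_forall_pos hQ hx.1 hx0
  have hswap : M *ᵥ w = Q *ᵥ (M *ᵥ x) := by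
    rw [hw, Matrix.mulVec_mulVec, hcomm.eq, Matrix.mulVec_mulVec]
  have heigen : M *ᵥ x = t • x := by
    by_contra hne
    have hgap := mulVec_pos_of_forall_pos hQ (sub_nonneg.2 ht) (sub_ne_zero.2 hne)
    obtain ⟨y, hy, s, hs, hsy⟩ := exists_gt_subeigenvalue (M := M) hwpos (t := t) fun i => by
      have := hgap i
      rwa [Matrix.mulVec_sub, ← hswap, Matrix.mulVec_smul, ← hw, Pi.sub_apply, sub_pos] at this
    exact hs.not_ge (hmax y hy s (ht0.trans hs.le) hsy)
  have hweigen : M *ᵥ w = t • w := by rw [hswap, heigen, Matrix.mulVec_smul]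
  refine ⟨t, w, ht0.lt_of_ne' ?_, hwpos, hweigen⟩
  classical
  rintro rfl
  obtain ⟨i⟩ := ‹Nonempty ι›
  obtain ⟨n, hn, hpos⟩ := (Matrix.isIrreducible_iff_exists_pow_pos hM.nonneg).1 hM i i
  obtain ⟨m, rfl⟩ := Nat.exists_eq_add_of_le' hn
  have hzero : (M ^ (m + 1) *ᵥ w) i = 0 := by
    rw [pow_succ, ← Matrix.mulVec_mulVec, hweigen, zero_smul, Matrix.mulVec_zero, Pi.zero_apply]
  refine hzero.not_gt (Finset.sum_pos' (fun j _ => mul_nonneg ?_ (hwpos j).le)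
    ⟨i, Finset.mem_univ i, mul_pos hpos (hwpos i)⟩)
  exact Matrix.pow_apply_nonneg hM.nonneg (m + 1) i j

theorem exists_pos_left_right_eigenvectors [Nonempty ι] (hM : M.IsIrreducible) :
    ∃ (t : ℝ) (l r : ι → ℝ), 0 < t ∧ (∀ i, 0 < l i) ∧ (∀ i, 0 < r i) ∧
      l ᵥ* M = t • l ∧ M *ᵥ r = t • r ∧ l ⬝ᵥ r = 1 := by
  obtain ⟨t, r, ht, hr, hMr⟩ := exists_pos_eigenvector hM
  obtain ⟨t', l, -, hl, hMl⟩ := exists_pos_eigenvector hM.transpose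
  rw [Matrix.mulVec_transpose] at hMl
  have hdot : 0 < l ⬝ᵥ r :=
    Finset.sum_pos (fun i _ => mul_pos (hl i) (hr i)) Finset.univ_nonempty
  have heq : t' = t := by
    have h := Matrix.dotProduct_mulVec l M r
    rw [hMr, hMl, dotProduct_smul, smul_dotProduct, smul_eq_mul, smul_eq_mul] at h
    exact (mul_right_cancel₀ hdot.ne' h).symm
  refine ⟨t, (l ⬝ᵥ r)⁻¹ • l, r, ht, fun i => mul_pos (inv_pos.2 hdot) (hl i), hr, ?_, hMr, ?_⟩
  · rw [Matrix.smul_vecMul, hMl, heq, smul_comm]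
  · rw [smul_dotProduct, smul_eq_mul, inv_mul_cancel₀ hdot.ne']

variable {p : ι → Prop}

lemma mulVec_extend [DecidablePred p] (hp : ∀ i j, M i j ≠ 0 → p i ∧ p j) (x : {i // p i} → ℝ) :
    M *ᵥ Function.extend Subtype.val x 0 =
      Function.extend Subtype.val
        ((M.submatrix Subtype.val Subtype.val : Matrix {i // p i} {i // p i} ℝ) *ᵥ x) 0 := by
  funext i
  by_cases hi : p i
  · rw [Subtype.val_injective.extend_apply (a := ⟨i, hi⟩)]
    refine (Fintype.sum_of_injective Subtype.val Subtype.val_injective _ _ (fun j hj => ?_)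
      fun j => ?_).symm
    · rw [Function.extend_apply' _ _ _ hj, Pi.zero_apply, mul_zero]
    · rw [Subtype.val_injective.extend_apply]; rfl
  · rw [Function.extend_apply' _ _ _ (by rintro ⟨j, rfl⟩; exact hi j.2)]
    refine Finset.sum_eq_zero fun j _ => mul_eq_zero_of_left ?_ _
    exact not_not.1 (mt (hp i j) fun h => hi h.1)

theorem exists_left_right_eigenvectors_of_support [Nonempty {i // p i}]
    (hp : ∀ i j, M i j ≠ 0 → p i ∧ p j)
    (hM : (M.submatrix Subtype.val Subtype.val : Matrix {i // p i} {i // p i} ℝ).IsIrreducible) :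
    ∃ (t : ℝ) (l r : ι → ℝ), 0 < t ∧ 0 ≤ l ∧ 0 ≤ r ∧ (∀ i, 0 < l i ↔ p i) ∧
      (∀ i, 0 < r i ↔ p i) ∧ l ᵥ* M = t • l ∧ M *ᵥ r = t • r ∧ l ⬝ᵥ r = 1 := by
  classical
  obtain ⟨t, l, r, ht, hl, hr, hMl, hMr, hlr⟩ := exists_pos_left_right_eigenvectors hM
  have hsmul (x : {i // p i} → ℝ) : Function.extend Subtype.val (t • x) 0 =
      t • (Function.extend Subtype.val x 0 : ι → ℝ) := by
    simpa using Function.extend_smul t Subtype.val x (0 : ι → ℝ)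
  have hnonneg {x : {i // p i} → ℝ} (hx : ∀ i, 0 < x i) :
      0 ≤ (Function.extend Subtype.val x 0 : ι → ℝ) :=
    Function.extend_nonneg (fun i => (hx i).le) le_rfl
  refine ⟨t, Function.extend Subtype.val l 0, Function.extend Subtype.val r 0, ht, hnonneg hl,
    hnonneg hr, extend_pos_iff hl, extend_pos_iff hr, ?_, ?_, ?_⟩
  · rw [← Matrix.mulVec_transpose, mulVec_extend (M := Mᵀ) fun i j h => (hp j i h).symm, ← hsmul,
      ← hMl, ← Matrix.mulVec_transpose]
    rfl
  · rw [mulVec_extend hp, hMr, hsmul]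
  · rw [← hlr]
    refine (Fintype.sum_of_injective Subtype.val Subtype.val_injective _ _ (fun j hj => ?_)
      fun j => ?_).symm
    · rw [Function.extend_apply' _ _ _ hj, Pi.zero_apply, zero_mul]
    · rw [Subtype.val_injective.extend_apply, Subtype.val_injective.extend_apply]

end PerronFrobenius

section Subshift

variable {k : ℕ} {B : Matrix (Fin k) (Fin k) ℕ}

/-- The word `y_1 ⋯ y_n` of the first `n` symbols of `y`. A function `Φ` on the subshift depends
only on the first `n` symbols when `Function.FactorsThrough Φ (prefixWord n)`. -/
def prefixWord (n : ℕ) (y : SFT B) : Fin n → Fin k := fun i => y.1 i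

lemma prefixWord_eq_iff {n : ℕ} {y z : SFT B} :
    prefixWord n z = prefixWord n y ↔ z ∈ cylinder y n :=
  ⟨fun h i hi => congrFun h ⟨i, hi⟩, fun h => funext fun i => h i i.2⟩

lemma preimage_prefixWord (n : ℕ) (y : SFT B) :
    prefixWord n ⁻¹' {prefixWord n y} = cylinder y n :=
  Set.ext fun _ => prefixWord_eq_iff

lemma cylinder_eq_of_mem {n : ℕ} {y z : SFT B} (h : z ∈ cylinder y n) :
    cylinder z n = cylinder y n := by
  rw [← preimage_prefixWord, ← preimage_prefixWord, prefixWord_eq_iff.2 h]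

lemma self_mem_cylinder (y : SFT B) (n : ℕ) : y ∈ cylinder y n := fun _ _ => rfl

lemma cylinder_zero (y : SFT B) : cylinder y 0 = Set.univ :=
  Set.eq_univ_of_forall fun _ _ hi => absurd hi (Nat.not_lt_zero _)

lemma mem_cylinder_one_iff {y z : SFT B} : z ∈ cylinder y 1 ↔ z.1 0 = y.1 0 := by
  simp [cylinder]

lemma cylinder_anti (y : SFT B) : Antitone (cylinder y) := fun _ _ h _ hz i hi =>
  hz i (hi.trans_le h)

lemma cylinder_inter_cylinder {x y z : SFT B} {n m : ℕ} (hx : z ∈ cylinder x n)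
    (hy : z ∈ cylinder y m) : cylinder x n ∩ cylinder y m = cylinder z (max n m) := by
  rw [← cylinder_eq_of_mem hx, ← cylinder_eq_of_mem hy]
  ext w
  simp only [cylinder, Set.mem_inter_iff, Set.mem_ofPred_eq, lt_max_iff, or_imp, forall_and]

lemma prefixWord_succ (n : ℕ) (y : SFT B) :
    prefixWord (n + 1) y = Fin.snoc (prefixWord n y) (y.1 n) :=
  (Fin.snoc_init_self (prefixWord (n + 1) y)).symm

lemma prefixWord_succ' (n : ℕ) (y : SFT B) :
    prefixWord (n + 1) y = Fin.cons (y.1 0) (prefixWord n (shift B y)) :=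
  (Fin.cons_self_tail (prefixWord (n + 1) y)).symm

lemma shift_iterate_val (n : ℕ) (y : SFT B) (i : ℕ) : ((shift B)^[n] y).1 i = y.1 (n + i) := by
  induction n generalizing y with
  | zero => rw [Function.iterate_zero_apply, zero_add]
  | succ n ih => rw [Function.iterate_succ_apply, ih, Nat.add_right_comm]; rfl

lemma continuous_val_apply (i : ℕ) : Continuous fun y : SFT B => y.1 i :=
  (continuous_apply i).comp continuous_subtype_val

lemma continuous_prefixWord (n : ℕ) : Continuous (prefixWord n : SFT B → Fin n → Fin k) :=
  continuous_pi fun i => continuous_val_apply i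

lemma continuous_shift : Continuous (shift B) :=
  Continuous.subtype_mk (continuous_pi fun i => continuous_val_apply (i + 1)) _

lemma isClosed_SFT : IsClosed (SFT B) := by
  simp only [SFT, Set.ofPred_forall]
  refine isClosed_iInter fun n => ?_
  exact (isClosed_discrete {p : Fin k × Fin k | B p.1 p.2 = 1}).preimage
    (f := fun x : ℕ → Fin k => (x n, x (n + 1))) (by fun_prop)

instance : CompactSpace (SFT B) := isCompact_iff_compactSpace.1 isClosed_SFT.isCompact

lemma cylinder_add_eq_inter (y : SFT B) (n q : ℕ) :
    cylinder y (n + q) = cylinder y n ∩ (shift B)^[n] ⁻¹' cylinder ((shift B)^[n] y) q := by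
  ext z
  simp only [cylinder, Set.mem_inter_iff, Set.mem_preimage, Set.mem_ofPred_eq, shift_iterate_val]
  refine ⟨fun h => ⟨fun i hi => h i (by omega), fun i hi => h _ (by omega)⟩, fun h i hi => ?_⟩
  rcases lt_or_ge i n with hin | hin
  · exact h.1 i hin
  · obtain ⟨j, rfl⟩ := Nat.exists_eq_add_of_le hin
    exact h.2 j (by omega)

lemma exists_splice {n : ℕ} (z v : SFT B) (h : v.1 0 = z.1 n) :
    ∃ z' ∈ cylinder z n, (shift B)^[n] z' = v := by
  set s : ℕ → Fin k := fun i => if i < n then z.1 i else v.1 (i - n) with hs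
  have hlt {i} (hi : i < n) : s i = z.1 i := if_pos hi
  have hge (i) : s (n + i) = v.1 i := by simp [hs]
  have hmem : s ∈ SFT B := fun i => by
    rcases lt_or_ge i n with hi | hi
    · rcases (Nat.succ_le_of_lt hi).lt_or_eq with hi' | rfl
      · rw [hlt hi, hlt hi']; exact z.2 i
      · rw [hlt hi, show s (i + 1) = v.1 0 from hge 0, h]; exact z.2 i
    · obtain ⟨j, rfl⟩ := Nat.exists_eq_add_of_le hi
      rw [hge, add_assoc, hge]; exact v.2 j
  refine ⟨⟨s, hmem⟩, fun i hi => hlt hi, Subtype.ext (funext fun i => ?_)⟩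
  rw [shift_iterate_val]
  exact hge i

lemma isOpen_preimage_prefixWord (n : ℕ) (W : Set (Fin n → Fin k)) :
    IsOpen (prefixWord n ⁻¹' W : Set (SFT B)) :=
  (isOpen_discrete W).preimage (continuous_prefixWord n)

lemma isTopologicalBasis_cylinder :
    TopologicalSpace.IsTopologicalBasis {S : Set (SFT B) | ∃ y n, S = cylinder y n} := by
  refine TopologicalSpace.isTopologicalBasis_of_isOpen_of_nhds ?_ fun y U hy hU => ?_
  · rintro _ ⟨y, n, rfl⟩
    exact preimage_prefixWord n y ▸ isOpen_preimage_prefixWord n _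
  obtain ⟨V, hV, rfl⟩ := isOpen_induced_iff.1 hU
  obtain ⟨_, ⟨x, n, rfl⟩, hyx, hxV⟩ :=
    (PiNat.isTopologicalBasis_cylinders fun _ => Fin k).exists_subset_of_mem_open hy hV
  refine ⟨_, ⟨y, n, rfl⟩, self_mem_cylinder y n, fun z hz => hxV fun i hi => ?_⟩
  exact (hz i hi).trans (hyx i hi)

lemma cylinder_mem_nhds (y : SFT B) (n : ℕ) : cylinder y n ∈ 𝓝 y :=
  (isTopologicalBasis_cylinder.isOpen ⟨y, n, rfl⟩).mem_nhds (self_mem_cylinder y n)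

lemma ext_of_cylinder {μ ν : Measure (SFT B)} [IsFiniteMeasure μ]
    (h : ∀ y n, μ (cylinder y n) = ν (cylinder y n)) : μ = ν := by
  rcases isEmpty_or_nonempty (SFT B) with _ | ⟨⟨y₀⟩⟩
  · exact Subsingleton.elim μ ν
  refine ext_of_generate_finite {S | ∃ y n, S = cylinder y n} ?_ ?_ ?_ ?_
  · exact BorelSpace.measurable_eq.trans isTopologicalBasis_cylinder.borel_eq_generateFrom
  · rintro _ ⟨x, n, rfl⟩ _ ⟨y, m, rfl⟩ ⟨z, hzx, hzy⟩
    exact ⟨z, max n m, cylinder_inter_cylinder hzx hzy⟩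
  · rintro _ ⟨y, n, rfl⟩
    exact h y n
  · simpa only [cylinder_zero] using h y₀ 0

lemma measurableSet_preimage_prefixWord (n : ℕ) (W : Set (Fin n → Fin k)) :
    MeasurableSet (prefixWord n ⁻¹' W : Set (SFT B)) :=
  (isOpen_preimage_prefixWord n W).measurableSet

lemma measurableSet_cylinder (y : SFT B) (n : ℕ) : MeasurableSet (cylinder y n) :=
  preimage_prefixWord n y ▸ measurableSet_preimage_prefixWord n _

end Subshift

section PrefixIntegral

variable {k n : ℕ} {B : Matrix (Fin k) (Fin k) ℕ} {Φ : SFT B → ℝ}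

lemma exists_eq_comp_prefixWord (hΦ : Φ.FactorsThrough (prefixWord n)) :
    ∃ F : (Fin n → Fin k) → ℝ, Φ = F ∘ prefixWord n :=
  (Function.factorsThrough_iff Φ).1 hΦ

lemma factorsThrough_prefixWord_comp_shift_iterate (hΦ : Φ.FactorsThrough (prefixWord n))
    {i m : ℕ} (h : i + n ≤ m) :
    (fun y => Φ ((shift B)^[i] y)).FactorsThrough (prefixWord m) := fun y z hyz =>
  hΦ <| funext fun j => by
    simpa only [prefixWord, shift_iterate_val] using
      congrFun hyz ⟨i + j, (Nat.add_lt_add_left j.2 i).trans_le h⟩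

lemma continuous_of_factorsThrough (hΦ : Φ.FactorsThrough (prefixWord n)) : Continuous Φ := by
  obtain ⟨F, rfl⟩ := exists_eq_comp_prefixWord hΦ
  exact continuous_of_discreteTopology.comp (continuous_prefixWord n)

lemma integrable_of_factorsThrough (hΦ : Φ.FactorsThrough (prefixWord n)) (μ : Measure (SFT B))
    [IsFiniteMeasure μ] : Integrable Φ μ :=
  (BoundedContinuousFunction.mkOfCompact ⟨Φ, continuous_of_factorsThrough hΦ⟩).integrable μ

lemma integral_comp_prefixWord (μ : Measure (SFT B)) [IsFiniteMeasure μ]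
    (F : (Fin n → Fin k) → ℝ) :
    ∫ y, F (prefixWord n y) ∂μ = ∑ w, μ.real (prefixWord n ⁻¹' {w}) * F w := by
  have hmeas : Measurable (prefixWord n : SFT B → Fin n → Fin k) :=
    (continuous_prefixWord n).measurable
  rw [← integral_map (f := F) hmeas.aemeasurable (by fun_prop), integral_fintype .of_finite]
  simp only [map_measureReal_apply hmeas (measurableSet_singleton _), smul_eq_mul]

lemma integral_le_mul_integral_of_cylinder_le {μ μ' : Measure (SFT B)} [IsFiniteMeasure μ]
    [IsFiniteMeasure μ'] {D : ℝ} (hD : ∀ y, μ'.real (cylinder y n) ≤ D * μ.real (cylinder y n))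
    (hΦ : Φ.FactorsThrough (prefixWord n)) (hΦ0 : 0 ≤ Φ) : ∫ y, Φ y ∂μ' ≤ D * ∫ y, Φ y ∂μ := by
  obtain ⟨F, rfl⟩ := exists_eq_comp_prefixWord hΦ
  simp only [Function.comp_apply, integral_comp_prefixWord, Finset.mul_sum]
  refine Finset.sum_le_sum fun w _ => ?_
  by_cases hw : ∃ y : SFT B, prefixWord n y = w
  · obtain ⟨y, rfl⟩ := hw
    rw [preimage_prefixWord, ← mul_assoc]
    exact mul_le_mul_of_nonneg_right (hD y) (hΦ0 y)
  · have hempty : (prefixWord n ⁻¹' {w} : Set (SFT B)) = ∅ :=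
      Set.eq_empty_of_forall_notMem fun y hy => hw ⟨y, hy⟩
    simp [hempty]

lemma measureReal_le_mul_measureReal_of_cylinder_le {μ μ' : Measure (SFT B)} [IsFiniteMeasure μ]
    [IsFiniteMeasure μ'] {D : ℝ} (hD : ∀ y, μ'.real (cylinder y n) ≤ D * μ.real (cylinder y n))
    (W : Set (Fin n → Fin k)) :
    μ'.real (prefixWord n ⁻¹' W) ≤ D * μ.real (prefixWord n ⁻¹' W) := by
  simpa only [integral_indicator_one (measurableSet_preimage_prefixWord n W)] using
    integral_le_mul_integral_of_cylinder_le hD (Φ := (prefixWord n ⁻¹' W).indicator 1)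
      (fun _ _ h => congrArg (W.indicator (1 : (Fin n → Fin k) → ℝ)) h)
      (Set.indicator_nonneg fun _ _ => zero_le_one)

end PrefixIntegral

section MeasureOfWeights

variable {k n : ℕ} {B : Matrix (Fin k) (Fin k) ℕ}

lemma measureReal_eq_sum_inter (μ : Measure (SFT B)) [IsFiniteMeasure μ] (S : Set (SFT B))
    (i : ℕ) : μ.real S = ∑ a, μ.real ((fun y => y.1 i) ⁻¹' {a} ∩ S) := by
  have h (a : Fin k) : MeasurableSet ((fun y : SFT B => y.1 i) ⁻¹' {a}) :=
    (continuous_val_apply i).measurable (measurableSet_singleton a)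
  have hsum := sum_measureReal_preimage_singleton (μ := μ.restrict S) Finset.univ fun a _ => h a
  simpa only [Finset.coe_univ, Set.preimage_univ, measureReal_restrict_apply (h _),
    measureReal_restrict_apply MeasurableSet.univ, Set.univ_inter] using hsum.symm

lemma measureReal_prefixWord_eq_sum_snoc (μ : Measure (SFT B)) [IsFiniteMeasure μ]
    (w : Fin n → Fin k) : μ.real (prefixWord n ⁻¹' {w}) =
      ∑ a, μ.real (prefixWord (n + 1) ⁻¹' {Fin.snoc w a}) := by
  rw [measureReal_eq_sum_inter μ _ n]
  refine Finset.sum_congr rfl fun a _ => congrArg μ.real (Set.ext fun y => ?_)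
  simp only [Set.mem_inter_iff, Set.mem_preimage, Set.mem_singleton_iff, prefixWord_succ,
    Fin.snoc_inj, and_comm]

lemma measureReal_preimage_shift_eq_sum_cons (μ : Measure (SFT B)) [IsFiniteMeasure μ]
    (w : Fin n → Fin k) : μ.real (shift B ⁻¹' (prefixWord n ⁻¹' {w})) =
      ∑ a, μ.real (prefixWord (n + 1) ⁻¹' {Fin.cons a w}) := by
  rw [measureReal_eq_sum_inter μ _ 0]
  refine Finset.sum_congr rfl fun a _ => congrArg μ.real (Set.ext fun y => ?_)
  simp only [Set.mem_inter_iff, Set.mem_preimage, Set.mem_singleton_iff, prefixWord_succ',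
    Fin.cons_inj]

lemma measurePreserving_shift_of_sum_cons {μ : Measure (SFT B)} [IsFiniteMeasure μ]
    (h : ∀ n (w : Fin n → Fin k), ∑ a, μ.real (prefixWord (n + 1) ⁻¹' {Fin.cons a w}) =
      μ.real (prefixWord n ⁻¹' {w})) : MeasurePreserving (shift B) μ μ := by
  have hmeas : Measurable (shift B) := continuous_shift.measurable
  have := μ.isFiniteMeasure_map (shift B)
  refine ⟨hmeas, ext_of_cylinder fun y n => ?_⟩
  rw [← measureReal_eq_measureReal_iff, map_measureReal_apply hmeas (measurableSet_cylinder y n),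
    ← preimage_prefixWord, measureReal_preimage_shift_eq_sum_cons, h]

variable {ρ : ∀ n, (Fin n → Fin k) → ℝ}

lemma sum_weights_eq_one (hzero : ∀ w, ρ 0 w = 1)
    (hsnoc : ∀ n w, ∑ a, ρ (n + 1) (Fin.snoc w a) = ρ n w) (n : ℕ) : ∑ w, ρ n w = 1 := by
  induction n with
  | zero => simp [hzero]
  | succ n ih =>
    rw [← (Fin.snocEquiv fun _ => Fin k).sum_comp, Fintype.sum_prod_type_right, ← ih]
    exact Finset.sum_congr rfl fun w _ => hsnoc n w

lemma exists_measure_prefixWord_eq {q : (Fin n → Fin k) → ℝ} (hq : ∀ w, 0 ≤ q w)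
    (hsum : ∑ w, q w = 1) (hrange : ∀ w, q w ≠ 0 → ∃ y : SFT B, prefixWord n y = w) :
    ∃ μ : ProbabilityMeasure (SFT B),
      ∀ w, (μ : Measure (SFT B)).real (prefixWord n ⁻¹' {w}) = q w := by
  obtain ⟨w₀, -, hw₀⟩ := Finset.exists_ne_zero_of_sum_ne_zero (hsum.trans_ne one_ne_zero)
  have : Nonempty (SFT B) := ⟨(hrange w₀ hw₀).choose⟩
  set point : (Fin n → Fin k) → SFT B := Function.invFun (prefixWord n)
  set μ : Measure (SFT B) := ∑ w, ENNReal.ofReal (q w) • Measure.dirac (point w) with hμ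
  have happly (v) : μ (prefixWord n ⁻¹' {v}) = ENNReal.ofReal (q v) := by
    rw [hμ, Measure.finsetSum_apply, Finset.sum_eq_single v]
    · by_cases hv : q v = 0
      · simp [hv]
      · have hmem : point v ∈ prefixWord n ⁻¹' {v} := Function.invFun_eq (hrange v hv)
        rw [Measure.smul_apply, Measure.dirac_apply_of_mem hmem, smul_eq_mul, mul_one]
    · intro w _ hwv
      by_cases hw : q w = 0
      · simp [hw]
      · have hnot : point w ∉ prefixWord n ⁻¹' {v} := fun h =>
          hwv ((Function.invFun_eq (hrange w hw)).symm.trans h)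
        rw [Measure.smul_apply, Measure.dirac_apply' _ (measurableSet_preimage_prefixWord n _),
          Set.indicator_of_notMem hnot, smul_zero]
    · simp
  have hprob : IsProbabilityMeasure μ := by
    refine ⟨?_⟩
    simp only [hμ, Measure.finsetSum_apply, Measure.smul_apply, measure_univ, smul_eq_mul, mul_one]
    rw [← ENNReal.ofReal_sum_of_nonneg fun w _ => hq w, hsum, ENNReal.ofReal_one]
  refine ⟨⟨μ, hprob⟩, fun w => ?_⟩
  rw [ProbabilityMeasure.coe_mk, measureReal_def, happly, ENNReal.toReal_ofReal (hq w)]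

lemma isClosed_forall_prefixWord_eq (q : (Fin n → Fin k) → ℝ) :
    IsClosed {μ : ProbabilityMeasure (SFT B) |
      ∀ w, (μ : Measure (SFT B)).real (prefixWord n ⁻¹' {w}) = q w} := by
  simp only [Set.ofPred_forall]
  refine isClosed_iInter fun w => isClosed_eq (NNReal.continuous_coe.comp ?_) continuous_const
  exact continuous_iff_continuousAt.2 fun μ =>
    ProbabilityMeasure.tendsto_measure_of_isClopen_of_tendsto tendsto_id
      ((isClopen_discrete {w}).preimage (continuous_prefixWord n))

theorem exists_measure_of_weights (hzero : ∀ w, ρ 0 w = 1) (hρ : ∀ n w, 0 ≤ ρ n w)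
    (hsnoc : ∀ n w, ∑ a, ρ (n + 1) (Fin.snoc w a) = ρ n w)
    (hrange : ∀ n w, ρ n w ≠ 0 → ∃ y : SFT B, prefixWord n y = w) :
    ∃ μ : Measure (SFT B), IsProbabilityMeasure μ ∧
      ∀ n w, μ.real (prefixWord n ⁻¹' {w}) = ρ n w := by
  set F : ℕ → Set (ProbabilityMeasure (SFT B)) := fun n =>
    {μ | ∀ w, (μ : Measure (SFT B)).real (prefixWord n ⁻¹' {w}) = ρ n w}
  have hanti (n) : F (n + 1) ⊆ F n := fun μ hμ w => by
    rw [measureReal_prefixWord_eq_sum_snoc, ← hsnoc]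
    exact Finset.sum_congr rfl fun a _ => hμ _
  obtain ⟨μ, hμ⟩ := IsCompact.nonempty_iInter_of_sequence_nonempty_isCompact_isClosed F hanti
    (fun n => exists_measure_prefixWord_eq (hρ n) (sum_weights_eq_one hzero hsnoc n) (hrange n))
    (isClosed_forall_prefixWord_eq _).isCompact fun n => isClosed_forall_prefixWord_eq _
  exact ⟨μ, inferInstance, fun n => Set.mem_iInter.1 hμ n⟩

end MeasureOfWeights

section FirstVisit

variable {α : Type*} [MeasurableSpace α] {T : α → α} {μ μ' : Measure α} [IsFiniteMeasure μ]
  [IsFiniteMeasure μ'] {Z S : Set α} {κ : ℝ}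

lemma measureReal_eq_add_of_measurePreserving (hT : MeasurePreserving T μ μ)
    (hZ : MeasurableSet Z) (hS : MeasurableSet S) :
    μ.real S = μ.real (Z ∩ T ⁻¹' S) + μ.real (Zᶜ ∩ T ⁻¹' S) := by
  rw [← hT.measureReal_preimage hS.nullMeasurableSet,
    ← measureReal_inter_add_sdiff (s := T ⁻¹' S) hZ, Set.sdiff_eq, Set.inter_comm Zᶜ,
    Set.inter_comm Z]

/-- The part of the mass that has not yet visited `Z` carries the whole difference between `μ'` and
`κ μ`. -/
lemma abs_sub_le_of_measurePreserving (hT : MeasurePreserving T μ μ)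
    (hT' : MeasurePreserving T μ' μ') (hZ : MeasurableSet Z)
    (hκ : ∀ S, MeasurableSet S → μ'.real (Z ∩ S) = κ * μ.real (Z ∩ S)) (hS : MeasurableSet S)
    (n : ℕ) :
    |μ'.real S - κ * μ.real S| ≤
      μ'.real {y | ∀ i < n, T^[i] y ∉ Z} + |κ| * μ.real {y | ∀ i < n, T^[i] y ∉ Z} := by
  set F : Set α → Set α := fun S => Zᶜ ∩ T ⁻¹' S
  have hmeas (n : ℕ) : MeasurableSet (F^[n] S) := by
    induction n with
    | zero => exact hS
    | succ n ih =>
      rw [Function.iterate_succ_apply']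
      exact hZ.compl.inter (hT.measurable ih)
  have hdiff (n : ℕ) :
      μ'.real S - κ * μ.real S = μ'.real (F^[n] S) - κ * μ.real (F^[n] S) := by
    induction n with
    | zero => rfl
    | succ n ih =>
      rw [ih, measureReal_eq_add_of_measurePreserving hT hZ (hmeas n),
        measureReal_eq_add_of_measurePreserving hT' hZ (hmeas n), hκ _ (hT.measurable (hmeas n)),
        Function.iterate_succ_apply']
      ring
  have hsub (n : ℕ) : F^[n] S ⊆ {y | ∀ i < n, T^[i] y ∉ Z} := by
    induction n with
    | zero => exact fun _ _ _ hi => absurd hi (Nat.not_lt_zero _)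
    | succ n ih =>
      rw [Function.iterate_succ_apply']
      rintro y ⟨hyZ, hy⟩ (_ | i) hi
      · exact hyZ
      · exact ih hy i (Nat.lt_of_succ_lt_succ hi)
  calc |μ'.real S - κ * μ.real S|
      ≤ μ'.real (F^[n] S) + |κ| * μ.real (F^[n] S) := by
        rw [hdiff n]
        refine (abs_sub _ _).trans_eq ?_
        rw [abs_mul, abs_of_nonneg measureReal_nonneg, abs_of_nonneg measureReal_nonneg]
    _ ≤ _ := add_le_add (measureReal_mono (hsub n))
        (mul_le_mul_of_nonneg_left (measureReal_mono (hsub n)) (abs_nonneg κ))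

end FirstVisit

section ExponentialMoment

variable {k q : ℕ} {B : Matrix (Fin k) (Fin k) ℕ} {h : SFT B → ℝ} {μ μ' : Measure (SFT B)}
  [IsProbabilityMeasure μ]

lemma exp_mul_le_one_add {t x : ℝ} (ht : |t| ≤ 1) (hx : |x| ≤ 1) :
    Real.exp (t * x) ≤ 1 + t ^ 2 + t * x := by
  have htx : |t * x| ≤ 1 := by rw [abs_mul]; exact mul_le_one₀ ht (abs_nonneg x) hx
  have hsq : (t * x) ^ 2 ≤ t ^ 2 := by
    rw [mul_pow]; exact mul_le_of_le_one_right (sq_nonneg t) ((sq_le_one_iff_abs_le_one x).2 hx)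
  linarith [(abs_le.1 (Real.abs_exp_sub_one_sub_id_le htx)).2]

lemma factorsThrough_birkhoffSum (hh : h.FactorsThrough (prefixWord q)) (N : ℕ) :
    (birkhoffSum (shift B)^[q] h N).FactorsThrough (prefixWord (N * q)) := fun y z hyz =>
  Finset.sum_congr rfl fun i hi => by
    have hle : q * i + q ≤ N * q := by
      rw [mul_comm N, ← Nat.mul_succ]
      exact Nat.mul_le_mul_left q (Finset.mem_range.1 hi)
    simpa only [← Function.iterate_mul] using
      factorsThrough_prefixWord_comp_shift_iterate hh hle hyz

lemma integral_exp_birkhoffSum_le (hh : h.FactorsThrough (prefixWord q)) (hh1 : ∀ y, |h y| ≤ 1)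
    (hzero : ∀ (n : ℕ) (Φ : SFT B → ℝ), Φ.FactorsThrough (prefixWord n) →
      ∫ y, Φ y * h ((shift B)^[n] y) ∂μ = 0) {t : ℝ} (ht : |t| ≤ 1) (N : ℕ) :
    ∫ y, Real.exp (t * birkhoffSum (shift B)^[q] h N y) ∂μ ≤ (1 + t ^ 2) ^ N := by
  induction N with
  | zero => simp
  | succ N ih =>
    set Φ : SFT B → ℝ := fun y => Real.exp (t * birkhoffSum (shift B)^[q] h N y)
    have hΦN : Φ.FactorsThrough (prefixWord (N * q)) := fun y z hyz =>
      congrArg (fun s => Real.exp (t * s)) (factorsThrough_birkhoffSum hh N hyz)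
    have hnext : (fun y => h ((shift B)^[N * q] y)).FactorsThrough (prefixWord (N * q + q)) :=
      factorsThrough_prefixWord_comp_shift_iterate hh le_rfl
    have hint : Integrable (fun y => Φ y * h ((shift B)^[N * q] y)) μ :=
      integrable_of_factorsThrough (n := N * q + q) (fun y z hyz => congrArg₂ (· * ·)
        (factorsThrough_prefixWord_comp_shift_iterate hΦN (i := 0) (by omega) hyz) (hnext hyz)) μ
    have hbound (y : SFT B) : Real.exp (t * birkhoffSum (shift B)^[q] h (N + 1) y) ≤
        (1 + t ^ 2) * Φ y + t * (Φ y * h ((shift B)^[N * q] y)) := by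
      rw [birkhoffSum_succ, ← Function.iterate_mul, mul_comm q, mul_add, Real.exp_add]
      nlinarith [mul_le_mul_of_nonneg_left (exp_mul_le_one_add ht (hh1 ((shift B)^[N * q] y)))
        (Real.exp_pos (t * birkhoffSum (shift B)^[q] h N y)).le]
    have hΦint := integrable_of_factorsThrough hΦN μ
    calc ∫ y, Real.exp (t * birkhoffSum (shift B)^[q] h (N + 1) y) ∂μ
        ≤ ∫ y, (1 + t ^ 2) * Φ y + t * (Φ y * h ((shift B)^[N * q] y)) ∂μ :=
          integral_mono (integrable_of_factorsThrough (n := (N + 1) * q) (fun y z hyz =>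
            congrArg (fun s => Real.exp (t * s)) (factorsThrough_birkhoffSum hh (N + 1) hyz)) μ)
            ((hΦint.const_mul _).add (hint.const_mul _)) hbound
      _ = (1 + t ^ 2) * ∫ y, Φ y ∂μ := by
          rw [integral_add (hΦint.const_mul _) (hint.const_mul _), integral_const_mul,
            integral_const_mul, hzero _ Φ hΦN, mul_zero, add_zero]
      _ ≤ (1 + t ^ 2) ^ (N + 1) := by
          rw [pow_succ' _ N]
          exact mul_le_mul_of_nonneg_left ih (add_nonneg zero_le_one (sq_nonneg t))

variable [IsProbabilityMeasure μ'] {D : ℕ → ℝ}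

lemma one_le_of_cylinder_le {d : ℝ} {n : ℕ}
    (hd : ∀ y, μ'.real (cylinder y n) ≤ d * μ.real (cylinder y n)) : 1 ≤ d := by
  simpa using measureReal_le_mul_measureReal_of_cylinder_le hd Set.univ

lemma integral_birkhoffSum_of_measurePreserving {α : Type*} [MeasurableSpace α] {T : α → α}
    {ν : Measure α} (hT : MeasurePreserving T ν ν) {g : α → ℝ} (hg : Integrable g ν) (N : ℕ) :
    ∫ y, birkhoffSum T g N y ∂ν = N * ∫ y, g y ∂ν := by
  have hcomp (i : ℕ) : ∫ y, g (T^[i] y) ∂ν = ∫ y, g y ∂ν := by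
    have hi : ν.map T^[i] = ν := (hT.iterate i).map_eq
    rw [← integral_map (hT.iterate i).aemeasurable (hi.symm ▸ hg.aestronglyMeasurable), hi]
  simp only [birkhoffSum]
  rw [integral_finsetSum (f := fun i y => g (T^[i] y)) _ fun i _ =>
    (hT.iterate i).integrable_comp_of_integrable hg]
  simp only [hcomp, Finset.sum_const, Finset.card_range, nsmul_eq_mul]

lemma mul_integral_le (hq : 1 ≤ q) (hh : h.FactorsThrough (prefixWord q)) (hh1 : ∀ y, |h y| ≤ 1)
    (hzero : ∀ (n : ℕ) (Φ : SFT B → ℝ), Φ.FactorsThrough (prefixWord n) →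
      ∫ y, Φ y * h ((shift B)^[n] y) ∂μ = 0) (hT' : MeasurePreserving (shift B) μ' μ')
    {d t : ℝ} (ht : |t| ≤ 1) {N : ℕ} (hN : 1 ≤ N)
    (hd : ∀ y, μ'.real (cylinder y (N * q)) ≤ d * μ.real (cylinder y (N * q))) :
    t * ∫ y, h y ∂μ' ≤ q * (Real.log d / (N * q : ℕ)) + t ^ 2 := by
  have hNpos : (0 : ℝ) < N := Nat.cast_pos.2 hN
  have hpow : (0 : ℝ) < (1 + t ^ 2) ^ N := pow_pos (by linarith [sq_nonneg t]) N
  have hdpos : 0 < d := one_pos.trans_le (one_le_of_cylinder_le hd)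
  set X : SFT B → ℝ := fun y => t * birkhoffSum (shift B)^[q] h N y with hX
  have hXN : X.FactorsThrough (prefixWord (N * q)) := fun y z hyz =>
    congrArg (t * ·) (factorsThrough_birkhoffSum hh N hyz)
  have hexp : (fun y => Real.exp (X y)).FactorsThrough (prefixWord (N * q)) := fun y z hyz =>
    congrArg Real.exp (hXN hyz)
  have hmean : ∫ y, X y ∂μ' = N * (t * ∫ y, h y ∂μ') := by
    rw [hX, integral_const_mul, integral_birkhoffSum_of_measurePreserving (hT'.iterate q)
      (integrable_of_factorsThrough hh μ')]
    ring
  have hle : Real.exp (N * (t * ∫ y, h y ∂μ')) ≤ d * (1 + t ^ 2) ^ N := calc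
    _ ≤ ∫ y, Real.exp (X y) ∂μ' := by
        rw [← hmean]
        exact convexOn_exp.map_integral_le Real.continuous_exp.continuousOn isClosed_univ
          (ae_of_all _ fun _ => Set.mem_univ _) (integrable_of_factorsThrough hXN μ')
          (integrable_of_factorsThrough hexp μ')
    _ ≤ d * ∫ y, Real.exp (X y) ∂μ :=
        integral_le_mul_integral_of_cylinder_le hd hexp fun y => (Real.exp_pos _).le
    _ ≤ _ := mul_le_mul_of_nonneg_left (integral_exp_birkhoffSum_le hh hh1 hzero ht N) hdpos.le
  have hlog := Real.log_le_log (Real.exp_pos _) hle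
  rw [Real.log_exp, Real.log_mul hdpos.ne' hpow.ne', Real.log_pow] at hlog
  have hsq : Real.log (1 + t ^ 2) ≤ t ^ 2 := by
    linarith [Real.log_le_sub_one_of_pos (show 0 < 1 + t ^ 2 by linarith [sq_nonneg t])]
  have hcancel : (N : ℝ) * (q * (Real.log d / (N * q : ℕ))) = Real.log d := by
    rw [← mul_assoc, ← Nat.cast_mul]
    exact mul_div_cancel₀ _ (Nat.cast_ne_zero.2 (Nat.mul_pos hN hq).ne')
  refine le_of_mul_le_mul_left (hlog.trans ?_) hNpos
  rw [mul_add, hcancel]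
  exact add_le_add_right (mul_le_mul_of_nonneg_left hsq hNpos.le) _

theorem integral_eq_zero_of_subexponential_le (hq : 1 ≤ q) (hh : h.FactorsThrough (prefixWord q))
    (hh1 : ∀ y, |h y| ≤ 1)
    (hzero : ∀ (n : ℕ) (Φ : SFT B → ℝ), Φ.FactorsThrough (prefixWord n) →
      ∫ y, Φ y * h ((shift B)^[n] y) ∂μ = 0) (hT' : MeasurePreserving (shift B) μ' μ')
    (hD : ∀ᶠ n in atTop, ∀ y, μ'.real (cylinder y n) ≤ D n * μ.real (cylinder y n))
    (hlim : Tendsto (fun n : ℕ => Real.log (D n) / n) atTop (𝓝 0)) : ∫ y, h y ∂μ' = 0 := by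
  have hsq {t : ℝ} (ht : |t| ≤ 1) : t * ∫ y, h y ∂μ' ≤ t ^ 2 := by
    have hlim' : Tendsto (fun N : ℕ => q * (Real.log (D (N * q)) / (N * q : ℕ)) + t ^ 2) atTop
        (𝓝 (q * 0 + t ^ 2)) :=
      ((hlim.comp (tendsto_id.atTop_mul_const' hq)).const_mul _).add_const _
    rw [mul_zero, zero_add] at hlim'
    refine ge_of_tendsto hlim' ?_
    filter_upwards [eventually_ge_atTop 1, (tendsto_id.atTop_mul_const' hq).eventually hD]
      with N hN hDN using mul_integral_le hq hh hh1 hzero hT' ht hN hDN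
  -- `t a ≤ t ^ 2` for all small `t` of both signs forces `a = 0`
  have habs {t : ℝ} (ht0 : 0 < t) (ht1 : t ≤ 1) : |∫ y, h y ∂μ'| ≤ t := by
    have hpos := hsq (t := t) (by rwa [abs_of_pos ht0])
    have hneg := hsq (t := -t) (by rwa [abs_neg, abs_of_pos ht0])
    exact abs_le.2 ⟨by nlinarith, by nlinarith⟩
  refine abs_eq_zero.1 (le_antisymm (le_of_forall_pos_le_add fun ε hε => ?_) (abs_nonneg _))
  rw [zero_add]
  exact (habs (lt_min hε one_pos) (min_le_right ε 1)).trans (min_le_left ε 1)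

end ExponentialMoment

section RenewalMeasure

variable {k : ℕ} {B : Matrix (Fin k) (Fin k) ℕ}

/-- A shift-invariant probability measure `ν` with full support for which the symbol `a` is a
renewal state: given that `y_{n+1} = a`, the past and the future of that coordinate are independent,
and the probability of not seeing `a` for a long time decays exponentially. -/
structure IsRenewalMeasure (ν : Measure (SFT B)) (a : Fin k) : Prop where
  isInvariant : IsInvariant ν
  pos : ∀ n y, 0 < ν.real (cylinder y n)
  renewal : ∀ n q (y : SFT B), 1 ≤ q → y.1 n = a →
    ν.real (cylinder y (n + q)) * ν.real (cylinder ((shift B)^[n] y) 1) =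
      ν.real (cylinder y (n + 1)) * ν.real (cylinder ((shift B)^[n] y) q)
  exists_decay : ∃ (K : ℕ) (θ : ℝ), 1 ≤ K ∧ 0 < θ ∧ θ < 1 ∧
    ∀ m, ν.real {y | ∀ i < m * K, y.1 i ≠ a} ≤ θ ^ m

namespace IsRenewalMeasure

variable {a : Fin k} {ν ν' : Measure (SFT B)} {v : SFT B} {q : ℕ}

lemma measureReal_inter_mul (hν : IsRenewalMeasure ν a) (hv : v.1 0 = a) (hq : 1 ≤ q) (n : ℕ)
    (w : Fin n → Fin k) :
    ν.real (prefixWord n ⁻¹' {w} ∩ (shift B)^[n] ⁻¹' cylinder v q) * ν.real (cylinder v 1) =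
      ν.real (prefixWord n ⁻¹' {w} ∩ (shift B)^[n] ⁻¹' cylinder v 1) * ν.real (cylinder v q) := by
  rcases (prefixWord n ⁻¹' {w} ∩ (shift B)^[n] ⁻¹' cylinder v 1).eq_empty_or_nonempty with h | h
  · have hq' : prefixWord n ⁻¹' {w} ∩ (shift B)^[n] ⁻¹' cylinder v q = ∅ :=
      Set.subset_eq_empty
        (Set.inter_subset_inter_right _ (Set.preimage_mono (cylinder_anti v hq))) h
    rw [h, hq', measureReal_empty, zero_mul, zero_mul]
  · obtain ⟨z, rfl, hz⟩ := h
    rw [Set.mem_preimage, mem_cylinder_one_iff, shift_iterate_val, add_zero] at hz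
    obtain ⟨y, hyz, hyv⟩ := exists_splice z v hz.symm
    have hyn : y.1 n = a := by rw [← hv, ← hyv, shift_iterate_val, add_zero]
    have := hν.renewal n q y hq hyn
    simpa only [preimage_prefixWord, ← cylinder_eq_of_mem hyz, ← hyv, ← cylinder_add_eq_inter]

lemma setIntegral_mul (hν : IsRenewalMeasure ν a) (hv : v.1 0 = a) (hq : 1 ≤ q) {n : ℕ}
    {Φ : SFT B → ℝ} (hΦ : Φ.FactorsThrough (prefixWord n)) :
    (∫ y in (shift B)^[n] ⁻¹' cylinder v q, Φ y ∂ν) * ν.real (cylinder v 1) =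
      (∫ y in (shift B)^[n] ⁻¹' cylinder v 1, Φ y ∂ν) * ν.real (cylinder v q) := by
  have := hν.isInvariant.1
  obtain ⟨F, rfl⟩ := exists_eq_comp_prefixWord hΦ
  simp only [Function.comp_apply, integral_comp_prefixWord, Finset.sum_mul,
    measureReal_restrict_apply (measurableSet_preimage_prefixWord n _)]
  exact Finset.sum_congr rfl fun w _ => by
    rw [mul_right_comm, measureReal_inter_mul hν hv hq, mul_right_comm]

/-- The indicator function of `[v_1 ⋯ v_q]` minus its conditional probability given `[v_1]` on
`[v_1]`; it is the observable used to compare an invariant measure with `ν`. -/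
noncomputable def centredIndicator (ν : Measure (SFT B)) (v : SFT B) (q : ℕ) (y : SFT B) : ℝ :=
  (cylinder v q).indicator 1 y -
    ν.real (cylinder v q) / ν.real (cylinder v 1) * (cylinder v 1).indicator 1 y

lemma factorsThrough_centredIndicator (hq : 1 ≤ q) :
    (centredIndicator ν v q).FactorsThrough (prefixWord q) := fun y z hyz => by
  have hmem {j : ℕ} (hj : j ≤ q) : y ∈ cylinder v j ↔ z ∈ cylinder v j :=
    forall₂_congr fun i hi => by rw [show y.1 i = z.1 i from congrFun hyz ⟨i, hi.trans_le hj⟩]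
  have hind {j : ℕ} (hj : j ≤ q) :
      (cylinder v j).indicator (1 : SFT B → ℝ) y = (cylinder v j).indicator 1 z := by
    by_cases hy : y ∈ cylinder v j
    · rw [Set.indicator_of_mem hy, Set.indicator_of_mem ((hmem hj).1 hy)]; rfl
    · rw [Set.indicator_of_notMem hy, Set.indicator_of_notMem (hy ∘ (hmem hj).2)]
  rw [centredIndicator, centredIndicator, hind le_rfl, hind hq]

lemma abs_centredIndicator_le [IsFiniteMeasure ν] (hq : 1 ≤ q) (y : SFT B) :
    |centredIndicator ν v q y| ≤ 1 := by
  have hp0 : 0 ≤ ν.real (cylinder v q) / ν.real (cylinder v 1) :=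
    div_nonneg measureReal_nonneg measureReal_nonneg
  have hp1 : ν.real (cylinder v q) / ν.real (cylinder v 1) ≤ 1 :=
    div_le_one_of_le₀ (measureReal_mono (cylinder_anti v hq)) measureReal_nonneg
  have hle (S : Set (SFT B)) : S.indicator (1 : SFT B → ℝ) y ≤ 1 :=
    Set.indicator_apply_le' (fun _ => le_rfl) fun _ => zero_le_one
  have hnonneg (S : Set (SFT B)) : 0 ≤ S.indicator (1 : SFT B → ℝ) y :=
    Set.indicator_nonneg (fun _ _ => zero_le_one) y
  rw [centredIndicator, abs_le]
  constructor
  · linarith [hnonneg (cylinder v q), mul_le_one₀ hp1 (hnonneg _) (hle (cylinder v 1))]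
  · linarith [hle (cylinder v q), mul_nonneg hp0 (hnonneg (cylinder v 1))]

lemma integral_mul_centredIndicator (hν : IsRenewalMeasure ν a) (hv : v.1 0 = a) (hq : 1 ≤ q)
    {n : ℕ} {Φ : SFT B → ℝ} (hΦ : Φ.FactorsThrough (prefixWord n)) :
    ∫ y, Φ y * centredIndicator ν v q ((shift B)^[n] y) ∂ν = 0 := by
  have := hν.isInvariant.1
  have hΦint := integrable_of_factorsThrough hΦ ν
  have hpre (j : ℕ) : MeasurableSet ((shift B)^[n] ⁻¹' cylinder v j) :=
    (measurableSet_cylinder v j).preimage (continuous_shift.iterate n).measurable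
  have hsplit (y : SFT B) : Φ y * centredIndicator ν v q ((shift B)^[n] y) =
      ((shift B)^[n] ⁻¹' cylinder v q).indicator Φ y -
        ν.real (cylinder v q) / ν.real (cylinder v 1) *
          ((shift B)^[n] ⁻¹' cylinder v 1).indicator Φ y := by
    have hind (j : ℕ) : ((shift B)^[n] ⁻¹' cylinder v j).indicator Φ y =
        Φ y * (cylinder v j).indicator 1 ((shift B)^[n] y) := by
      by_cases hy : (shift B)^[n] y ∈ cylinder v j
      · rw [Set.indicator_of_mem hy, Pi.one_apply, mul_one]
        exact Set.indicator_of_mem (Set.mem_preimage.2 hy) Φ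
      · rw [Set.indicator_of_notMem hy, mul_zero]
        exact Set.indicator_of_notMem (Set.mem_preimage.not.2 hy) Φ
    rw [hind, hind, centredIndicator]
    ring
  simp only [hsplit]
  rw [integral_sub (hΦint.indicator (hpre q)) ((hΦint.indicator (hpre 1)).const_mul _),
    integral_const_mul, integral_indicator (hpre q), integral_indicator (hpre 1),
    div_mul_eq_mul_div, sub_eq_zero, eq_div_iff (hν.pos 1 v).ne', mul_comm (ν.real _)]
  exact setIntegral_mul hν hv hq hΦ

lemma integral_centredIndicator (ν' : Measure (SFT B)) [IsFiniteMeasure ν'] :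
    ∫ y, centredIndicator ν v q y ∂ν' = ν'.real (cylinder v q) -
      ν.real (cylinder v q) / ν.real (cylinder v 1) * ν'.real (cylinder v 1) := by
  have hint (j : ℕ) : Integrable ((cylinder v j).indicator (1 : SFT B → ℝ)) ν' :=
    (integrable_const 1).indicator (measurableSet_cylinder v j)
  simp only [centredIndicator]
  rw [integral_sub (hint q) ((hint 1).const_mul _), integral_const_mul,
    integral_indicator_one (measurableSet_cylinder v q),
    integral_indicator_one (measurableSet_cylinder v 1)]

variable {D : ℕ → ℝ}

lemma measureReal_cylinder_eq_mul (hν : IsRenewalMeasure ν a) (hν' : IsInvariant ν')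
    (hD : ∀ᶠ n in atTop, ∀ y, ν'.real (cylinder y n) ≤ D n * ν.real (cylinder y n))
    (hlim : Tendsto (fun n : ℕ => Real.log (D n) / n) atTop (𝓝 0)) (hv : v.1 0 = a)
    (hq : 1 ≤ q) :
    ν'.real (cylinder v q) =
      ν'.real (cylinder v 1) / ν.real (cylinder v 1) * ν.real (cylinder v q) := by
  have := hν.isInvariant.1
  have := hν'.1
  have hmean := integral_eq_zero_of_subexponential_le hq (factorsThrough_centredIndicator hq)
    (abs_centredIndicator_le hq) (fun n Φ => integral_mul_centredIndicator hν hv hq)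
    hν'.2 hD hlim
  rw [integral_centredIndicator, sub_eq_zero] at hmean
  rw [hmean, div_mul_eq_mul_div, div_mul_eq_mul_div, mul_comm]

lemma exists_measureReal_inter_eq_mul (hν : IsRenewalMeasure ν a) (hν' : IsInvariant ν')
    (hD : ∀ᶠ n in atTop, ∀ y, ν'.real (cylinder y n) ≤ D n * ν.real (cylinder y n))
    (hlim : Tendsto (fun n : ℕ => Real.log (D n) / n) atTop (𝓝 0)) :
    ∃ κ : ℝ, ∀ S, MeasurableSet S →
      ν'.real ({y | y.1 0 = a} ∩ S) = κ * ν.real ({y | y.1 0 = a} ∩ S) := by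
  have := hν.isInvariant.1
  have := hν'.1
  rcases Set.eq_empty_or_nonempty {y : SFT B | y.1 0 = a} with hempty | ⟨v, hv⟩
  · exact ⟨0, fun S _ => by simp [hempty]⟩
  have hZ : {y : SFT B | y.1 0 = a} = cylinder v 1 := by
    ext y; rw [mem_cylinder_one_iff, show v.1 0 = a from hv]; rfl
  have hκ : 0 ≤ ν'.real (cylinder v 1) / ν.real (cylinder v 1) :=
    div_nonneg measureReal_nonneg measureReal_nonneg
  have hext : ν'.restrict (cylinder v 1) =
      (ν'.real (cylinder v 1) / ν.real (cylinder v 1)).toNNReal • ν.restrict (cylinder v 1) := by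
    refine ext_of_cylinder fun y n => (measureReal_eq_measureReal_iff).1 ?_
    rw [measureReal_nnreal_smul_apply, Real.coe_toNNReal _ hκ,
      measureReal_restrict_apply (measurableSet_cylinder y n),
      measureReal_restrict_apply (measurableSet_cylinder y n)]
    rcases (cylinder y n ∩ cylinder v 1).eq_empty_or_nonempty with h | ⟨z, hzy, hzv⟩
    · simp [h]
    · have hz : z.1 0 = a := (mem_cylinder_one_iff.1 hzv).trans hv
      rw [cylinder_inter_cylinder hzy hzv,
        measureReal_cylinder_eq_mul hν hν' hD hlim hz (le_max_right n 1), cylinder_eq_of_mem hzv]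
  refine ⟨ν'.real (cylinder v 1) / ν.real (cylinder v 1), fun S hS => ?_⟩
  have := congrArg (fun μ => μ.real S) hext
  simpa only [measureReal_nnreal_smul_apply, Real.coe_toNNReal _ hκ,
    measureReal_restrict_apply hS, hZ, Set.inter_comm S] using this

lemma tendsto_mul_pow_of_tendsto_log_div {K : ℕ} {θ : ℝ} (hK : 1 ≤ K) (hθ0 : 0 < θ)
    (hθ1 : θ < 1) (hD : ∀ᶠ n in atTop, 0 < D n)
    (hlim : Tendsto (fun n : ℕ => Real.log (D n) / n) atTop (𝓝 0)) :
    Tendsto (fun m => D (m * K) * θ ^ m) atTop (𝓝 0) := by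
  have hrate : Tendsto (fun m : ℕ => K * (Real.log (D (m * K)) / (m * K : ℕ)) + Real.log θ) atTop
      (𝓝 (K * 0 + Real.log θ)) :=
    ((hlim.comp (tendsto_id.atTop_mul_const' hK)).const_mul _).add_const _
  rw [mul_zero, zero_add] at hrate
  refine (Real.tendsto_exp_atBot.comp (tendsto_natCast_atTop_atTop.atTop_mul_neg
    (Real.log_neg hθ0 hθ1) hrate)).congr' ?_
  filter_upwards [eventually_ge_atTop 1, (tendsto_id.atTop_mul_const' hK).eventually hD]
    with m hm hDm
  rw [id] at hDm
  have hm0 : (m : ℝ) ≠ 0 := Nat.cast_ne_zero.2 (Nat.one_le_iff_ne_zero.1 hm)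
  have hK0 : (K : ℝ) ≠ 0 := Nat.cast_ne_zero.2 (Nat.one_le_iff_ne_zero.1 hK)
  have hlog : (m : ℝ) * (K * (Real.log (D (m * K)) / (m * K : ℕ)) + Real.log θ) =
      Real.log (D (m * K)) + m * Real.log θ := by
    push_cast; field_simp
  rw [Function.comp_apply, hlog, Real.exp_add, Real.exp_log hDm, Real.exp_nat_mul,
    Real.exp_log hθ0]

theorem eq_of_subexponential_le (hν : IsRenewalMeasure ν a) (hν' : IsInvariant ν')
    (hD : ∀ᶠ n in atTop, ∀ y, ν'.real (cylinder y n) ≤ D n * ν.real (cylinder y n))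
    (hlim : Tendsto (fun n : ℕ => Real.log (D n) / n) atTop (𝓝 0)) : ν' = ν := by
  have := hν.isInvariant.1
  have := hν'.1
  obtain ⟨κ, hκ⟩ := exists_measureReal_inter_eq_mul hν hν' hD hlim
  obtain ⟨K, θ, hK, hθ0, hθ1, hdecay⟩ := hν.exists_decay
  have hDpos : ∀ᶠ n in atTop, 0 < D n :=
    hD.mono fun n hn => one_pos.trans_le (one_le_of_cylinder_le hn)
  have hZ : MeasurableSet {y : SFT B | y.1 0 = a} :=
    (continuous_val_apply 0).measurable (measurableSet_singleton a)
  have hrem : ∀ᶠ n in atTop,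
      ν'.real {y | ∀ i < n, y.1 i ≠ a} ≤ D n * ν.real {y | ∀ i < n, y.1 i ≠ a} :=
    hD.mono fun n hn => by
      have hpre : {y : SFT B | ∀ i < n, y.1 i ≠ a} = prefixWord n ⁻¹' {w | ∀ i, w i ≠ a} :=
        Set.ext fun y => ⟨fun h i => h i i.2, fun h i hi => h ⟨i, hi⟩⟩
      rw [hpre]
      exact measureReal_le_mul_measureReal_of_cylinder_le hn _
  have hbound {S : Set (SFT B)} (hS : MeasurableSet S) : ∀ᶠ m in atTop,
      |ν'.real S - κ * ν.real S| ≤ D (m * K) * θ ^ m + |κ| * θ ^ m := by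
    filter_upwards [(tendsto_id.atTop_mul_const' hK).eventually hDpos,
      (tendsto_id.atTop_mul_const' hK).eventually hrem] with m hDm hm
    have h := abs_sub_le_of_measurePreserving hν.isInvariant.2 hν'.2 hZ hκ hS (m * K)
    simp only [Set.mem_ofPred_eq, shift_iterate_val, add_zero] at h
    exact h.trans (add_le_add (hm.trans (mul_le_mul_of_nonneg_left (hdecay m) hDm.le))
      (mul_le_mul_of_nonneg_left (hdecay m) (abs_nonneg κ)))
  have heq {S : Set (SFT B)} (hS : MeasurableSet S) : ν'.real S = κ * ν.real S := by
    have hlim' := (tendsto_mul_pow_of_tendsto_log_div hK hθ0 hθ1 hDpos hlim).add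
      ((tendsto_pow_atTop_nhds_zero_of_lt_one hθ0.le hθ1).const_mul |κ|)
    rw [mul_zero, add_zero] at hlim'
    exact sub_eq_zero.1 (abs_nonpos_iff.1 (ge_of_tendsto hlim' (hbound hS)))
  have hκ1 : 1 = κ := by simpa using heq MeasurableSet.univ
  exact Measure.ext fun S hS => (measureReal_eq_measureReal_iff).1 (by rw [heq hS, ← hκ1, one_mul])

end IsRenewalMeasure

end RenewalMeasure

section SubstochasticDecay

variable {ι : Type*} [Fintype ι] {Q R : Matrix ι ι ℝ} {r : ι → ℝ}

lemma mulVec_mono_of_nonneg (hQ : ∀ i j, 0 ≤ Q i j) {x y : ι → ℝ} (hxy : x ≤ y) :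
    Q *ᵥ x ≤ Q *ᵥ y := fun i =>
  dotProduct_le_dotProduct_of_nonneg_left hxy (hQ i)

lemma mulVec_nonneg_of_nonneg (hQ : ∀ i j, 0 ≤ Q i j) {x : ι → ℝ} (hx : 0 ≤ x) : 0 ≤ Q *ᵥ x :=
  fun i => dotProduct_nonneg_of_nonneg (hQ i) hx

variable [DecidableEq ι]

lemma antitone_pow_mulVec (hQ : ∀ i j, 0 ≤ Q i j) (hr : Q *ᵥ r ≤ r) :
    Antitone fun n : ℕ => Q ^ n *ᵥ r :=
  antitone_nat_of_succ_le fun n => by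
    rw [pow_succ, ← Matrix.mulVec_mulVec]
    exact mulVec_mono_of_nonneg (Matrix.pow_apply_nonneg hQ n) hr

lemma add_pow_mulVec_le (hR : ∀ i j, 0 ≤ R i j) (hQ : ∀ i j, 0 ≤ Q i j) (hr0 : 0 ≤ r)
    (hr : (R + Q) *ᵥ r = r) (m : ℕ) :
    (R + Q) ^ m *ᵥ (R *ᵥ r) ≤ r - Q ^ (m + 1) *ᵥ r := by
  induction m with
  | zero =>
    rw [pow_zero, Matrix.one_mulVec, zero_add, pow_one]
    exact (eq_sub_of_add_eq ((Matrix.add_mulVec R Q r).symm.trans hr)).le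
  | succ m ih =>
    have hx : 0 ≤ R *ᵥ (Q ^ (m + 1) *ᵥ r) := mulVec_nonneg_of_nonneg hR
      (mulVec_nonneg_of_nonneg (Matrix.pow_apply_nonneg hQ _) hr0)
    calc (R + Q) ^ (m + 1) *ᵥ (R *ᵥ r) = (R + Q) *ᵥ ((R + Q) ^ m *ᵥ (R *ᵥ r)) := by
          rw [pow_succ', ← Matrix.mulVec_mulVec]
      _ ≤ (R + Q) *ᵥ (r - Q ^ (m + 1) *ᵥ r) :=
          mulVec_mono_of_nonneg (fun i j => add_nonneg (hR i j) (hQ i j)) ih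
      _ = r - Q ^ (m + 2) *ᵥ r - R *ᵥ (Q ^ (m + 1) *ᵥ r) := by
          rw [Matrix.mulVec_sub, hr, Matrix.add_mulVec, pow_succ' Q (m + 1),
            ← Matrix.mulVec_mulVec, sub_sub, add_comm]
      _ ≤ r - Q ^ (m + 2) *ᵥ r := sub_le_self _ hx

lemma exists_pow_mulVec_le_smul (hQ : ∀ i j, 0 ≤ Q i j) (hr0 : 0 ≤ r) (hr : Q *ᵥ r ≤ r)
    (hlt : ∀ i, 0 < r i → ∃ m, (Q ^ m *ᵥ r) i < r i) :
    ∃ (K : ℕ) (θ : ℝ), 1 ≤ K ∧ 0 < θ ∧ θ < 1 ∧ Q ^ K *ᵥ r ≤ θ • r := by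
  have hanti := antitone_pow_mulVec hQ hr
  have hK (i : ι) : ∀ᶠ K in atTop, 0 < r i → (Q ^ K *ᵥ r) i < r i := by
    by_cases hi : 0 < r i
    · obtain ⟨m, hm⟩ := hlt i hi
      filter_upwards [eventually_ge_atTop m] with K hmK _ using (hanti hmK i).trans_lt hm
    · exact Eventually.of_forall fun _ h => absurd h hi
  obtain ⟨K, hK, hK1⟩ := ((eventually_all.2 hK).and (eventually_ge_atTop 1)).exists
  have hθ (i : ι) : ∀ᶠ θ in 𝓝[<] (1 : ℝ), (Q ^ K *ᵥ r) i ≤ θ * r i := by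
    rcases (hr0 i).lt_or_eq with hi | hi
    · have hcont : Tendsto (fun θ : ℝ => θ * r i) (𝓝[<] 1) (𝓝 (1 * r i)) :=
        (continuous_mul_const (r i)).continuousAt.mono_left nhdsWithin_le_nhds
      exact (hcont.eventually_const_lt (by rw [one_mul]; exact hK i hi)).mono fun _ h => h.le
    · have hle : (Q ^ K *ᵥ r) i ≤ r i := by simpa using hanti K.zero_le i
      exact Eventually.of_forall fun θ => hle.trans_eq (by simp [← hi])
  obtain ⟨θ, hθ, hθ01⟩ := ((eventually_all.2 hθ).and (Ioo_mem_nhdsLT zero_lt_one)).exists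
  exact ⟨K, θ, hK1, hθ01.1, hθ01.2, hθ⟩

lemma exists_pow_mul_mulVec_le (hR : ∀ i j, 0 ≤ R i j) (hQ : ∀ i j, 0 ≤ Q i j) (hr0 : 0 ≤ r)
    (hr : (R + Q) *ᵥ r = r) (hreach : ∀ i, 0 < r i → ∃ m, 0 < ((R + Q) ^ m *ᵥ (R *ᵥ r)) i) :
    ∃ (K : ℕ) (θ : ℝ), 1 ≤ K ∧ 0 < θ ∧ θ < 1 ∧ ∀ m, Q ^ (m * K) *ᵥ r ≤ θ ^ m • r := by
  have hQr : Q *ᵥ r ≤ r := calc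
    Q *ᵥ r ≤ R *ᵥ r + Q *ᵥ r := le_add_of_nonneg_left (mulVec_nonneg_of_nonneg hR hr0)
    _ = r := by rw [← Matrix.add_mulVec, hr]
  obtain ⟨K, θ, hK, hθ0, hθ1, hKθ⟩ := exists_pow_mulVec_le_smul hQ hr0 hQr fun i hi => by
    obtain ⟨m, hm⟩ := hreach i hi
    exact ⟨m + 1, sub_pos.1 (hm.trans_le (add_pow_mulVec_le hR hQ hr0 hr m i))⟩
  refine ⟨K, θ, hK, hθ0, hθ1, fun m => ?_⟩
  induction m with
  | zero => simp
  | succ m ih =>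
    calc Q ^ ((m + 1) * K) *ᵥ r = Q ^ (m * K) *ᵥ (Q ^ K *ᵥ r) := by
          rw [add_one_mul, pow_add, Matrix.mulVec_mulVec]
      _ ≤ Q ^ (m * K) *ᵥ (θ • r) :=
          mulVec_mono_of_nonneg (Matrix.pow_apply_nonneg hQ _) hKθ
      _ = θ • Q ^ (m * K) *ᵥ r := Matrix.mulVec_smul _ _ _
      _ ≤ θ • θ ^ m • r := smul_le_smul_of_nonneg_left ih hθ0.le
      _ = θ ^ (m + 1) • r := by rw [smul_smul, pow_succ']

end SubstochasticDecay

section WordMatrix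

variable {k n : ℕ} {ι : Type*} [Fintype ι] [DecidableEq ι] {P : Fin k → Matrix ι ι ℝ}

/-- The product `P_{w_1} ⋯ P_{w_n}` of the matrices attached to the letters of a word. -/
def wordMatrix (P : Fin k → Matrix ι ι ℝ) (w : Fin n → Fin k) : Matrix ι ι ℝ :=
  (List.ofFn fun i => P (w i)).prod

lemma wordMatrix_fin_zero (w : Fin 0 → Fin k) : wordMatrix P w = 1 := by
  rw [wordMatrix, List.ofFn_zero, List.prod_nil]

lemma wordMatrix_snoc (w : Fin n → Fin k) (a : Fin k) :
    wordMatrix P (Fin.snoc w a : Fin (n + 1) → Fin k) = wordMatrix P w * P a := by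
  simp only [wordMatrix, List.ofFn_succ_last, Fin.snoc_castSucc, Fin.snoc_last, List.prod_append,
    List.prod_singleton]

lemma wordMatrix_cons (a : Fin k) (w : Fin n → Fin k) :
    wordMatrix P (Fin.cons a w : Fin (n + 1) → Fin k) = P a * wordMatrix P w := by
  simp only [wordMatrix, List.ofFn_succ, Fin.cons_zero, Fin.cons_succ, List.prod_cons]

lemma wordMatrix_of_forall_eq {a : Fin k} {w : Fin n → Fin k} (hw : ∀ i, w i = a) :
    wordMatrix P w = P a ^ n := by
  simp only [wordMatrix, hw, List.ofFn_const, List.prod_replicate]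

lemma wordMatrix_nonneg (hP : ∀ a i j, 0 ≤ P a i j) (w : Fin n → Fin k) (i j : ι) :
    0 ≤ wordMatrix P w i j := by
  induction w using Fin.snocInduction generalizing i j with
  | elim0 => rw [wordMatrix_fin_zero, Matrix.one_apply]; split_ifs <;> norm_num
  | snoc w a ih =>
    rw [wordMatrix_snoc, Matrix.mul_apply]
    exact Finset.sum_nonneg fun j' _ => mul_nonneg (ih i j') (hP a j' j)

lemma sum_wordMatrix (P : Fin k → Matrix ι ι ℝ) (n : ℕ) :
    ∑ w : Fin n → Fin k, wordMatrix P w = (∑ a, P a) ^ n := by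
  induction n with
  | zero => simp [wordMatrix_fin_zero]
  | succ n ih =>
    rw [← (Fin.snocEquiv fun _ => Fin k).sum_comp, Fintype.sum_prod_type, Finset.sum_comm, pow_succ,
      ← ih, Finset.sum_mul_sum]
    exact Finset.sum_congr rfl fun w _ => Finset.sum_congr rfl fun a _ => wordMatrix_snoc w a

lemma wordMatrix_update_zero (a : Fin k) (w : Fin n → Fin k) :
    wordMatrix (Function.update P a 0) w = if ∀ i, w i ≠ a then wordMatrix P w else 0 := by
  split_ifs with h
  · exact congrArg List.prod (congrArg List.ofFn (funext fun i => Function.update_of_ne (h i) 0 P))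
  · push Not at h
    obtain ⟨i, hi⟩ := h
    refine List.prod_eq_zero (List.mem_ofFn.2 ⟨i, ?_⟩)
    rw [hi, Function.update_self]

variable {B : Matrix (Fin k) (Fin k) ℕ}

lemma wordMatrix_prefixWord_add (n q : ℕ) (y : SFT B) :
    wordMatrix P (prefixWord (n + q) y) =
      wordMatrix P (prefixWord n y) * wordMatrix P (prefixWord q ((shift B)^[n] y)) := by
  induction q with
  | zero => rw [wordMatrix_fin_zero, mul_one, add_zero]
  | succ q ih =>
    rw [← add_assoc, prefixWord_succ, prefixWord_succ, wordMatrix_snoc, wordMatrix_snoc, ih,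
      shift_iterate_val, mul_assoc]

end WordMatrix

section HiddenMarkov

variable {k n : ℕ} {ι : Type*} [Fintype ι] [DecidableEq ι] {P : Fin k → Matrix ι ι ℝ}
  {l r : ι → ℝ} {B : Matrix (Fin k) (Fin k) ℕ} {a : Fin k} {s : ι}

/-- The weight `l P_{w_1} ⋯ P_{w_n} r` of a word. -/
def wordWeight (P : Fin k → Matrix ι ι ℝ) (l r : ι → ℝ) (w : Fin n → Fin k) : ℝ :=
  l ⬝ᵥ (wordMatrix P w *ᵥ r)

/-- Linear-algebraic data of a stationary hidden Markov chain: `P_b` contains the transitions that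
emit the symbol `b`, and `l`, `r` are normalized left and right fixed vectors of the total
transition matrix. No row is assumed to sum to `1`; the role of the constant vector is played by
`r`. -/
structure IsHiddenMarkov (P : Fin k → Matrix ι ι ℝ) (l r : ι → ℝ) : Prop where
  nonneg : ∀ b i j, 0 ≤ P b i j
  left_nonneg : 0 ≤ l
  right_nonneg : 0 ≤ r
  vecMul_sum : l ᵥ* ∑ b, P b = l
  sum_mulVec : (∑ b, P b) *ᵥ r = r
  dotProduct_eq_one : l ⬝ᵥ r = 1

namespace IsHiddenMarkov

lemma wordWeight_nonneg (h : IsHiddenMarkov P l r) (w : Fin n → Fin k) : 0 ≤ wordWeight P l r w :=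
  dotProduct_nonneg_of_nonneg h.left_nonneg
    (mulVec_nonneg_of_nonneg (wordMatrix_nonneg h.nonneg w) h.right_nonneg)

lemma sum_wordWeight_snoc (h : IsHiddenMarkov P l r) (w : Fin n → Fin k) :
    ∑ b, wordWeight P l r (Fin.snoc w b : Fin (n + 1) → Fin k) = wordWeight P l r w := by
  simp only [wordWeight, wordMatrix_snoc]
  rw [← dotProduct_sum, ← Matrix.sum_mulVec, ← Finset.mul_sum, ← Matrix.mulVec_mulVec, h.sum_mulVec]

lemma sum_wordWeight_cons (h : IsHiddenMarkov P l r) (w : Fin n → Fin k) :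
    ∑ b, wordWeight P l r (Fin.cons b w : Fin (n + 1) → Fin k) = wordWeight P l r w := by
  simp only [wordWeight, wordMatrix_cons]
  rw [← dotProduct_sum, ← Matrix.sum_mulVec, ← Finset.sum_mul, ← Matrix.mulVec_mulVec,
    Matrix.dotProduct_mulVec, h.vecMul_sum]

theorem exists_isInvariant (h : IsHiddenMarkov P l r)
    (hrange : ∀ n (w : Fin n → Fin k), wordWeight P l r w ≠ 0 → ∃ y : SFT B, prefixWord n y = w) :
    ∃ ν : Measure (SFT B), IsInvariant ν ∧
      ∀ n (w : Fin n → Fin k), ν.real (prefixWord n ⁻¹' {w}) = wordWeight P l r w := by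
  obtain ⟨ν, hprob, hν⟩ := exists_measure_of_weights (ρ := fun _ => wordWeight P l r)
    (fun w => by rw [wordWeight, wordMatrix_fin_zero, Matrix.one_mulVec, h.dotProduct_eq_one])
    (fun _ => h.wordWeight_nonneg) (fun _ => h.sum_wordWeight_snoc) hrange
  refine ⟨ν, ⟨hprob, measurePreserving_shift_of_sum_cons fun n w => ?_⟩, hν⟩
  simp only [hν]
  exact h.sum_wordWeight_cons w

lemma wordWeight_prefixWord_add (hcol : ∀ i j, j ≠ s → P a i j = 0) {y : SFT B} {n : ℕ}
    (hy : y.1 n = a) (q : ℕ) :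
    wordWeight P l r (prefixWord (n + (q + 1)) y) =
      ((l ᵥ* wordMatrix P (prefixWord n y)) ᵥ* P a) s *
        (wordMatrix P (prefixWord q ((shift B)^[n + 1] y)) *ᵥ r) s := by
  have hdot (u v : ι → ℝ) : u ⬝ᵥ (P a *ᵥ v) = (u ᵥ* P a) s * v s := by
    rw [Matrix.dotProduct_mulVec]
    refine Finset.sum_eq_single_of_mem s (Finset.mem_univ s) fun j _ hj => ?_
    rw [Matrix.vecMul, dotProduct, Finset.sum_eq_zero fun i _ => by rw [hcol i j hj, mul_zero],
      zero_mul]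
  rw [wordWeight, add_comm q, ← add_assoc, wordMatrix_prefixWord_add, prefixWord_succ,
    wordMatrix_snoc, hy, ← Matrix.mulVec_mulVec, ← Matrix.mulVec_mulVec, Matrix.dotProduct_mulVec,
    hdot]

lemma exists_sum_wordWeight_le_pow (h : IsHiddenMarkov P l r) (a : Fin k)
    (hreach : ∀ i, 0 < r i → ∃ m, 0 < ((∑ b, P b) ^ m *ᵥ (P a *ᵥ r)) i) :
    ∃ (K : ℕ) (θ : ℝ), 1 ≤ K ∧ 0 < θ ∧ θ < 1 ∧ ∀ m,
      ∑ w : Fin (m * K) → Fin k, wordWeight (Function.update P a 0) l r w ≤ θ ^ m := by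
  set Q := ∑ b, Function.update P a 0 b with hQ
  have hsum : ∑ b, P b = P a + Q := by
    rw [hQ, Finset.sum_update_of_mem (Finset.mem_univ a), zero_add,
      ← Finset.sum_eq_add_sum_sdiff_singleton_of_mem (Finset.mem_univ a)]
  have hQ0 (i j : ι) : 0 ≤ Q i j := by
    rw [hQ, Matrix.sum_apply]
    refine Finset.sum_nonneg fun b _ => ?_
    rcases eq_or_ne b a with rfl | hb
    · rw [Function.update_self, Matrix.zero_apply]
    · rw [Function.update_of_ne hb]
      exact h.nonneg b i j
  rw [hsum] at hreach
  obtain ⟨K, θ, hK, hθ0, hθ1, hle⟩ := exists_pow_mul_mulVec_le (h.nonneg a) hQ0 h.right_nonneg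
    (hsum ▸ h.sum_mulVec) hreach
  refine ⟨K, θ, hK, hθ0, hθ1, fun m => ?_⟩
  calc ∑ w : Fin (m * K) → Fin k, wordWeight (Function.update P a 0) l r w
      = l ⬝ᵥ (Q ^ (m * K) *ᵥ r) := by
        rw [hQ, ← sum_wordMatrix, Matrix.sum_mulVec, dotProduct_sum]; rfl
    _ ≤ l ⬝ᵥ (θ ^ m • r) := dotProduct_le_dotProduct_of_nonneg_left (hle m) h.left_nonneg
    _ = θ ^ m := by rw [dotProduct_smul, h.dotProduct_eq_one, smul_eq_mul, mul_one]

lemma measureReal_forall_ne_eq_sum {ν : Measure (SFT B)} [IsFiniteMeasure ν] {n : ℕ}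
    (hν : ∀ w : Fin n → Fin k, ν.real (prefixWord n ⁻¹' {w}) = wordWeight P l r w) (a : Fin k) :
    ν.real {y | ∀ i < n, y.1 i ≠ a} =
      ∑ w : Fin n → Fin k, wordWeight (Function.update P a 0) l r w := by
  have hset : {y : SFT B | ∀ i < n, y.1 i ≠ a} = prefixWord n ⁻¹'
      (Finset.univ.filter fun w : Fin n → Fin k => ∀ i, w i ≠ a) := by
    ext y
    simp [Fin.forall_iff, prefixWord]
  rw [hset, ← sum_measureReal_preimage_singleton _ fun w _ =>
    measurableSet_preimage_prefixWord n {w}, Finset.sum_filter]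
  refine Finset.sum_congr rfl fun w _ => ?_
  rw [hν, wordWeight, wordWeight, wordMatrix_update_zero]
  split_ifs <;> simp

theorem exists_isRenewalMeasure (h : IsHiddenMarkov P l r)
    (hrange : ∀ n (w : Fin n → Fin k), wordWeight P l r w ≠ 0 → ∃ y : SFT B, prefixWord n y = w)
    (hpos : ∀ n (y : SFT B), 0 < wordWeight P l r (prefixWord n y))
    (hcol : ∀ i j, j ≠ s → P a i j = 0)
    (hreach : ∀ i, 0 < r i → ∃ m, 0 < ((∑ b, P b) ^ m *ᵥ (P a *ᵥ r)) i) :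
    ∃ ν : Measure (SFT B), IsRenewalMeasure ν a ∧
      ∀ n y, ν.real (cylinder y n) = wordWeight P l r (prefixWord n y) := by
  obtain ⟨ν, hinv, hν⟩ := h.exists_isInvariant hrange
  have := hinv.1
  have hcyl (n : ℕ) (y : SFT B) : ν.real (cylinder y n) = wordWeight P l r (prefixWord n y) := by
    rw [← preimage_prefixWord, hν]
  obtain ⟨K, θ, hK, hθ0, hθ1, hle⟩ := h.exists_sum_wordWeight_le_pow a hreach
  refine ⟨ν, ⟨hinv, fun n y => (hpos n y).trans_eq (hcyl n y).symm, fun n q y hq hy => ?_,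
    K, θ, hK, hθ0, hθ1, fun m => ?_⟩, hcyl⟩
  · obtain ⟨q, rfl⟩ := Nat.exists_eq_add_of_le' hq
    have hy' : ((shift B)^[n] y).1 0 = a := by rw [shift_iterate_val, add_zero, hy]
    have hn (q : ℕ) := (hcyl _ y).trans (wordWeight_prefixWord_add hcol hy q)
    have h0 (q : ℕ) := (hcyl _ _).trans (wordWeight_prefixWord_add hcol hy' q)
    simp only [zero_add, Function.iterate_one, ← Function.iterate_succ_apply',
      Nat.succ_eq_add_one] at h0
    refine (congrArg₂ (· * ·) (hn q) (h0 0)).trans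
      (Eq.trans ?_ (congrArg₂ (· * ·) (hn 0) (h0 q)).symm)
    ring
  · rw [measureReal_forall_ne_eq_sum (hν _)]
    exact hle m

end IsHiddenMarkov

end HiddenMarkov

section PathWeight

variable {ι κ : Type*} {n : ℕ}

/-- The product `M_{w_0 w_1} ⋯ M_{w_{n-1} w_n}` of the transition weights along a word. -/
def pathWeight (M : Matrix ι ι ℝ) (w : Fin (n + 1) → ι) : ℝ :=
  ∏ i : Fin n, M (w i.castSucc) (w i.succ)

variable {M : Matrix ι ι ℝ}

lemma pathWeight_cons (i : ι) (w : Fin (n + 1) → ι) :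
    pathWeight M (Fin.cons i w : Fin (n + 2) → ι) = M i (w 0) * pathWeight M w := by
  simp only [pathWeight, Fin.prod_univ_succ (n := n), Fin.castSucc_zero, Fin.cons_zero,
    Fin.cons_succ, ← Fin.succ_castSucc]

lemma pathWeight_snoc (w : Fin (n + 1) → ι) (j : ι) :
    pathWeight M (Fin.snoc w j : Fin (n + 2) → ι) = pathWeight M w * M (w (Fin.last n)) j := by
  simp only [pathWeight, Fin.prod_univ_castSucc (n := n), Fin.snoc_castSucc, Fin.succ_castSucc,
    Fin.succ_last, Fin.snoc_last]

lemma pathWeight_smul (c : ℝ) (w : Fin (n + 1) → ι) :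
    pathWeight (c • M) w = c ^ n * pathWeight M w := by
  simp only [pathWeight, Matrix.smul_apply, smul_eq_mul, Finset.prod_mul_distrib,
    Finset.prod_const, Finset.card_univ, Fintype.card_fin]

lemma mulVec_apply_pos [Fintype ι] (hM : ∀ i j, 0 ≤ M i j) {v : ι → ℝ} (hv : 0 ≤ v) {i j : ι}
    (hij : 0 < M i j) (hj : 0 < v j) : 0 < (M *ᵥ v) i :=
  Finset.sum_pos' (fun j _ => mul_nonneg (hM i j) (hv j)) ⟨j, Finset.mem_univ _, mul_pos hij hj⟩

lemma pow_apply_pos_of_path [Fintype ι] [DecidableEq ι] (hM : ∀ i j, 0 ≤ M i j) {z : ℕ → ι}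
    (hz : ∀ m, 0 < M (z m) (z (m + 1))) (m : ℕ) : 0 < (M ^ m) (z 0) (z m) := by
  induction m with
  | zero => simp
  | succ m ih =>
    rw [pow_succ, Matrix.mul_apply]
    exact Finset.sum_pos' (fun j _ => mul_nonneg (Matrix.pow_apply_nonneg hM m _ _) (hM _ _))
      ⟨z m, Finset.mem_univ _, mul_pos ih (hz m)⟩

variable [DecidableEq κ] {p : ι → κ} {l : ι → ℝ}

/-- The part of `N` consisting of the transitions into the states over the symbol `b`. -/
def symbolMatrix (p : ι → κ) (N : Matrix ι ι ℝ) (b : κ) : Matrix ι ι ℝ :=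
  Matrix.of fun i j => if p j = b then N i j else 0

lemma symbolMatrix_apply (N : Matrix ι ι ℝ) (b : κ) (i j : ι) :
    symbolMatrix p N b i j = if p j = b then N i j else 0 := rfl

lemma symbolMatrix_nonneg {N : Matrix ι ι ℝ} (hN : ∀ i j, 0 ≤ N i j) (b : κ) (i j : ι) :
    0 ≤ symbolMatrix p N b i j := by
  rw [symbolMatrix_apply]
  split_ifs
  exacts [hN i j, le_rfl]

lemma sum_symbolMatrix [Fintype κ] (p : ι → κ) (N : Matrix ι ι ℝ) :
    ∑ b, symbolMatrix p N b = N := by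
  ext i j
  simp only [Matrix.sum_apply, symbolMatrix_apply, Finset.sum_ite_eq, Finset.mem_univ, if_true]

variable [Fintype ι]

lemma vecMul_symbolMatrix (hl : l ᵥ* M = l) (b : κ) (j : ι) :
    (l ᵥ* symbolMatrix p M b) j = if p j = b then l j else 0 := by
  simp only [Matrix.vecMul, dotProduct, symbolMatrix_apply, mul_ite, mul_zero]
  split_ifs
  · exact congrFun hl j
  · exact Finset.sum_const_zero

lemma wordWeight_symbolMatrix [DecidableEq ι] {k : ℕ} {p : ι → Fin k} (hl : l ᵥ* M = l)
    (r : ι → ℝ) (y : Fin (n + 1) → Fin k) :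
    wordWeight (symbolMatrix p M) l r y = ∑ w : Fin (n + 1) → ι with ∀ i, p (w i) = y i,
      l (w 0) * pathWeight M w * r (w (Fin.last n)) := by
  induction n generalizing r with
  | zero =>
    rw [wordWeight, ← Fin.snoc_init_self y, wordMatrix_snoc, wordMatrix_fin_zero, one_mul,
      Matrix.dotProduct_mulVec, dotProduct, Finset.sum_filter]
    refine Fintype.sum_equiv (Equiv.funUnique (Fin 1) ι).symm _ _ fun j => ?_
    simp [vecMul_symbolMatrix hl, pathWeight, Fin.snoc]
  | succ n ih =>
    have hsnoc (q : ι × (Fin (n + 1) → ι)) : (Fin.snocEquiv fun _ : Fin (n + 2) => ι) q =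
      (Fin.snoc q.2 q.1 : Fin (n + 2) → ι) := rfl
    have hzero (w : Fin (n + 1) → ι) (j : ι) : (Fin.snoc w j : Fin (n + 2) → ι) 0 = w 0 :=
      Fin.snoc_castSucc (α := fun _ => ι) j w 0
    rw [← Fin.snoc_init_self y, wordWeight, wordMatrix_snoc, ← Matrix.mulVec_mulVec, ← wordWeight,
      ih, Finset.sum_filter, Finset.sum_filter, ← (Fin.snocEquiv fun _ : Fin (n + 2) => ι).sum_comp,
      Fintype.sum_prod_type_right]
    refine Finset.sum_congr rfl fun w _ => ?_
    simp only [hsnoc, hzero, Fin.forall_fin_succ' (n := n + 1), Fin.snoc_castSucc, Fin.snoc_last,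
      pathWeight_snoc, Matrix.mulVec, dotProduct, symbolMatrix_apply]
    by_cases hw : ∀ i, p (w i) = Fin.init y i
    · simp only [hw, implies_true, if_true, true_and, Finset.mul_sum]
      refine Finset.sum_congr rfl fun j _ => ?_
      split_ifs
      · ring
      · ring
    · simp only [hw, if_false, false_and, Finset.sum_const_zero]

end PathWeight

section WeightMatrix

variable {k : ℕ} {A : Matrix (Fin k) (Fin k) ℕ} {φ : Fin k → Fin k → ℝ} {n : ℕ}

/-- The symbol `i` occurs in a point of the subshift; rows and columns of `A` may vanish, so not
every symbol need occur. -/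
def Appears (A : Matrix (Fin k) (Fin k) ℕ) (i : Fin k) : Prop := ∃ x : SFT A, x.1 0 = i

lemma appears_apply (x : SFT A) (n : ℕ) : Appears A (x.1 n) :=
  ⟨(shift A)^[n] x, shift_iterate_val n x 0⟩

lemma mem_blocks_iff {w : Fin n → Fin k} :
    w ∈ blocks (SFT A) n ↔ ∃ x : SFT A, prefixWord n x = w := by
  constructor
  · rintro ⟨x, hx, m, hm⟩
    exact ⟨(shift A)^[m] ⟨x, hx⟩, funext fun i => (shift_iterate_val m _ i).trans (hm i)⟩
  · rintro ⟨x, rfl⟩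
    exact ⟨x.1, x.2, 0, fun i => by rw [zero_add]; rfl⟩

lemma weightMatrix_nonneg (A : Matrix (Fin k) (Fin k) ℕ) (φ : Fin k → Fin k → ℝ) (i j : Fin k) :
    0 ≤ weightMatrix A φ i j := by
  rw [weightMatrix, Matrix.of_apply]
  split_ifs
  exacts [(Real.exp_pos _).le, le_rfl]

lemma normalizedWeight_nonneg (φ : Fin k → Fin k → ℝ) {t : ℝ} (ht : 0 ≤ t) (i j : Fin k) :
    0 ≤ (t⁻¹ • weightMatrix A φ) i j :=
  mul_nonneg (inv_nonneg.2 ht) (weightMatrix_nonneg A φ i j)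

lemma weightMatrix_apply_point (x : SFT A) (n : ℕ) :
    weightMatrix A φ (x.1 n) (x.1 (n + 1)) = Real.exp (φ (x.1 n) (x.1 (n + 1))) := by
  rw [weightMatrix, Matrix.of_apply, if_pos]
  refine ⟨x.1, x.2, n, fun i => ?_⟩
  fin_cases i <;> rfl

lemma weightMatrix_point_pos (φ : Fin k → Fin k → ℝ) (x : SFT A) (n : ℕ) :
    0 < weightMatrix A φ (x.1 n) (x.1 (n + 1)) :=
  weightMatrix_apply_point x n ▸ Real.exp_pos _

lemma exists_of_weightMatrix_ne_zero {i j : Fin k} (h : weightMatrix A φ i j ≠ 0) :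
    ∃ x : SFT A, x.1 0 = i ∧ x.1 1 = j := by
  have hij : ![i, j] ∈ blocks (SFT A) 2 := by
    by_contra hij
    exact h (if_neg hij)
  obtain ⟨x, hx⟩ := mem_blocks_iff.1 hij
  exact ⟨x, congrFun hx 0, congrFun hx 1⟩

lemma pathWeight_prefixWord_pos (φ : Fin k → Fin k → ℝ) (n : ℕ) (x : SFT A) :
    0 < pathWeight (weightMatrix A φ) (prefixWord (n + 1) x) :=
  Finset.prod_pos fun i _ => weightMatrix_point_pos φ x i

lemma exists_prefixWord_eq_of_pathWeight_ne_zero {w : Fin (n + 1) → Fin k}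
    (hw : pathWeight (weightMatrix A φ) w ≠ 0) (hlast : Appears A (w (Fin.last n))) :
    ∃ x : SFT A, prefixWord (n + 1) x = w := by
  induction n with
  | zero =>
    obtain ⟨x, hx⟩ := hlast
    exact ⟨x, funext fun i => by rw [Fin.fin_one_eq_zero i]; exact hx⟩
  | succ n ih =>
    rw [← Fin.cons_self_tail w, pathWeight_cons] at hw
    obtain ⟨x, hx⟩ := ih (right_ne_zero_of_mul hw) hlast
    obtain ⟨z, hz0, hz1⟩ := exists_of_weightMatrix_ne_zero (left_ne_zero_of_mul hw)
    obtain ⟨x', hx'z, hx'x⟩ := exists_splice z x (hz1.symm ▸ congrFun hx 0)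
    refine ⟨x', ?_⟩
    rw [prefixWord_succ', ← Fin.cons_self_tail w, hx'z 0 zero_lt_one, hz0, ← hx]
    exact congrArg (fun v => (Fin.cons (w 0) (prefixWord (n + 1) v) : Fin (n + 2) → Fin k)) hx'x

lemma exists_path (hirr : IsIrreducible (SFT A)) {i j : Fin k} (hi : Appears A i)
    (hj : Appears A j) : ∃ (x : SFT A) (m : ℕ), x.1 0 = i ∧ x.1 (m + 1) = j := by
  have hmem {i : Fin k} (hi : Appears A i) : (fun _ => i) ∈ blocks (SFT A) 1 := by
    obtain ⟨x, hx⟩ := hi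
    exact mem_blocks_iff.2 ⟨x, funext fun a => by rw [Subsingleton.elim a 0]; exact hx⟩
  obtain ⟨m, w, -, hw⟩ := hirr 1 1 _ (hmem hi) _ (hmem hj)
  obtain ⟨x, hx⟩ := mem_blocks_iff.1 hw
  refine ⟨x, m, ?_, ?_⟩
  · have h := congrFun hx (Fin.castAdd 1 (Fin.castAdd m 0))
    rwa [Fin.append_left, Fin.append_left] at h
  · have h := congrFun hx (Fin.natAdd (1 + m) 0)
    rw [Fin.append_right] at h
    rw [add_comm]
    exact h

lemma isIrreducible_weightMatrix (φ : Fin k → Fin k → ℝ) (hirr : IsIrreducible (SFT A)) :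
    ((weightMatrix A φ).submatrix Subtype.val Subtype.val :
      Matrix {i // Appears A i} {i // Appears A i} ℝ).IsIrreducible := by
  classical
  have hnonneg (i j : {i // Appears A i}) := weightMatrix_nonneg A φ i j
  refine (Matrix.isIrreducible_iff_exists_pow_pos hnonneg).2 ?_
  rintro ⟨i, hi⟩ ⟨j, hj⟩
  obtain ⟨x, m, rfl, rfl⟩ := exists_path hirr hi hj
  exact ⟨m + 1, m.succ_pos, pow_apply_pos_of_path hnonneg
    (z := fun n => ⟨x.1 n, appears_apply x n⟩) (weightMatrix_point_pos φ x) (m + 1)⟩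

end WeightMatrix

section Normalization

variable {k k' : ℕ} {A : Matrix (Fin k) (Fin k) ℕ} {B : Matrix (Fin k') (Fin k') ℕ}
  {φ : Fin k → Fin k → ℝ} {p : Fin k → Fin k'} {π : SFT A → SFT B} {l r : Fin k → ℝ} {t : ℝ}
  {a : Fin k'} {s : Fin k} {n : ℕ}

theorem exists_isHiddenMarkov (φ : Fin k → Fin k → ℝ) (p : Fin k → Fin k')
    (hirr : IsIrreducible (SFT A)) (hs : Appears A s) :
    ∃ (t : ℝ) (l r : Fin k → ℝ), 0 < t ∧ (∀ i, 0 < l i ↔ Appears A i) ∧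
      (∀ i, 0 < r i ↔ Appears A i) ∧
      IsHiddenMarkov (symbolMatrix p (t⁻¹ • weightMatrix A φ)) l r := by
  have : Nonempty {i // Appears A i} := ⟨⟨s, hs⟩⟩
  have happears (i j : Fin k) (h : weightMatrix A φ i j ≠ 0) : Appears A i ∧ Appears A j := by
    obtain ⟨x, rfl, rfl⟩ := exists_of_weightMatrix_ne_zero h
    exact ⟨appears_apply x 0, appears_apply x 1⟩
  obtain ⟨t, l, r, ht, hl0, hr0, hl, hr, hlM, hMr, hlr⟩ :=
    exists_left_right_eigenvectors_of_support happears (isIrreducible_weightMatrix φ hirr)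
  refine ⟨t, l, r, ht, hl, hr,
    symbolMatrix_nonneg (normalizedWeight_nonneg φ ht.le), hl0, hr0, ?_, ?_, hlr⟩
  · rw [sum_symbolMatrix, Matrix.vecMul_smul, hlM, inv_smul_smul₀ ht.ne']
  · rw [sum_symbolMatrix, Matrix.smul_mulVec, hMr, inv_smul_smul₀ ht.ne']

lemma IsHiddenMarkov.wordWeight_prefixWord_pos
    (h : IsHiddenMarkov (symbolMatrix p (t⁻¹ • weightMatrix A φ)) l r) (ht : 0 < t)
    (hl : ∀ i, 0 < l i ↔ Appears A i) (hr : ∀ i, 0 < r i ↔ Appears A i)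
    (hπ : Function.Surjective π) (hcode : IsOneBlockCode π p) (n : ℕ) (y : SFT B) :
    0 < wordWeight (symbolMatrix p (t⁻¹ • weightMatrix A φ)) l r (prefixWord n y) := by
  obtain ⟨x, rfl⟩ := hπ y
  rcases n with _ | n
  · rw [wordWeight, wordMatrix_fin_zero, Matrix.one_mulVec, h.dotProduct_eq_one]
    exact one_pos
  rw [wordWeight_symbolMatrix (sum_symbolMatrix p (t⁻¹ • weightMatrix A φ) ▸ h.vecMul_sum)]
  refine Finset.sum_pos' (fun w _ => mul_nonneg (mul_nonneg (h.left_nonneg _) ?_)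
    (h.right_nonneg _)) ⟨prefixWord (n + 1) x, Finset.mem_filter.2 ⟨Finset.mem_univ _, fun i =>
      (hcode x i).symm⟩, mul_pos (mul_pos ((hl _).2 (appears_apply x _)) ?_)
        ((hr _).2 (appears_apply x _))⟩
  · exact Finset.prod_nonneg fun i _ => normalizedWeight_nonneg φ ht.le _ _
  · rw [pathWeight_smul]
    exact mul_pos (pow_pos (inv_pos.2 ht) n) (pathWeight_prefixWord_pos φ n x)

lemma exists_prefixWord_eq_of_term_ne_zero (hr : ∀ i, 0 < r i ↔ Appears A i) (hr0 : 0 ≤ r)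
    {w : Fin (n + 1) → Fin k}
    (hw : l (w 0) * pathWeight (t⁻¹ • weightMatrix A φ) w * r (w (Fin.last n)) ≠ 0) :
    ∃ x : SFT A, prefixWord (n + 1) x = w := by
  have hpath := right_ne_zero_of_mul (left_ne_zero_of_mul hw)
  rw [pathWeight_smul] at hpath
  exact exists_prefixWord_eq_of_pathWeight_ne_zero (right_ne_zero_of_mul hpath)
    ((hr _).1 ((hr0 _).lt_of_ne' (right_ne_zero_of_mul hw)))

lemma IsHiddenMarkov.exists_prefixWord_eq
    (h : IsHiddenMarkov (symbolMatrix p (t⁻¹ • weightMatrix A φ)) l r)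
    (hr : ∀ i, 0 < r i ↔ Appears A i) (hs : Appears A s) (hcode : IsOneBlockCode π p)
    {w : Fin n → Fin k'} (hw : wordWeight (symbolMatrix p (t⁻¹ • weightMatrix A φ)) l r w ≠ 0) :
    ∃ y : SFT B, prefixWord n y = w := by
  rcases n with _ | n
  · obtain ⟨x, -⟩ := hs
    exact ⟨π x, Subsingleton.elim _ _⟩
  rw [wordWeight_symbolMatrix (sum_symbolMatrix p (t⁻¹ • weightMatrix A φ) ▸ h.vecMul_sum)] at hw
  obtain ⟨v, hv, hne⟩ := Finset.exists_ne_zero_of_sum_ne_zero hw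
  obtain ⟨x, rfl⟩ := exists_prefixWord_eq_of_term_ne_zero hr h.right_nonneg hne
  exact ⟨π x, funext fun i => (hcode x i).trans ((Finset.mem_filter.1 hv).2 i)⟩

lemma exists_pow_mulVec_symbolMatrix_pos (hirr : IsIrreducible (SFT A)) (ht : 0 < t)
    (hr : ∀ i, 0 < r i ↔ Appears A i) (hr0 : 0 ≤ r) (hs : Appears A s) {i : Fin k}
    (hi : 0 < r i) :
    ∃ m, 0 < ((t⁻¹ • weightMatrix A φ) ^ m *ᵥ
      (symbolMatrix p (t⁻¹ • weightMatrix A φ) (p s) *ᵥ r)) i := by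
  have hnonneg := normalizedWeight_nonneg (A := A) φ ht.le
  obtain ⟨x, m, rfl, rfl⟩ := exists_path hirr ((hr i).1 hi) hs
  have hx (n : ℕ) : 0 < (t⁻¹ • weightMatrix A φ) (x.1 n) (x.1 (n + 1)) :=
    mul_pos (inv_pos.2 ht) (weightMatrix_point_pos φ x n)
  have hlast : 0 < symbolMatrix p (t⁻¹ • weightMatrix A φ) (p (x.1 (m + 1)))
      (x.1 m) (x.1 (m + 1)) := by
    rw [symbolMatrix_apply, if_pos rfl]
    exact hx m
  have hstep := mulVec_apply_pos (symbolMatrix_nonneg hnonneg _) hr0 hlast ((hr _).2 hs)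
  exact ⟨m, mulVec_apply_pos (Matrix.pow_apply_nonneg hnonneg m)
    (mulVec_nonneg_of_nonneg (symbolMatrix_nonneg hnonneg _) hr0)
    (pow_apply_pos_of_path hnonneg hx m) hstep⟩

end Normalization

section Selection

variable {k k' : ℕ} {A : Matrix (Fin k) (Fin k) ℕ} {B : Matrix (Fin k') (Fin k') ℕ}
  {p : Fin k → Fin k'} {n : ℕ}

open Classical in
lemma IsSelection.sum_prefixWord {y : ℕ → Fin k'} {E : Finset (SFT A)} (hE : IsSelection A p n y E)
    (u : (Fin n → Fin k) → ℝ) :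
    ∑ x ∈ E, u (prefixWord n x) = ∑ w with w ∈ fiberBlocks A p n y, u w := by
  refine Finset.sum_nbij (prefixWord n) (fun x hx => ?_) (fun x hx x' hx' hxx' => ?_)
    (fun w hw => ?_) fun _ _ => rfl
  · exact Finset.mem_filter.2 ⟨Finset.mem_univ _, hE.1 x hx⟩
  · exact (hE.2 _ (hE.1 x hx)).unique ⟨hx, fun _ => rfl⟩ ⟨hx', fun i => (congrFun hxx' i).symm⟩
  · obtain ⟨x, ⟨hx, hxw⟩, -⟩ := hE.2 w (Finset.mem_filter.1 hw).2
    exact ⟨x, hx, funext hxw⟩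

lemma exists_isSelection (A : Matrix (Fin k) (Fin k) ℕ) (p : Fin k → Fin k') (n : ℕ)
    (y : ℕ → Fin k') : ∃ E : Finset (SFT A), IsSelection A p n y E := by
  classical
  choose s hs using fun w : fiberBlocks A p n y => mem_blocks_iff.1 w.2.1
  refine ⟨Finset.univ.image s, fun x hx => ?_, fun w hw => ⟨s ⟨w, hw⟩,
    ⟨Finset.mem_image_of_mem _ (Finset.mem_univ _), congrFun (hs ⟨w, hw⟩)⟩, ?_⟩⟩
  · obtain ⟨w, -, rfl⟩ := Finset.mem_image.1 hx
    exact (congrArg (· ∈ fiberBlocks A p n y) (hs w)).mpr w.2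
  · rintro x ⟨hx, hxw⟩
    obtain ⟨w', -, rfl⟩ := Finset.mem_image.1 hx
    exact congrArg s (Subtype.ext ((hs w').symm.trans (funext hxw)))

lemma relSeq_mem_Icc {f : SFT A → ℝ} {y : SFT B} {a b : ℝ}
    (h : ∀ E : Finset (SFT A), IsSelection A p n y.1 E →
      ∑ x ∈ E, Real.exp (birkhoffSum (shift A) f n x) ∈ Set.Icc a b) :
    relSeq p f n y ∈ Set.Icc a b := by
  obtain ⟨E, hE⟩ := exists_isSelection A p n y.1
  have hmem : ∀ s ∈ {s | ∃ E : Finset (SFT A), IsSelection A p n y.1 E ∧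
      s = ∑ x ∈ E, Real.exp (birkhoffSum (shift A) f n x)}, s ∈ Set.Icc a b := by
    rintro _ ⟨E, hE, rfl⟩
    exact h E hE
  exact ⟨(h E hE).1.trans (le_csSup ⟨b, fun s hs => (hmem s hs).2⟩ ⟨E, hE, rfl⟩),
    csSup_le ⟨_, E, hE, rfl⟩ fun s hs => (hmem s hs).2⟩

end Selection

section Comparison

/-- `g` agrees up to a bounded factor with `e^{nτ} ν[y_1 ⋯ y_n]`; stated for logarithms. -/
def IsComparable {k : ℕ} {B : Matrix (Fin k) (Fin k) ℕ} (g : ℕ → SFT B → ℝ)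
    (ν : Measure (SFT B)) (τ c : ℝ) : Prop :=
  ∀ n, 1 ≤ n → ∀ y, 0 < g n y ∧ |Real.log (g n y) - (n * τ + Real.log (ν.real (cylinder y n)))| ≤ c

variable {k k' : ℕ} {A : Matrix (Fin k) (Fin k) ℕ} {B : Matrix (Fin k') (Fin k') ℕ}
  {φ : Fin k → Fin k → ℝ} {p : Fin k → Fin k'} {π : SFT A → SFT B} {f : SFT A → ℝ}
  {l r : Fin k → ℝ} {t : ℝ} {s : Fin k}

lemma exp_birkhoffSum (hf : ∀ x : SFT A, f x = φ (x.1 0) (x.1 1)) (n : ℕ) (x : SFT A) :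
    Real.exp (birkhoffSum (shift A) f n x) =
      pathWeight (weightMatrix A φ) (prefixWord (n + 1) x) := by
  rw [birkhoffSum, Real.exp_sum, Finset.prod_range]
  refine Finset.prod_congr rfl fun i _ => ?_
  rw [hf, shift_iterate_val, shift_iterate_val]
  exact (weightMatrix_apply_point x i).symm

lemma exists_exp_birkhoffSum_mem_Icc (hf : ∀ x : SFT A, f x = φ (x.1 0) (x.1 1)) (ht : 0 < t)
    (hl : ∀ i, 0 < l i ↔ Appears A i) (hr : ∀ i, 0 < r i ↔ Appears A i) :
    ∃ c, ∀ n (x : SFT A), Real.exp (birkhoffSum (shift A) f (n + 1) x) ∈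
      Set.Icc (Real.exp (-c) * (t ^ (n + 1) * (l (x.1 0) *
          pathWeight (t⁻¹ • weightMatrix A φ) (prefixWord (n + 1) x) * r (x.1 n))))
        (Real.exp c * (t ^ (n + 1) * (l (x.1 0) *
          pathWeight (t⁻¹ • weightMatrix A φ) (prefixWord (n + 1) x) * r (x.1 n)))) := by
  set ρ : Fin k × Fin k × Fin k → ℝ := fun i =>
    weightMatrix A φ i.2.1 i.2.2 / (t * l i.1 * r i.2.1) with hρ
  obtain ⟨c, hc⟩ := Finite.exists_le fun i => |Real.log (ρ i)|
  refine ⟨c, fun n x => ?_⟩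
  have hl0 := (hl _).2 (appears_apply x 0)
  have hr0 := (hr _).2 (appears_apply x n)
  have hρ0 : 0 < ρ (x.1 0, x.1 n, x.1 (n + 1)) :=
    div_pos (weightMatrix_point_pos φ x n) (mul_pos (mul_pos ht hl0) hr0)
  set W := t ^ (n + 1) * (l (x.1 0) *
    pathWeight (t⁻¹ • weightMatrix A φ) (prefixWord (n + 1) x) * r (x.1 n)) with hW
  have hpath := pathWeight_prefixWord_pos φ n x
  have hW0 : 0 ≤ W := by
    rw [hW, pathWeight_smul]
    positivity
  have heq : Real.exp (birkhoffSum (shift A) f (n + 1) x) =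
      ρ (x.1 0, x.1 n, x.1 (n + 1)) * W := by
    rw [exp_birkhoffSum hf, prefixWord_succ, pathWeight_snoc, hρ, hW, pathWeight_smul, inv_pow,
      pow_succ]
    change _ * weightMatrix A φ (x.1 n) (x.1 (n + 1)) = _
    field_simp
  have hbound := abs_le.1 (hc (x.1 0, x.1 n, x.1 (n + 1)))
  rw [heq]
  exact ⟨mul_le_mul_of_nonneg_right ((Real.le_log_iff_exp_le hρ0).1 hbound.1) hW0,
    mul_le_mul_of_nonneg_right ((Real.log_le_iff_le_exp hρ0).1 hbound.2) hW0⟩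

lemma IsHiddenMarkov.sum_isSelection
    (h : IsHiddenMarkov (symbolMatrix p (t⁻¹ • weightMatrix A φ)) l r)
    (hr : ∀ i, 0 < r i ↔ Appears A i) {n : ℕ} {y : SFT B} {E : Finset (SFT A)}
    (hE : IsSelection A p (n + 1) y.1 E) :
    ∑ x ∈ E, l (x.1 0) * pathWeight (t⁻¹ • weightMatrix A φ) (prefixWord (n + 1) x) * r (x.1 n) =
      wordWeight (symbolMatrix p (t⁻¹ • weightMatrix A φ)) l r (prefixWord (n + 1) y) := by
  classical
  rw [wordWeight_symbolMatrix (sum_symbolMatrix p (t⁻¹ • weightMatrix A φ) ▸ h.vecMul_sum)]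
  refine (hE.sum_prefixWord fun w : Fin (n + 1) → Fin k =>
    l (w 0) * pathWeight (t⁻¹ • weightMatrix A φ) w * r (w (Fin.last n))).trans
    (Finset.sum_subset_zero_on_sdiff (fun w hw => ?_) (fun w hw => ?_) fun _ _ => rfl)
  · exact Finset.mem_filter.2 ⟨Finset.mem_univ _, (Finset.mem_filter.1 hw).2.2⟩
  · obtain ⟨hcode, hfiber⟩ := Finset.mem_sdiff.1 hw
    by_contra hne
    exact hfiber (Finset.mem_filter.2 ⟨Finset.mem_univ _, mem_blocks_iff.2
      (exists_prefixWord_eq_of_term_ne_zero hr h.right_nonneg hne), (Finset.mem_filter.1 hcode).2⟩)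

theorem IsHiddenMarkov.exists_isComparable
    (h : IsHiddenMarkov (symbolMatrix p (t⁻¹ • weightMatrix A φ)) l r) (ht : 0 < t)
    (hl : ∀ i, 0 < l i ↔ Appears A i) (hr : ∀ i, 0 < r i ↔ Appears A i)
    (hf : ∀ x : SFT A, f x = φ (x.1 0) (x.1 1)) {ν : Measure (SFT B)}
    (hpos : ∀ n y, 0 < ν.real (cylinder y n))
    (hν : ∀ n y, ν.real (cylinder y n) =
      wordWeight (symbolMatrix p (t⁻¹ • weightMatrix A φ)) l r (prefixWord n y)) :
    ∃ c, IsComparable (relSeq p f) ν (Real.log t) c := by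
  obtain ⟨c, hc⟩ := exists_exp_birkhoffSum_mem_Icc hf ht hl hr
  refine ⟨c, fun n hn y => ?_⟩
  obtain ⟨n, rfl⟩ := Nat.exists_eq_add_of_le' hn
  set W := t ^ (n + 1) * ν.real (cylinder y (n + 1)) with hW
  have hW0 : 0 < W := mul_pos (pow_pos ht _) (hpos _ _)
  have hlogW : Real.log W = (n + 1 : ℕ) * Real.log t + Real.log (ν.real (cylinder y (n + 1))) := by
    rw [hW, Real.log_mul (pow_pos ht _).ne' (hpos _ _).ne', Real.log_pow]
  obtain ⟨hlower, hupper⟩ :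
      relSeq p f (n + 1) y ∈ Set.Icc (Real.exp (-c) * W) (Real.exp c * W) := by
    refine relSeq_mem_Icc fun E hE => ?_
    rw [hW, hν, ← h.sum_isSelection hr hE, Finset.mul_sum, Finset.mul_sum, Finset.mul_sum]
    exact ⟨Finset.sum_le_sum fun x _ => (hc n x).1, Finset.sum_le_sum fun x _ => (hc n x).2⟩
  have hg : 0 < relSeq p f (n + 1) y := (mul_pos (Real.exp_pos _) hW0).trans_le hlower
  refine ⟨hg, ?_⟩
  have hlog1 := Real.log_le_log (mul_pos (Real.exp_pos _) hW0) hlower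
  have hlog2 := Real.log_le_log hg hupper
  rw [Real.log_mul (Real.exp_pos _).ne' hW0.ne', Real.log_exp, hlogW] at hlog1 hlog2
  exact abs_le.2 ⟨by linarith, by linarith⟩

theorem exists_isRenewalMeasure_isComparable {a : Fin k'} (hirr : IsIrreducible (SFT A))
    (hπ : Function.Surjective π) (hcode : IsOneBlockCode π p)
    (hf : ∀ x : SFT A, f x = φ (x.1 0) (x.1 1)) (hs : Appears A s) (hps : ∀ i, p i = a ↔ i = s) :
    ∃ (ν : Measure (SFT B)) (t c : ℝ) (l r : Fin k → ℝ), 0 < t ∧ IsRenewalMeasure ν a ∧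
      IsComparable (relSeq p f) ν (Real.log t) c ∧
      IsHiddenMarkov (symbolMatrix p (t⁻¹ • weightMatrix A φ)) l r ∧
      ∀ n y, ν.real (cylinder y n) =
        wordWeight (symbolMatrix p (t⁻¹ • weightMatrix A φ)) l r (prefixWord n y) := by
  obtain ⟨t, l, r, ht, hl, hr, h⟩ := exists_isHiddenMarkov φ p hirr hs
  have hpos := h.wordWeight_prefixWord_pos ht hl hr hπ hcode
  obtain ⟨ν, hrenewal, hν⟩ := h.exists_isRenewalMeasure (a := a) (s := s)
    (fun n w hw => h.exists_prefixWord_eq hr hs hcode hw) hpos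
    (fun i j hj => if_neg (mt (hps j).1 hj)) fun i hi => by
      rw [sum_symbolMatrix, ← (hps s).2 rfl]
      exact exists_pow_mulVec_symbolMatrix_pos hirr ht hr h.right_nonneg hs hi
  obtain ⟨c, hc⟩ := h.exists_isComparable ht hl hr hf hrenewal.pos hν
  exact ⟨ν, t, c, l, r, ht, hrenewal, hc, h, hν⟩

end Comparison

section Gibbs

lemma abs_log_sub_sub_le_iff {x y z K : ℝ} (hx : 0 < x) (hy : 0 < y) (hz : 0 < z) :
    |Real.log x - Real.log y - Real.log z| ≤ K ↔
      x ≤ Real.exp K * y * z ∧ Real.exp (-K) * y * z ≤ x := by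
  have hlog (s : ℝ) : Real.log (Real.exp s * y * z) = s + Real.log y + Real.log z := by
    rw [Real.log_mul (mul_pos (Real.exp_pos s) hy).ne' hz.ne',
      Real.log_mul (Real.exp_pos s).ne' hy.ne', Real.log_exp]
  rw [← Real.log_le_log_iff hx (by positivity), ← Real.log_le_log_iff (by positivity) hx, hlog,
    hlog, abs_le]
  constructor <;> rintro ⟨h₁, h₂⟩ <;> constructor <;> linarith

variable {k : ℕ} {B : Matrix (Fin k) (Fin k) ℕ} {a : Fin k} {ν ν' : Measure (SFT B)}
  {g : ℕ → SFT B → ℝ} {g' : SFT B → ℝ} {P τ c : ℝ} {C : ℕ → ℝ}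

/-- `log g_{n+m}` differs from `log g_n + log g_m ∘ σⁿ` by at most `C n`: the logarithmic form of
(weak) almost additivity. -/
def IsAdditiveUpTo (g : ℕ → SFT B → ℝ) (C : ℕ → ℝ) : Prop :=
  ∀ n m, 1 ≤ n → 1 ≤ m → ∀ y,
    |Real.log (g (n + m) y) - Real.log (g n y) - Real.log (g m ((shift B)^[n] y))| ≤ C n

lemma log_div_exp_neg_mul_exp {x s u : ℝ} (hx : 0 < x) :
    Real.log (x / (Real.exp (-s) * Real.exp u)) = Real.log x + s - u := by
  rw [← Real.exp_add, Real.log_div hx.ne' (Real.exp_pos _).ne', Real.log_exp]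
  ring

lemma GibbsBounds.measureReal_pos (h : GibbsBounds ν g' P C) {n : ℕ} (hn : 1 ≤ n) (hC : 0 < C n)
    (y : SFT B) : 0 < ν.real (cylinder y n) := by
  have hpos := (one_div_pos.2 hC).trans_le (h n hn y).1
  exact (div_pos_iff_of_pos_right (by positivity)).1 hpos

lemma GibbsBounds.abs_log_le (h : GibbsBounds ν g' P C) {n : ℕ} (hn : 1 ≤ n) (hC : 0 < C n)
    (y : SFT B) :
    |Real.log (ν.real (cylinder y n)) + n * P - birkhoffSum (shift B) g' n y| ≤ Real.log (C n) := by
  have hpos := h.measureReal_pos hn hC y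
  obtain ⟨hlower, hupper⟩ := h n hn y
  rw [← log_div_exp_neg_mul_exp hpos, abs_le, ← Real.log_inv, ← one_div]
  exact ⟨Real.log_le_log (by positivity) hlower, Real.log_le_log (by positivity) hupper⟩

lemma gibbsBounds_of_abs_log_le {L : ℕ → ℝ} (hpos : ∀ n y, 0 < ν.real (cylinder y n))
    (h : ∀ n, 1 ≤ n → ∀ y,
      |Real.log (ν.real (cylinder y n)) + n * P - birkhoffSum (shift B) g' n y| ≤ L n) :
    GibbsBounds ν g' P fun n => Real.exp (L n) := fun n hn y => by
  have hbound := h n hn y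
  have hratio : 0 < ν.real (cylinder y n) /
      (Real.exp (-(n * P)) * Real.exp (birkhoffSum (shift B) g' n y)) :=
    div_pos (hpos n y) (by positivity)
  rw [← log_div_exp_neg_mul_exp (hpos n y), abs_le] at hbound
  rw [one_div, ← Real.exp_neg]
  exact ⟨(Real.le_log_iff_exp_le hratio).1 hbound.1, (Real.log_le_iff_le_exp hratio).1 hbound.2⟩

lemma IsGibbs.isWeakGibbs (h : IsGibbs ν g') : IsWeakGibbs ν g' := by
  obtain ⟨P, C, hC, hbounds⟩ := h
  exact ⟨P, fun _ => C, fun _ _ => hC, tendsto_const_div_atTop_nhds_zero_nat _, hbounds⟩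

lemma Approximates.exists_abs_le (h : Approximates g g') :
    ∃ e : ℕ → ℝ, Tendsto (fun n : ℕ => e n / n) atTop (𝓝 0) ∧
      ∀ᶠ n in atTop, ∀ y, |Real.log (g n y) - birkhoffSum (shift B) g' n y| ≤ e n := by
  set s : ℕ → ENNReal :=
    fun n => ⨆ y : SFT B, ‖Real.log (g n y) - birkhoffSum (shift B) g' n y‖ₑ
  have hlim : Tendsto (fun n : ℕ => s n / n) atTop (𝓝 0) := h
  refine ⟨fun n => (s n).toReal, ?_, ?_⟩
  · simpa [Function.comp_def, ENNReal.toReal_div] using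
      (ENNReal.tendsto_toReal ENNReal.zero_ne_top).comp hlim
  · filter_upwards [hlim.eventually_lt_const zero_lt_one] with n hn y
    have hfin : s n ≠ ⊤ := fun htop => by
      rw [htop, ENNReal.top_div_of_ne_top (ENNReal.natCast_ne_top n)] at hn
      exact not_top_lt hn
    have hle := ENNReal.toReal_mono hfin
      (le_iSup (fun y : SFT B => ‖Real.log (g n y) - birkhoffSum (shift B) g' n y‖ₑ) y)
    rwa [toReal_enorm, Real.norm_eq_abs] at hle

lemma approximates_of_abs_le {E : ℕ → ℝ} (hE : Tendsto (fun n : ℕ => E n / n) atTop (𝓝 0))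
    (hgE : ∀ n, 1 ≤ n → ∀ y, |Real.log (g n y) - birkhoffSum (shift B) g' n y| ≤ E n) :
    Approximates g g' := by
  have hlim : Tendsto (fun n : ℕ => ENNReal.ofReal (E n / n)) atTop (𝓝 0) := by
    simpa only [ENNReal.ofReal_zero] using ENNReal.tendsto_ofReal hE
  refine tendsto_of_tendsto_of_tendsto_of_le_of_le' tendsto_const_nhds hlim
    (Eventually.of_forall fun _ => zero_le) ((eventually_ge_atTop 1).mono fun n hn => ?_)
  rw [ENNReal.ofReal_div_of_pos (Nat.cast_pos.2 hn), ENNReal.ofReal_natCast]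
  refine ENNReal.div_le_div_right (iSup_le fun y => ?_) _
  rw [← ofReal_norm, Real.norm_eq_abs]
  exact ENNReal.ofReal_le_ofReal (hgE n hn y)

lemma le_of_abs_log_sub_le [IsProbabilityMeasure ν] [IsProbabilityMeasure ν'] {u : ℕ → ℝ}
    (hpos : ∀ n y, 0 < ν.real (cylinder y n)) (hu : Tendsto (fun n : ℕ => u n / n) atTop (𝓝 0))
    (h : ∀ᶠ n : ℕ in atTop, ∀ y, 0 < ν'.real (cylinder y n) ∧
      |Real.log (ν'.real (cylinder y n)) + n * P -
        (n * τ + Real.log (ν.real (cylinder y n)))| ≤ u n) : τ ≤ P := by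
  refine sub_nonpos.1 (ge_of_tendsto hu ?_)
  filter_upwards [h, eventually_ge_atTop 1] with n hn hn1
  have hone : 1 ≤ Real.exp (u n - n * (τ - P)) := by
    refine one_le_of_cylinder_le (μ := ν') (μ' := ν) (n := n) fun y => ?_
    obtain ⟨hpos', hbound⟩ := hn y
    rw [← Real.log_le_log_iff (hpos n y) (by positivity),
      Real.log_mul (Real.exp_pos _).ne' hpos'.ne', Real.log_exp]
    linarith [(abs_le.1 hbound).1]
  rw [le_div_iff₀ (Nat.cast_pos.2 hn1)]
  linarith [Real.one_le_exp_iff.1 hone]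

namespace IsComparable

variable (h : IsComparable g ν τ c)
include h

lemma exists_abs_log_sub_le (hg : Approximates g g') (hν' : IsWeakGibbs ν' g') :
    ∃ (P : ℝ) (u : ℕ → ℝ), Tendsto (fun n : ℕ => u n / n) atTop (𝓝 0) ∧
      ∀ᶠ n : ℕ in atTop, ∀ y, 0 < ν'.real (cylinder y n) ∧
        |Real.log (ν'.real (cylinder y n)) + n * P -
          (n * τ + Real.log (ν.real (cylinder y n)))| ≤ u n := by
  obtain ⟨P, C, hC, hClim, hbounds⟩ := hν'
  obtain ⟨e, helim, he⟩ := hg.exists_abs_le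
  refine ⟨P, fun n => Real.log (C n) + e n + c, ?_, ?_⟩
  · simpa only [add_div, add_zero] using
      (hClim.add helim).add (tendsto_const_div_atTop_nhds_zero_nat c)
  · filter_upwards [he, eventually_ge_atTop 1] with n hen hn y
    have hGibbs := abs_le.1 (hbounds.abs_log_le hn (hC n hn) y)
    have happrox := abs_le.1 (hen y)
    have hcomp := abs_le.1 (h n hn y).2
    exact ⟨hbounds.measureReal_pos hn (hC n hn) y, abs_le.2 ⟨by linarith, by linarith⟩⟩

theorem eq_of_isWeakGibbs (hν : IsRenewalMeasure ν a) (hg : Approximates g g')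
    (hν' : IsInvariant ν') (hw : IsWeakGibbs ν' g') : ν' = ν := by
  have := hν.isInvariant.1
  have := hν'.1
  obtain ⟨P, u, hu, hlog⟩ := h.exists_abs_log_sub_le hg hw
  have hP : τ ≤ P := le_of_abs_log_sub_le hν.pos hu hlog
  refine hν.eq_of_subexponential_le (D := fun n => Real.exp (u n)) hν' (hlog.mono fun n hn y => ?_)
    (by simpa only [Real.log_exp] using hu)
  obtain ⟨hpos', hbound⟩ := hn y
  have hpos := hν.pos n y
  rw [← Real.log_le_log_iff hpos' (by positivity), Real.log_mul (Real.exp_pos _).ne' hpos.ne',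
    Real.log_exp]
  linarith [(abs_le.1 hbound).2, mul_le_mul_of_nonneg_left hP n.cast_nonneg]

lemma almostAdditive_iff : AlmostAdditive g ↔ ∃ C : ℝ, IsAdditiveUpTo g fun _ => C := by
  have hiff {C : ℝ} {n m : ℕ} (hn : 1 ≤ n) (hm : 1 ≤ m) (y : SFT B) :=
    abs_log_sub_sub_le_iff (K := C) (h (n + m) (Nat.le_add_right_of_le hn) y).1 (h n hn y).1
      (h m hm ((shift B)^[n] y)).1
  constructor
  · rintro ⟨C, -, hC⟩
    exact ⟨C, fun n m hn hm y => (hiff hn hm y).2 (hC n m hn hm y)⟩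
  · rintro ⟨C, hC⟩
    exact ⟨|C| + 1, by positivity, fun n m hn hm y => (hiff hn hm y).1
      ((hC n m hn hm y).trans ((le_abs_self C).trans (lt_add_one _).le))⟩

lemma exists_isAdditiveUpTo (hg : WeaklyAlmostAdditive g) :
    ∃ C : ℕ → ℝ, Tendsto (fun n : ℕ => C n / n) atTop (𝓝 0) ∧ IsAdditiveUpTo g C := by
  obtain ⟨C, -, hlim, hC⟩ := hg
  exact ⟨C, hlim, fun n m hn hm y => (abs_log_sub_sub_le_iff
    (h (n + m) (Nat.le_add_right_of_le hn) y).1 (h n hn y).1 (h m hm _).1).2 (hC n m hn hm y)⟩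

theorem almostAdditive_of_isGibbs (hν : IsRenewalMeasure ν a) (hg : Approximates g g')
    (hν' : IsInvariant ν') (hw : IsGibbs ν' g') : AlmostAdditive g := by
  obtain rfl := h.eq_of_isWeakGibbs hν hg hν' hw.isWeakGibbs
  obtain ⟨P, C, hC, hbounds⟩ := hw
  have hbirkhoff (n : ℕ) (hn : 1 ≤ n) (y : SFT B) : |Real.log (g n y) -
      (n * τ - n * P + birkhoffSum (shift B) g' n y)| ≤ c + Real.log C := by
    have hcomp := abs_le.1 (h n hn y).2
    have hGibbs := abs_le.1 (hbounds.abs_log_le hn hC y)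
    exact abs_le.2 ⟨by linarith, by linarith⟩
  refine h.almostAdditive_iff.2 ⟨3 * (c + Real.log C), fun n m hn hm y => ?_⟩
  have hnm := abs_le.1 (hbirkhoff (n + m) (Nat.le_add_right_of_le hn) y)
  have hn' := abs_le.1 (hbirkhoff n hn y)
  have hm' := abs_le.1 (hbirkhoff m hm ((shift B)^[n] y))
  rw [birkhoffSum_add] at hnm
  push_cast at hnm
  exact abs_le.2 ⟨by linarith, by linarith⟩

variable {E : ℕ → ℝ}

lemma gibbsBounds (hν : IsRenewalMeasure ν a)
    (hgE : ∀ n, 1 ≤ n → ∀ y, |Real.log (g n y) - birkhoffSum (shift B) g' n y| ≤ E n) :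
    GibbsBounds ν g' τ fun n => Real.exp (E n + c) :=
  gibbsBounds_of_abs_log_le hν.pos fun n hn y => by
    have hcomp := abs_le.1 (h n hn y).2
    have happrox := abs_le.1 (hgE n hn y)
    exact abs_le.2 ⟨by linarith, by linarith⟩

theorem existsUnique_isWeakGibbs (hν : IsRenewalMeasure ν a)
    (hE : Tendsto (fun n : ℕ => E n / n) atTop (𝓝 0))
    (hgE : ∀ n, 1 ≤ n → ∀ y, |Real.log (g n y) - birkhoffSum (shift B) g' n y| ≤ E n) :
    Approximates g g' ∧ ∃! ν : Measure (SFT B), IsInvariant ν ∧ IsWeakGibbs ν g' := by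
  have happrox := approximates_of_abs_le hE hgE
  have hlim : Tendsto (fun n : ℕ => Real.log (Real.exp (E n + c)) / n) atTop (𝓝 0) := by
    simpa only [Real.log_exp, add_div, add_zero] using
      hE.add (tendsto_const_div_atTop_nhds_zero_nat c)
  exact ⟨happrox, ν,
    ⟨hν.isInvariant, τ, _, fun _ _ => Real.exp_pos _, hlim, h.gibbsBounds hν hgE⟩,
    fun ν' hν' => h.eq_of_isWeakGibbs hν happrox hν'.1 hν'.2⟩

theorem existsUnique_isGibbs (hν : IsRenewalMeasure ν a) {E : ℝ}
    (hgE : ∀ n, 1 ≤ n → ∀ y, |Real.log (g n y) - birkhoffSum (shift B) g' n y| ≤ E) :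
    Approximates g g' ∧ ∃! ν : Measure (SFT B), IsInvariant ν ∧ IsGibbs ν g' := by
  have happrox := approximates_of_abs_le (E := fun _ => E)
    (tendsto_const_div_atTop_nhds_zero_nat E) hgE
  exact ⟨happrox, ν,
    ⟨hν.isInvariant, τ, _, Real.exp_pos _, h.gibbsBounds (E := fun _ => E) hν hgE⟩,
    fun ν' hν' => h.eq_of_isWeakGibbs hν happrox hν'.1 hν'.2.isWeakGibbs⟩

end IsComparable

end Gibbs

section ReturnPotential

variable {k : ℕ} {B : Matrix (Fin k) (Fin k) ℕ} {ν : Measure (SFT B)} {a : Fin k} {τ : ℝ}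
  {d : Fin k → ℝ}

open Classical in
/-- The potential `τ + log (ν[y_0 ⋯ y_m] / ν[y_1 ⋯ y_m])`, where `m ≥ 1` is the first positive time
with `y_m = a`. By the renewal property the same formula holds for every `m ≥ 1` with `y_m = a`, so
the Birkhoff sums telescope. On the points that never visit `a` after time `0` the value is given
by the function `d` of the first symbol. -/
noncomputable def returnPotential (ν : Measure (SFT B)) (a : Fin k) (τ : ℝ) (d : Fin k → ℝ)
    (y : SFT B) : ℝ :=
  if h : ∃ m, y.1 (m + 1) = a then
    τ + Real.log (ν.real (cylinder y (Nat.find h + 2))) -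
      Real.log (ν.real (cylinder (shift B y) (Nat.find h + 1)))
  else d (y.1 0)

lemma returnPotential_of_forall_ne {y : SFT B} (hy : ∀ m, y.1 (m + 1) ≠ a) :
    returnPotential ν a τ d y = d (y.1 0) :=
  dif_neg fun ⟨m, hm⟩ => hy m hm

namespace IsRenewalMeasure

variable (hν : IsRenewalMeasure ν a)
include hν

lemma returnPotential_eq {y : SFT B} {m : ℕ} (hy : y.1 (m + 1) = a) :
    returnPotential ν a τ d y = τ + Real.log (ν.real (cylinder y (m + 2))) -
      Real.log (ν.real (cylinder (shift B y) (m + 1))) := by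
  classical
  have hex : ∃ m, y.1 (m + 1) = a := ⟨m, hy⟩
  rw [returnPotential, dif_pos hex]
  have hfirst := Nat.find_spec hex
  obtain ⟨j, rfl⟩ := Nat.exists_eq_add_of_le (Nat.find_min' hex hy)
  generalize Nat.find hex = i at hfirst
  have hy' := congrArg Real.log (hν.renewal (i + 1) (j + 1) y (Nat.le_add_left 1 j) hfirst)
  have hσ := congrArg Real.log (hν.renewal i (j + 1) (shift B y) (Nat.le_add_left 1 j) hfirst)
  simp only [Real.log_mul (hν.pos _ _).ne' (hν.pos _ _).ne', ← Function.iterate_succ_apply]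
    at hy' hσ
  rw [show i + j + 2 = i + 1 + (j + 1) by ring, show i + j + 1 = i + (j + 1) by ring]
  linarith

lemma birkhoffSum_returnPotential {y : SFT B} {n j : ℕ} (hy : y.1 (n + j) = a) :
    birkhoffSum (shift B) (returnPotential ν a τ d) n y = n * τ +
      Real.log (ν.real (cylinder y (n + j + 1))) -
        Real.log (ν.real (cylinder ((shift B)^[n] y) (j + 1))) := by
  induction n generalizing j with
  | zero => simp
  | succ n ih =>
    have hy' : y.1 (n + (j + 1)) = a := by rwa [← add_assoc, add_right_comm]
    have hσ : ((shift B)^[n] y).1 (j + 1) = a := by rwa [shift_iterate_val]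
    rw [birkhoffSum_succ, ih hy', hν.returnPotential_eq hσ, Function.iterate_succ_apply',
      add_right_comm n 1 j, ← add_assoc n j 1]
    push_cast
    ring

lemma returnPotential_congr {y z : SFT B} {m : ℕ} (hy : y.1 (m + 1) = a)
    (hz : z ∈ cylinder y (m + 2)) : returnPotential ν a τ d z = returnPotential ν a τ d y := by
  have hσz : shift B z ∈ cylinder (shift B y) (m + 1) := fun i hi => hz (i + 1) (by lia)
  rw [hν.returnPotential_eq hy, hν.returnPotential_eq ((hz (m + 1) (by lia)).trans hy),
    cylinder_eq_of_mem hz, cylinder_eq_of_mem hσz]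

lemma continuousAt_returnPotential {y : SFT B} {m : ℕ} (hy : y.1 (m + 1) = a) :
    ContinuousAt (returnPotential ν a τ d) y :=
  continuousAt_const.congr (mem_of_superset (cylinder_mem_nhds y (m + 2)) fun _ hz =>
    (hν.returnPotential_congr hy hz).symm)

theorem measurable_returnPotential : Measurable (returnPotential ν a τ d) := by
  classical
  set U : Set (SFT B) := {y | ∃ m, y.1 (m + 1) = a}
  have hUo : IsOpen U := isOpen_iff_mem_nhds.2 fun y ⟨m, hm⟩ =>
    mem_of_superset (cylinder_mem_nhds y (m + 2)) fun z hz => ⟨m, (hz (m + 1) (by lia)).trans hm⟩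
  have hcont : ContinuousOn (returnPotential ν a τ d) U := fun y ⟨m, hm⟩ =>
    (hν.continuousAt_returnPotential hm).continuousWithinAt
  have hcont' : ContinuousOn (returnPotential ν a τ d) Uᶜ :=
    ((continuous_of_discreteTopology (f := d)).comp (continuous_val_apply 0)).continuousOn.congr
      fun y hy => returnPotential_of_forall_ne fun m hm => hy ⟨m, hm⟩
  simpa only [Set.piecewise_same] using hcont.measurable_piecewise hcont' hUo.measurableSet

end IsRenewalMeasure

variable {g : ℕ → SFT B → ℝ} {c : ℝ} {C : ℕ → ℝ}

lemma IsComparable.abs_log_measureReal_cylinder_le (h : IsComparable g ν τ c)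
    (hC : IsAdditiveUpTo g C) {n m : ℕ} (hn : 1 ≤ n) (hm : 1 ≤ m) (y : SFT B) :
    |Real.log (ν.real (cylinder y (n + m))) - Real.log (ν.real (cylinder y n)) -
      Real.log (ν.real (cylinder ((shift B)^[n] y) m))| ≤ C n + 3 * c := by
  have hnm := abs_le.1 (h (n + m) (Nat.le_add_right_of_le hn) y).2
  have hn' := abs_le.1 (h n hn y).2
  have hm' := abs_le.1 (h m hm ((shift B)^[n] y)).2
  have hadd := abs_le.1 (hC n m hn hm y)
  push_cast at hnm
  exact abs_le.2 ⟨by linarith, by linarith⟩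

lemma IsComparable.abs_log_sub_birkhoffSum_le_of_visit (h : IsComparable g ν τ c)
    (hν : IsRenewalMeasure ν a) (hC : IsAdditiveUpTo g C) {n m : ℕ} (hn : 1 ≤ n) (hnm : n ≤ m)
    {y : SFT B} (hy : y.1 m = a) :
    |Real.log (g n y) - birkhoffSum (shift B) (returnPotential ν a τ d) n y| ≤ C n + 4 * c := by
  obtain ⟨j, rfl⟩ := Nat.exists_eq_add_of_le hnm
  rw [hν.birkhoffSum_returnPotential hy, add_assoc n j 1]
  have hcomp := abs_le.1 (h n hn y).2
  have hadd := abs_le.1 (h.abs_log_measureReal_cylinder_le hC hn (Nat.le_add_left 1 j) y)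
  exact abs_le.2 ⟨by linarith, by linarith⟩

end ReturnPotential

section BinaryShift

variable {B : Matrix (Fin 2) (Fin 2) ℕ} (hB : ∀ i j, i = 1 ∨ j = 1 → B i j = 1)

/-- The fixed point `1 1 1 ⋯`; it exists because `hB` allows every transition except possibly
`0 → 0`. -/
def onePoint : SFT B :=
  ⟨fun _ => 1, fun _ => hB 1 1 (Or.inl rfl)⟩

/-- The point whose only `0` is at the index `m`. -/
def zeroAt (m : ℕ) : SFT B :=
  ⟨fun i => if i = m then 0 else 1, fun n => hB _ _ <| by
    by_cases hn : n = m
    · exact Or.inr (if_neg (by lia))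
    · exact Or.inl (if_neg hn)⟩

lemma shift_iterate_eq_onePoint {y : SFT B} {n : ℕ} (hy : ∀ i, n ≤ i → y.1 i = 1) :
    (shift B)^[n] y = onePoint hB :=
  Subtype.ext <| funext fun i => by
    rw [shift_iterate_val]
    exact hy _ (Nat.le_add_right n i)

lemma shift_iterate_eq_zeroAt {y : SFT B} {s : ℕ} (hs : y.1 s = 0)
    (hy : ∀ i, s < i → y.1 i = 1) : (shift B)^[s] y = zeroAt hB 0 :=
  Subtype.ext <| funext fun i => by
    rw [shift_iterate_val]
    rcases Nat.eq_zero_or_pos i with rfl | hi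
    · exact hs
    · exact (hy _ (Nat.lt_add_of_pos_right hi)).trans (if_neg hi.ne').symm

lemma shift_iterate_onePoint (n : ℕ) : (shift B)^[n] (onePoint hB) = onePoint hB :=
  shift_iterate_eq_onePoint hB fun _ _ => rfl

variable {ν : Measure (SFT B)} {τ : ℝ} {d : Fin 2 → ℝ}

lemma birkhoffSum_returnPotential_onePoint (n : ℕ) :
    birkhoffSum (shift B) (returnPotential ν 0 τ d) n (onePoint hB) = n * d 1 := by
  have hval : returnPotential ν 0 τ d (onePoint hB) = d 1 :=
    returnPotential_of_forall_ne fun _ => one_ne_zero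
  simp only [birkhoffSum, shift_iterate_onePoint, hval, Finset.sum_const, Finset.card_range,
    nsmul_eq_mul]

lemma exists_last_visit {y : SFT B} {n s : ℕ} (hsn : s < n) (hs : y.1 s = 0)
    (hy : ∀ i, n ≤ i → y.1 i ≠ 0) : ∃ s < n, y.1 s = 0 ∧ ∀ i, s < i → y.1 i = 1 := by
  obtain ⟨m, hm⟩ := Nat.exists_eq_add_of_lt hsn
  have hle : Nat.findGreatest (fun i => y.1 i = 0) (s + m) ≤ s + m := Nat.findGreatest_le _
  refine ⟨Nat.findGreatest (fun i => y.1 i = 0) (s + m), by lia,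
    Nat.findGreatest_spec (P := fun i => y.1 i = 0) (Nat.le_add_right s m) hs, fun i hi => ?_⟩
  refine Fin.eq_one_of_ne_zero _ ?_
  rcases lt_or_ge i n with hin | hin
  · exact Nat.findGreatest_is_greatest hi (by lia)
  · exact hy i hin

namespace IsComparable

variable {g : ℕ → SFT B → ℝ} {c : ℝ} {C : ℕ → ℝ}

lemma abs_log_sub_birkhoffSum_le_of_last_visit (h : IsComparable g ν τ c)
    (hν : IsRenewalMeasure ν 0) {y : SFT B} {s : ℕ} (hs : y.1 s = 0)
    (hlast : ∀ i, s < i → y.1 i = 1) :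
    |Real.log (g (s + 1) y) - birkhoffSum (shift B) (returnPotential ν 0 τ d) (s + 1) y| ≤
      c + |τ + Real.log (ν.real (cylinder (zeroAt hB 0) 1)) - d 0| := by
  have hval : returnPotential ν 0 τ d (zeroAt hB 0) = d 0 :=
    returnPotential_of_forall_ne fun _ => one_ne_zero
  have hcomp := (h (s + 1) (Nat.le_add_left 1 s) y).2
  rw [birkhoffSum_succ, hν.birkhoffSum_returnPotential (j := 0) hs,
    shift_iterate_eq_zeroAt hB hs hlast, hval]
  push_cast at hcomp
  refine le_trans (le_of_eq ?_) ((abs_add_le _ _).trans (add_le_add_left hcomp _))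
  congr 1
  rw [zero_add, add_zero]
  ring

theorem exists_abs_log_sub_birkhoffSum_le (h : IsComparable g ν τ c) (hν : IsRenewalMeasure ν 0)
    (hC : IsAdditiveUpTo g C)
    (hα : ∀ n : ℕ, 1 ≤ n → |Real.log (g n (onePoint hB)) - n * d 1| ≤ C n) :
    ∃ K : ℝ, ∀ E : ℕ → ℝ, (∀ k n, k ≤ n → C k ≤ E n) → ∀ n, 1 ≤ n → ∀ y,
      |Real.log (g n y) - birkhoffSum (shift B) (returnPotential ν 0 τ d) n y| ≤ 2 * E n + K := by
  set K := |τ + Real.log (ν.real (cylinder (zeroAt hB 0) 1)) - d 0|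
  have hK0 : 0 ≤ K := abs_nonneg _
  have hc : 0 ≤ c := (abs_nonneg _).trans (h 1 le_rfl (onePoint hB)).2
  refine ⟨4 * c + K, fun E hE n hn y => ?_⟩
  have hE0 : 0 ≤ E n :=
    ((abs_nonneg _).trans (hC n 1 hn le_rfl (onePoint hB))).trans (hE n n le_rfl)
  by_cases hlater : ∃ m, n ≤ m ∧ y.1 m = 0
  · obtain ⟨m, hnm, hm⟩ := hlater
    exact (h.abs_log_sub_birkhoffSum_le_of_visit hν hC hn hnm hm).trans
      (by linarith [hE n n le_rfl])
  push Not at hlater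
  by_cases hearlier : ∃ s < n, y.1 s = 0
  · obtain ⟨s, hsn, hs, hlast⟩ : ∃ s < n, y.1 s = 0 ∧ ∀ i, s < i → y.1 i = 1 :=
      hearlier.elim fun s hs => exists_last_visit hs.1 hs.2 hlater
    have hvisit := h.abs_log_sub_birkhoffSum_le_of_last_visit hB (d := d) hν hs hlast
    obtain ⟨j, rfl⟩ := Nat.exists_eq_add_of_le hsn
    rcases Nat.eq_zero_or_pos j with rfl | hj
    · exact hvisit.trans (by linarith)
    · have htail : (shift B)^[s + 1] y = onePoint hB := shift_iterate_eq_onePoint hB hlast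
      have hadd := abs_le.1 (hC (s + 1) j (Nat.le_add_left 1 s) hj y)
      have hone := abs_le.1 (hα j hj)
      have hvisit' := abs_le.1 hvisit
      rw [htail] at hadd
      rw [birkhoffSum_add, htail, birkhoffSum_returnPotential_onePoint]
      have hEs := hE (s + 1) (s + 1 + j) (Nat.le_add_right _ _)
      have hEj := hE j (s + 1 + j) (Nat.le_add_left _ _)
      exact abs_le.2 ⟨by linarith, by linarith⟩
  · push Not at hearlier
    have hy : y = onePoint hB := shift_iterate_eq_onePoint hB (n := 0) fun i _ =>
      Fin.eq_one_of_ne_zero _ <| (lt_or_ge i n).elim (hearlier i) (hlater i)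
    rw [hy, birkhoffSum_returnPotential_onePoint]
    exact (hα n hn).trans (by linarith [hE n n le_rfl])

end IsComparable

end BinaryShift

section Recurrence

section Generic

variable {ι R : Type*} [Fintype ι] [DecidableEq ι] [CommRing R] {Q : Matrix ι ι R} {τ δ : R}

lemma dotProduct_pow_mulVec_of_pow_three (hQ : Q ^ 3 = τ • Q ^ 2 - δ • Q) (u x : ι → R) (m : ℕ) :
    u ⬝ᵥ (Q ^ (m + 3) *ᵥ x) = τ * (u ⬝ᵥ (Q ^ (m + 2) *ᵥ x)) - δ * (u ⬝ᵥ (Q ^ (m + 1) *ᵥ x)) := by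
  rw [pow_add, hQ, mul_sub, mul_smul_comm, mul_smul_comm, ← pow_add, ← pow_succ,
    Matrix.sub_mulVec, Matrix.smul_mulVec, Matrix.smul_mulVec, dotProduct_sub, dotProduct_smul,
    dotProduct_smul, smul_eq_mul, smul_eq_mul]

lemma dotProduct_pow_mulVec_of_mulVec {x : ι → R} (hx : Q *ᵥ (Q *ᵥ x) = τ • (Q *ᵥ x))
    (u : ι → R) (m : ℕ) : u ⬝ᵥ (Q ^ (m + 3) *ᵥ x) = τ * (u ⬝ᵥ (Q ^ (m + 2) *ᵥ x)) := by
  rw [pow_add _ m 3, pow_three, pow_add _ m 2, pow_two]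
  simp only [← Matrix.mulVec_mulVec, hx, Matrix.mulVec_smul, dotProduct_smul, smul_eq_mul]

lemma dotProduct_pow_mulVec_of_vecMul {u : ι → R} (hu : (u ᵥ* Q) ᵥ* Q = τ • (u ᵥ* Q))
    (x : ι → R) (m : ℕ) : u ⬝ᵥ (Q ^ (m + 3) *ᵥ x) = τ * (u ⬝ᵥ (Q ^ (m + 2) *ᵥ x)) := by
  rw [add_comm m 3, add_comm m 2, pow_add _ 3 m, pow_three, pow_add _ 2 m, pow_two]
  simp only [Matrix.dotProduct_mulVec, ← Matrix.vecMul_vecMul, hu, Matrix.smul_vecMul,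
    smul_dotProduct, smul_eq_mul]

lemma pow_three_of_col_zero {Q : Matrix (Fin 3) (Fin 3) R} (hQ : ∀ i, Q i 0 = 0) :
    Q ^ 3 = (Q 1 1 + Q 2 2) • Q ^ 2 - (Q 1 1 * Q 2 2 - Q 1 2 * Q 2 1) • Q := by
  rw [pow_three, pow_two]
  ext i j
  simp only [Matrix.sub_apply, Matrix.smul_apply, Matrix.mul_apply, Fin.sum_univ_three, hQ,
    smul_eq_mul]
  fin_cases i <;> fin_cases j <;> simp only [Fin.zero_eta, Fin.mk_one, Fin.reduceFinMk, hQ] <;> ring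

end Generic

variable {N : Matrix (Fin 3) (Fin 3) ℝ} {l : Fin 3 → ℝ}

/-- The condition of part (ii) of the corollary on the weight matrix, stated through its lower right
`2 × 2` block. -/
def HasRegularBlock (N : Matrix (Fin 3) (Fin 3) ℝ) : Prop :=
  (¬ ∃ a₁ a₂ : ℝ, 0 < a₁ ∧ 0 < a₂ ∧ N.submatrix ![1, 2] ![1, 2] = !![0, a₁; a₂, 0]) ∨
    ((∃ a₁ : ℝ, 0 < a₁ ∧ N.submatrix ![1, 2] ![1, 2] = !![0, a₁; a₁, 0]) ∧
      (N 1 0 = N 2 0 ∨ N 0 1 = N 0 2))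

lemma submatrix_eq_antidiagonal_iff {a₁ a₂ : ℝ} :
    N.submatrix ![1, 2] ![1, 2] = !![0, a₁; a₂, 0] ↔
      N 1 1 = 0 ∧ N 1 2 = a₁ ∧ N 2 1 = a₂ ∧ N 2 2 = 0 := by
  rw [← Matrix.ext_iff]
  simp [Fin.forall_fin_two, and_assoc]

lemma HasRegularBlock.smul (h : HasRegularBlock N) {s : ℝ} (hs : 0 < s) :
    HasRegularBlock (s • N) := by
  simp only [HasRegularBlock, submatrix_eq_antidiagonal_iff, Matrix.smul_apply, smul_eq_mul,
    mul_eq_zero, hs.ne', false_or, mul_right_inj' hs.ne'] at h ⊢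
  refine h.imp (fun h => ?_) (And.imp_left ?_)
  · rintro ⟨-, -, h₁, h₂, h11, rfl, rfl, h22⟩
    exact h ⟨_, _, pos_of_mul_pos_right h₁ hs.le, pos_of_mul_pos_right h₂ hs.le, h11, rfl, rfl, h22⟩
  · rintro ⟨a₁, h₁, h11, h12, h21, h22⟩
    exact ⟨s * a₁, mul_pos hs h₁, h11, by rw [h12], by rw [h21], h22⟩

lemma symbolMatrix_code_one_mulVec (x : Fin 3 → ℝ) (i : Fin 3) :
    (symbolMatrix code N 1 *ᵥ x) i = N i 1 * x 1 + N i 2 * x 2 := by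
  simp [Matrix.mulVec, dotProduct, Fin.sum_univ_three, symbolMatrix_apply, code]

lemma vecMul_symbolMatrix_code_one (u : Fin 3 → ℝ) :
    u ᵥ* symbolMatrix code N 1 =
      ![0, u 0 * N 0 1 + u 1 * N 1 1 + u 2 * N 2 1, u 0 * N 0 2 + u 1 * N 1 2 + u 2 * N 2 2] := by
  ext j
  fin_cases j <;>
    simp [Matrix.vecMul, dotProduct, Fin.sum_univ_three, symbolMatrix_apply, code]

lemma trace_pos_of_det_neg (hN : ∀ i j, 0 ≤ N i j)
    (hreg : ¬ ∃ a₁ a₂ : ℝ, 0 < a₁ ∧ 0 < a₂ ∧ N.submatrix ![1, 2] ![1, 2] = !![0, a₁; a₂, 0])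
    (hdet : N 1 1 * N 2 2 - N 1 2 * N 2 1 < 0) : 0 < N 1 1 + N 2 2 := by
  refine (add_nonneg (hN 1 1) (hN 2 2)).lt_of_ne' fun htrace => hreg ?_
  obtain ⟨h11, h22⟩ := (add_eq_zero_iff_of_nonneg (hN 1 1) (hN 2 2)).1 htrace
  have hoff : 0 < N 1 2 * N 2 1 := by
    simpa only [h11, zero_mul, zero_sub, neg_neg_iff_pos] using hdet
  exact ⟨N 1 2, N 2 1, pos_of_mul_pos_left hoff (hN 2 1), pos_of_mul_pos_right hoff (hN 1 2),
    submatrix_eq_antidiagonal_iff.2 ⟨h11, rfl, rfl, h22⟩⟩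

section Swap

variable {a : ℝ} (hswap : N.submatrix ![1, 2] ![1, 2] = !![0, a; a, 0])
include hswap

lemma mulVec_mulVec_of_swap (hcol : N 1 0 = N 2 0) (r : Fin 3 → ℝ) :
    symbolMatrix code N 1 *ᵥ (symbolMatrix code N 1 *ᵥ (symbolMatrix code N 0 *ᵥ r)) =
      a • (symbolMatrix code N 1 *ᵥ (symbolMatrix code N 0 *ᵥ r)) := by
  obtain ⟨h11, h12, h21, h22⟩ := submatrix_eq_antidiagonal_iff.1 hswap
  have hx : (symbolMatrix code N 0 *ᵥ r) 1 = (symbolMatrix code N 0 *ᵥ r) 2 := by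
    simp [Matrix.mulVec, dotProduct, Fin.sum_univ_three, symbolMatrix_apply, code, hcol]
  ext i
  simp only [Pi.smul_apply, smul_eq_mul, symbolMatrix_code_one_mulVec, h11, h12, h21, h22, hx]
  ring

lemma vecMul_vecMul_of_swap (hrow : N 0 1 = N 0 2) {u : Fin 3 → ℝ} (hu : u 1 = u 2) :
    (u ᵥ* symbolMatrix code N 1) ᵥ* symbolMatrix code N 1 =
      a • (u ᵥ* symbolMatrix code N 1) := by
  obtain ⟨h11, h12, h21, h22⟩ := submatrix_eq_antidiagonal_iff.1 hswap
  simp only [vecMul_symbolMatrix_code_one, h11, h12, h21, h22, hrow, hu]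
  ext j
  fin_cases j <;> simp <;> ring

lemma left_eigenvector_eq_of_swap (ha : 0 < a) (hrow : N 0 1 = N 0 2) (hl : l ᵥ* N = l) :
    l 1 = l 2 := by
  obtain ⟨h11, h12, h21, h22⟩ := submatrix_eq_antidiagonal_iff.1 hswap
  have h1 := congrFun hl 1
  have h2 := congrFun hl 2
  simp only [Matrix.vecMul, dotProduct, Fin.sum_univ_three, h11, h12, h21, h22, hrow] at h1 h2
  have hdiff : (1 + a) * (l 1 - l 2) = 0 := by linarith
  exact sub_eq_zero.1 ((mul_eq_zero.1 hdiff).resolve_left (by positivity))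

end Swap

theorem HasRegularBlock.exists_recurrence (hreg : HasRegularBlock N) (hN : ∀ i j, 0 ≤ N i j)
    (hl : l ᵥ* N = l) (r : Fin 3 → ℝ) :
    ∃ τ δ : ℝ, (δ < 0 → 0 < τ) ∧ ∀ u, (u = l ∨ ∃ b, u = l ᵥ* symbolMatrix code N b) →
      ∀ m : ℕ,
      u ⬝ᵥ (symbolMatrix code N 1 ^ (m + 3) *ᵥ (symbolMatrix code N 0 *ᵥ r)) =
        τ * (u ⬝ᵥ (symbolMatrix code N 1 ^ (m + 2) *ᵥ (symbolMatrix code N 0 *ᵥ r))) -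
          δ * (u ⬝ᵥ (symbolMatrix code N 1 ^ (m + 1) *ᵥ (symbolMatrix code N 0 *ᵥ r))) := by
  rcases hreg with hreg | ⟨⟨a, ha, hswap⟩, hcol | hrow⟩
  · exact ⟨_, _, trace_pos_of_det_neg hN hreg, fun u _ m =>
      dotProduct_pow_mulVec_of_pow_three (pow_three_of_col_zero fun _ => rfl) u _ m⟩
  · refine ⟨a, 0, fun h => absurd h (lt_irrefl 0), fun u _ m => ?_⟩
    rw [zero_mul, sub_zero, dotProduct_pow_mulVec_of_mulVec (mulVec_mulVec_of_swap hswap hcol r)]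
  · refine ⟨a, 0, fun h => absurd h (lt_irrefl 0), fun u hu m => ?_⟩
    have hl12 := left_eigenvector_eq_of_swap hswap ha hrow hl
    have hu12 : u 1 = u 2 := by
      rcases hu with rfl | ⟨b, rfl⟩
      · exact hl12
      · rw [vecMul_symbolMatrix hl, vecMul_symbolMatrix hl, hl12]
        rfl
    rw [zero_mul, sub_zero, dotProduct_pow_mulVec_of_vecMul (vecMul_vecMul_of_swap hswap hrow hu12)]

end Recurrence

section Continuity

variable {B : Matrix (Fin 2) (Fin 2) ℕ} (hB : ∀ i j, i = 1 ∨ j = 1 → B i j = 1)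

/-- The point `b 1 ⋯ 1 0 1 1 ⋯` whose first `0` after time `0` is at the index `m + 2`. -/
def zeroAfter (b : Fin 2) (m : ℕ) : SFT B :=
  ⟨fun i => if i = 0 then b else if i = m + 2 then 0 else 1, fun n => hB _ _ <| by
    by_cases hn : n + 1 = m + 2
    · exact (em (n = 0)).elim (by lia) fun h0 => Or.inl ((if_neg h0).trans (if_neg (by lia)))
    · exact Or.inr ((if_neg n.succ_ne_zero).trans (if_neg hn))⟩

lemma shift_zeroAfter (b : Fin 2) (m : ℕ) : shift B (zeroAfter hB b m) = zeroAt hB (m + 1) :=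
  Subtype.ext <| funext fun i => by simp [shift, zeroAfter, zeroAt]

lemma zeroAfter_one (m : ℕ) : zeroAfter hB 1 m = zeroAt hB (m + 2) :=
  Subtype.ext <| funext fun i => by
    rcases eq_or_ne i 0 with rfl | hi
    · rfl
    · exact if_neg hi

section CylinderWeights

variable {ι : Type*} [Fintype ι] [DecidableEq ι] (P : Fin 2 → Matrix ι ι ℝ) (l r : ι → ℝ)

lemma wordMatrix_prefixWord_zeroAt (m : ℕ) :
    wordMatrix P (prefixWord (m + 1) (zeroAt hB m)) = P 1 ^ m * P 0 := by
  have hones : wordMatrix P (prefixWord m (zeroAt hB m)) = P 1 ^ m :=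
    wordMatrix_of_forall_eq fun i => if_neg i.2.ne
  rw [prefixWord_succ, wordMatrix_snoc, hones]
  exact congrArg (P 1 ^ m * P ·) (if_pos rfl)

lemma wordWeight_prefixWord_zeroAt (m : ℕ) :
    wordWeight P l r (prefixWord (m + 1) (zeroAt hB m)) = l ⬝ᵥ (P 1 ^ m *ᵥ (P 0 *ᵥ r)) := by
  rw [wordWeight, wordMatrix_prefixWord_zeroAt, ← Matrix.mulVec_mulVec]

lemma wordWeight_prefixWord_zeroAfter (b : Fin 2) (m : ℕ) :
    wordWeight P l r (prefixWord (m + 3) (zeroAfter hB b m)) =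
      (l ᵥ* P b) ⬝ᵥ (P 1 ^ (m + 1) *ᵥ (P 0 *ᵥ r)) := by
  rw [wordWeight, prefixWord_succ', wordMatrix_cons, shift_zeroAfter, wordMatrix_prefixWord_zeroAt,
    ← Matrix.mulVec_mulVec, Matrix.dotProduct_mulVec, ← Matrix.mulVec_mulVec]
  rfl

end CylinderWeights

variable {ν : Measure (SFT B)} {τ : ℝ} {d : Fin 2 → ℝ}

lemma mem_cylinder_zeroAfter {y : SFT B} {m : ℕ} (hlast : y.1 (m + 2) = 0)
    (hy : ∀ i ≤ m, y.1 (i + 1) ≠ 0) : zeroAfter hB (y.1 0) m ∈ cylinder y (m + 3) := by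
  rintro (_ | i) hi
  · rfl
  · change (if i + 1 = m + 2 then (0 : Fin 2) else 1) = y.1 (i + 1)
    rcases eq_or_ne i (m + 1) with rfl | him
    · exact (if_pos rfl).trans hlast.symm
    · exact (if_neg (by lia)).trans (Fin.eq_one_of_ne_zero _ (hy i (by lia))).symm

theorem IsRenewalMeasure.continuous_returnPotential (hν : IsRenewalMeasure ν 0)
    (hd : ∀ b, Tendsto (fun m => returnPotential ν 0 τ d (zeroAfter hB b m)) atTop (𝓝 (d b))) :
    Continuous (returnPotential ν 0 τ d) := by
  classical
  refine continuous_iff_continuousAt.2 fun y => ?_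
  by_cases hy : ∃ m, y.1 (m + 1) = 0
  · obtain ⟨m, hm⟩ := hy
    exact hν.continuousAt_returnPotential hm
  have hval := returnPotential_of_forall_ne (ν := ν) (τ := τ) (d := d) (not_exists.1 hy)
  refine Metric.continuousAt_iff'.2 fun ε hε => ?_
  obtain ⟨n, hn⟩ := Metric.tendsto_atTop.1 (hd (y.1 0)) ε hε
  filter_upwards [cylinder_mem_nhds y (n + 3)] with z hz
  have hz0 : z.1 0 = y.1 0 := hz 0 (Nat.succ_pos _)
  by_cases hvisit : ∃ m, z.1 (m + 1) = 0
  · have hfirst := Nat.find_spec hvisit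
    have hlt : n + 1 < Nat.find hvisit := by
      by_contra hle
      exact hy ⟨_, (hz (Nat.find hvisit + 1) (by lia)).symm.trans hfirst⟩
    obtain ⟨m, hm⟩ := Nat.exists_eq_add_of_lt hlt
    have hfirst' : z.1 (n + 1 + m + 1 + 1) = 0 := hm ▸ hfirst
    have hmem := mem_cylinder_zeroAfter hB (y := z) (m := n + 1 + m) hfirst'
      fun i hi => Nat.find_min hvisit (by lia)
    rw [hval, ← hν.returnPotential_congr hfirst' hmem, hz0]
    exact hn _ (by lia)
  · rwa [returnPotential_of_forall_ne (not_exists.1 hvisit), hval, hz0, dist_self]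

variable {g : ℕ → SFT B → ℝ} {c : ℝ} {C : ℕ → ℝ} {l r : Fin 3 → ℝ} {N : Matrix (Fin 3) (Fin 3) ℝ}

lemma IsComparable.exists_tendsto_log_sub (h : IsComparable g ν τ c) (hν : IsRenewalMeasure ν 0)
    (hC : IsAdditiveUpTo g C) (hP : IsHiddenMarkov (symbolMatrix code N) l r)
    (hcyl : ∀ n (y : SFT B),
      ν.real (cylinder y n) = wordWeight (symbolMatrix code N) l r (prefixWord n y))
    (hN : ∀ i j, 0 ≤ N i j) (hreg : HasRegularBlock N) (b : Fin 2) :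
    ∃ L, Tendsto (fun m => Real.log (ν.real (cylinder (zeroAfter hB b m) (m + 3))) -
      Real.log (ν.real (cylinder (zeroAt hB (m + 1)) (m + 2)))) atTop (𝓝 L) := by
  obtain ⟨T, δ, hδ, hrec⟩ :=
    hreg.exists_recurrence hN (sum_symbolMatrix code N ▸ hP.vecMul_sum) r
  refine exists_tendsto_log_sub_of_recurrence (τ := T) (δ := δ)
    (K := C 1 + 3 * c + |Real.log (ν.real (cylinder (zeroAfter hB b 0) 1))|)
    (fun m => hν.pos _ _) (fun m => hν.pos _ _) (fun m => ?_) (fun m => ?_) hδ (fun m => ?_)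
  · simpa only [hcyl, wordWeight_prefixWord_zeroAt] using hrec l (Or.inl rfl) m
  · simpa only [hcyl, wordWeight_prefixWord_zeroAfter] using hrec _ (Or.inr ⟨b, rfl⟩) m
  · have hadd := abs_le.1 <| h.abs_log_measureReal_cylinder_le hC le_rfl (Nat.le_add_left 1 (m + 1))
      (zeroAfter hB b m)
    have hfirst : cylinder (zeroAfter hB b m) 1 = cylinder (zeroAfter hB b 0) 1 :=
      cylinder_eq_of_mem (mem_cylinder_one_iff.2 rfl)
    rw [Function.iterate_one, shift_zeroAfter, hfirst, add_comm 1 (m + 1 + 1)] at hadd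
    have hlog := abs_le.1 (le_refl |Real.log (ν.real (cylinder (zeroAfter hB b 0) 1))|)
    exact abs_le.2 ⟨by linarith, by linarith⟩

lemma IsComparable.tendsto_log_measureReal_zeroAt_div (h : IsComparable g ν τ c)
    (hC : IsAdditiveUpTo g C) (hlim : Tendsto (fun n : ℕ => C n / n) atTop (𝓝 0)) {α : ℝ}
    (hα : ∀ n : ℕ, 1 ≤ n → |Real.log (g n (onePoint hB)) - n * α| ≤ C n) :
    Tendsto (fun n : ℕ => Real.log (ν.real (cylinder (zeroAt hB n) (n + 1))) / n) atTop
      (𝓝 (α - τ)) := by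
  set K := |Real.log (ν.real (cylinder (zeroAt hB 0) 1))| + 4 * c
  have hsub : Tendsto (fun n : ℕ => (2 * C n + K) / n) atTop (𝓝 0) := by
    simpa only [add_div, mul_div_assoc, mul_zero, add_zero] using
      (hlim.const_mul 2).add (tendsto_const_div_atTop_nhds_zero_nat K)
  refine tendsto_div_of_abs_sub_mul_le hsub fun n hn => ?_
  have hones : cylinder (zeroAt hB n) n = cylinder (onePoint hB) n :=
    cylinder_eq_of_mem fun i hi => if_neg hi.ne
  have hzero : (shift B)^[n] (zeroAt hB n) = zeroAt hB 0 :=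
    shift_iterate_eq_zeroAt hB (if_pos rfl) fun i hi => if_neg hi.ne'
  have hadd := abs_le.1 (h.abs_log_measureReal_cylinder_le hC hn le_rfl (zeroAt hB n))
  rw [hones, hzero] at hadd
  have hcomp := abs_le.1 (h n hn (onePoint hB)).2
  have hα' := abs_le.1 (hα n hn)
  have hfirst := abs_le.1 (le_refl |Real.log (ν.real (cylinder (zeroAt hB 0) 1))|)
  exact abs_le.2 ⟨by linarith, by linarith⟩

theorem IsComparable.exists_continuous_returnPotential (h : IsComparable g ν τ c)
    (hν : IsRenewalMeasure ν 0) (hC : IsAdditiveUpTo g C)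
    (hlim : Tendsto (fun n : ℕ => C n / n) atTop (𝓝 0))
    (hP : IsHiddenMarkov (symbolMatrix code N) l r)
    (hcyl : ∀ n (y : SFT B),
      ν.real (cylinder y n) = wordWeight (symbolMatrix code N) l r (prefixWord n y))
    (hN : ∀ i j, 0 ≤ N i j) (hreg : HasRegularBlock N) {α : ℝ}
    (hα : ∀ n : ℕ, 1 ≤ n → |Real.log (g n (onePoint hB)) - n * α| ≤ C n) :
    ∃ d : Fin 2 → ℝ, d 1 = α ∧ Continuous (returnPotential ν 0 τ d) := by
  choose L hL using h.exists_tendsto_log_sub hB hν hC hP hcyl hN hreg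
  have hlog : Tendsto (fun n => Real.log (ν.real (cylinder (zeroAt hB (n + 1)) (n + 1 + 1))) -
      Real.log (ν.real (cylinder (zeroAt hB n) (n + 1)))) atTop (𝓝 (L 1)) := by
    have h1 := hL 1
    simp only [zeroAfter_one] at h1
    exact (tendsto_add_atTop_iff_nat 1).1 h1
  have hL1 : L 1 = α - τ := tendsto_nhds_unique (tendsto_div_of_tendsto_sub hlog)
    (h.tendsto_log_measureReal_zeroAt_div hB hC hlim hα)
  refine ⟨fun b => τ + L b, (congrArg (τ + ·) hL1).trans (add_sub_cancel τ α),
    hν.continuous_returnPotential hB fun b => ((hL b).const_add τ).congr fun m => ?_⟩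
  have hvisit : (zeroAfter hB b m).1 (m + 1 + 1) = 0 := by simp [zeroAfter]
  rw [hν.returnPotential_eq hvisit, shift_zeroAfter, add_sub_assoc]

theorem IsComparable.gibbs_of_exists_returnPotential (h : IsComparable g ν τ c)
    (hν : IsRenewalMeasure ν 0) {p : (SFT B → ℝ) → Prop}
    (hp : ∀ (C : ℕ → ℝ) (α : ℝ), IsAdditiveUpTo g C →
      Tendsto (fun n : ℕ => C n / n) atTop (𝓝 0) →
      (∀ n : ℕ, 1 ≤ n → |Real.log (g n (onePoint hB)) - n * α| ≤ C n) →
      ∃ d : Fin 2 → ℝ, d 1 = α ∧ p (returnPotential ν 0 τ d)) :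
    (AlmostAdditive g ↔ ∃ g' : SFT B → ℝ, p g' ∧ Approximates g g' ∧
      ∃! ν : Measure (SFT B), IsInvariant ν ∧ IsGibbs ν g') ∧
    (WeaklyAlmostAdditive g → ∃ g' : SFT B → ℝ, p g' ∧ Approximates g g' ∧
      ∃! ν : Measure (SFT B), IsInvariant ν ∧ IsWeakGibbs ν g') := by
  have hpotential {C : ℕ → ℝ} (hC : IsAdditiveUpTo g C)
      (hlim : Tendsto (fun n : ℕ => C n / n) atTop (𝓝 0)) :
      ∃ g', p g' ∧ ∃ K : ℝ, ∀ E : ℕ → ℝ, (∀ k n, k ≤ n → C k ≤ E n) → ∀ n, 1 ≤ n → ∀ y,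
        |Real.log (g n y) - birkhoffSum (shift B) g' n y| ≤ 2 * E n + K := by
    obtain ⟨α, hα⟩ := exists_forall_abs_sub_mul_le
      (a := fun n => Real.log (g n (onePoint hB))) (C := C) fun n m hn hm => by
        simpa only [shift_iterate_onePoint] using hC n m hn hm (onePoint hB)
    obtain ⟨d, rfl, hd⟩ := hp C α hC hlim hα
    exact ⟨_, hd, h.exists_abs_log_sub_birkhoffSum_le hB hν hC hα⟩
  refine ⟨⟨fun hg => ?_, ?_⟩, fun hg => ?_⟩
  · obtain ⟨C, hC⟩ := h.almostAdditive_iff.1 hg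
    obtain ⟨g', hg', K, hK⟩ := hpotential hC (tendsto_const_div_atTop_nhds_zero_nat C)
    exact ⟨g', hg', h.existsUnique_isGibbs hν (hK (fun _ => C) fun _ _ _ => le_rfl)⟩
  · rintro ⟨g', -, happrox, ν', ⟨hinv, hGibbs⟩, -⟩
    exact h.almostAdditive_of_isGibbs hν happrox hinv hGibbs
  · obtain ⟨C, hlim, hC⟩ := h.exists_isAdditiveUpTo hg
    obtain ⟨E, hE, hElim⟩ := exists_sublinear_majorant hlim
    obtain ⟨g', hg', K, hK⟩ := hpotential hC hlim
    refine ⟨g', hg', h.existsUnique_isWeakGibbs hν (E := fun n => 2 * E n + K) ?_ (hK E hE)⟩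
    simpa only [add_div, mul_div_assoc, mul_zero, add_zero] using
      (hElim.const_mul 2).add (tendsto_const_div_atTop_nhds_zero_nat K)

end Continuity

end RelPressure

theorem corollary4p11
    (A : Matrix (Fin 3) (Fin 3) ℕ) (hA : ∀ i j, A i j = 0 ∨ A i j = 1)
    (hirr : RelPressure.IsIrreducible (RelPressure.SFT A))
    (B : Matrix (Fin 2) (Fin 2) ℕ) (hB : B = !![1, 1; 1, 1] ∨ B = !![0, 1; 1, 1])
    (π : RelPressure.SFT A → RelPressure.SFT B)
    (hπ : RelPressure.IsFactorMap π) (hcode : RelPressure.IsOneBlockCode π RelPressure.code)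
    (f : RelPressure.SFT A → ℝ) (φ : Fin 3 → Fin 3 → ℝ)
    (hf : ∀ x : RelPressure.SFT A, f x = φ (x.1 0) (x.1 1))
    (g : ℕ → RelPressure.SFT B → ℝ) (hg : g = RelPressure.relSeq RelPressure.code f) :
    ((RelPressure.AlmostAdditive g ↔
        ∃ g' : RelPressure.SFT B → ℝ, Measurable g' ∧ RelPressure.Approximates g g' ∧
          ∃! ν : MeasureTheory.Measure (RelPressure.SFT B),
            RelPressure.IsInvariant ν ∧ RelPressure.IsGibbs ν g') ∧
      (RelPressure.WeaklyAlmostAdditive g →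
        ∃ g' : RelPressure.SFT B → ℝ, Measurable g' ∧ RelPressure.Approximates g g' ∧
          ∃! ν : MeasureTheory.Measure (RelPressure.SFT B),
            RelPressure.IsInvariant ν ∧ RelPressure.IsWeakGibbs ν g')) ∧
    (((¬ ∃ a₁ a₂ : ℝ, 0 < a₁ ∧ 0 < a₂ ∧ RelPressure.block22 A φ = !![0, a₁; a₂, 0]) ∨
        ((∃ a₁ : ℝ, 0 < a₁ ∧ RelPressure.block22 A φ = !![0, a₁; a₁, 0]) ∧
          (RelPressure.weightMatrix A φ 1 0 = RelPressure.weightMatrix A φ 2 0 ∨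
            RelPressure.weightMatrix A φ 0 1 = RelPressure.weightMatrix A φ 0 2))) →
      (RelPressure.AlmostAdditive g ↔
        ∃ g' : RelPressure.SFT B → ℝ, Continuous g' ∧ RelPressure.Approximates g g' ∧
          ∃! ν : MeasureTheory.Measure (RelPressure.SFT B),
            RelPressure.IsInvariant ν ∧ RelPressure.IsGibbs ν g') ∧
      (RelPressure.WeaklyAlmostAdditive g →
        ∃ g' : RelPressure.SFT B → ℝ, Continuous g' ∧ RelPressure.Approximates g g' ∧
          ∃! ν : MeasureTheory.Measure (RelPressure.SFT B),
            RelPressure.IsInvariant ν ∧ RelPressure.IsWeakGibbs ν g')) := by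
  have hB' : ∀ i j, i = 1 ∨ j = 1 → B i j = 1 := by
    rcases hB with rfl | rfl <;> simp [Fin.forall_fin_two]
  have hps : ∀ i, RelPressure.code i = 0 ↔ i = 0 := by decide
  obtain ⟨x, hx⟩ := hπ.surjective (RelPressure.zeroAt hB' 0)
  have hx0 : x.1 0 = 0 :=
    (hps _).1 <| (hcode x 0).symm.trans (congrArg (fun y => y.1 0) hx)
  obtain ⟨ν, t, c, l, r, ht, hν, h, hP, hcyl⟩ :=
    RelPressure.exists_isRenewalMeasure_isComparable hirr hπ.surjective hcode hf ⟨x, hx0⟩ hps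
  subst hg
  exact ⟨h.gibbs_of_exists_returnPotential hB' hν fun _ α _ _ _ =>
      ⟨fun _ => α, rfl, hν.measurable_returnPotential⟩,
    fun hreg => h.gibbs_of_exists_returnPotential hB' hν fun _ _ hC hlim hα =>
      h.exists_continuous_returnPotential hB' hν hC hlim hP hcyl
        (RelPressure.normalizedWeight_nonneg φ ht.le)
        (RelPressure.HasRegularBlock.smul hreg (inv_pos.2 ht)) hα⟩
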